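/- **Setup.** Write $[\![a,b]\!]=\{a,a+1,\dots,b\}$. Let $N\in\mathbb N$, $k\in[\![1,N]\!]$, $M\in\mathbb Z_{\ge 0}$, $\theta>0$. Let $\mathfrak X^{\theta,M}_{N,k}$ be the set of $\ell=(\ell^N,\dots,\ell^k)$ with $\ell^j_i=\lambda^j_i-i\theta$ for $j\in[\![k,N]\!]$, $i\in[\![1,j]\!]$, where the $\lambda^j_i$ are integers with $M\ge\lambda^j_1\ge\cdots\ge\lambda^j_j\ge 0$ and $\lambda^{j+1}_i\ge\lambda^j_i\ge\lambda^{j+1}_{i+1}$. Let $w_N$ be a positive function on $[-N\theta,M-\theta]$, and let $\mathbb P=\mathbb P^{\theta,M}_{N,k}$ be the probability measure on $\mathfrak X^{\theta,M}_{N,k}$ with $\mathbb P(\ell)=Z^{-1}H^t(\ell^N)H^b(\ell^k)\prod_{j=k}^{N-1}I(\ell^{j+1},\ell^j)$, where $Z$ is the normalization constant and $$H^t(\ell^N)=\prod_{1\le p<q\le N}\frac{\Gamma(\ell^N_p-\ell^N_q+1)}{\Gamma(\ell^N_p-\ell^N_q+1-\theta)}\prod_{p=1}^N w_N(\ell^N_p),\qquad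 H^b(\ell^k)=\prod_{1\le p<q\le k}\frac{\Gamma(\ell^k_p-\ell^k_q+\theta)}{\Gamma(\ell^k_p-\ell^k_q)},$$ $$I(\ell^{j+1},\ell^j)=\prod_{1\le p<q\le j+1}\frac{\Gamma(\ell^{j+1}_p-\ell^{j+1}_q+1-\theta)}{\Gamma(\ell^{j+1}_p-\ell^{j+1}_q)}\prod_{1\le p<q\le j}\frac{\Gamma(\ell^j_p-\ell^j_q+1)}{\Gamma(\ell^j_p-\ell^j_q+\theta)}\prod_{1\le p<q\le j+1}\frac{\Gamma(\ell^j_p-\ell^{j+1}_q)}{\Gamma(\ell^j_p-\ell^{j+1}_q+1-\theta)}\prod_{1\le p\le q\le j}\frac{\Gamma(\ell^{j+1}_p-\ell^j_q+\theta)}{\Gamma(\ell^{j+1}_p-\ell^j_q+1)}.$$ Suppose that $\mathcal M\subseteq\mathbb C$ is open, $[-N\theta,M+1-\theta]\subseteq\mathcal M$, and $\Phi_N^+,\Phi_N^-$ are holomorphic functions on $\mathcal M$ such that $$\frac{w_N(x)}{w_N(x-1)}=\frac{\Phi^+_N(x)}{\Phi^-_N(x)}\qquad\text{for all } x\in[-N\theta+1,M-\theta]$$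 (in particular $\Phi^\pm_N$ do not vanish at these $x$). Let $L>0$, let $m_j\in\mathbb Z_{\ge 0}$ for $j\in[\![k,N]\!]$, and let $v^j_i\in\mathbb C$ satisfy $Lv^j_i\in\mathcal M\setminus[-N\theta,M-\theta]$ for $j\in[\![k,N]\!]$, $i\in[\![1,m_j]\!]$. Let $\Gamma$ be a positively oriented simple closed piecewise $C^1$ contour which, together with the region it encloses, is contained in $L^{-1}\mathcal M$. Suppose that $\Gamma$ encloses $[-\theta N/L,(M-\theta)/L]$, and that all points $v_i^j$ and $v_i^j+L^{-1}$ lie outside of $\Gamma$. Let $v\in\mathbb C$ lie outside of $\Gamma$, and put $$S_v(Lz)=\frac{L(z-v)}{(Lz+N\theta)(Lz-M-1+\theta)},\qquad G^j_L(z)=\sum_{i=1}^j\frac1{z-\ell^j_i/L}.$$ For bounded complex random variables, $M(X_1,\dots,X_n)=\frac{\partial^n}{\partial z_1\cdots\partial z_n}\log\mathbb E\big[e^{\sum_i z_iX_i}\big]\big|_{z=0}$ denotes their joint cumulant with respect to $\mathbb P$. For $F_r\subseteq[\![1,m_r]\!]$, $r\in[\![k,N]\!]$, let $M(\xi;F)=M(\xi;F_k,\dots,F_N)$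 be the joint cumulant of $\xi$ and all $G^j_L(v^j_i)$ with $j\in[\![k,N]\!]$, $i\in F_j$. Let $F_i^c=[\![1,m_i]\!]\setminus F_i$, and for $j\in[\![k,N+1]\!]$ $$\mathbf 1_{<j}(F)=\prod_{i=k}^{j-1}\mathbf 1\{F_i=[\![1,m_i]\!]\},\qquad K_j(F;z)=\prod_{i=j}^N\prod_{f\in F_i^c}\frac1{L(v^i_f-z)(v^i_f-z+L^{-1})}.$$ **Lemma.** If $\theta\ne1$, then $$0=\sum_{\substack{F_r\subseteq[\![1,m_r]\!]\\ r=k,\dots,N}}\Bigg\{\mathbf 1_{<N+1}(F)\oint_\Gamma\frac{\Phi_N^-(Lz)\,dz}{2\pi\mathsf i\,S_v(Lz)}\,M\Big(\prod_{p=1}^N\frac{Lz-\ell^N_p-\theta}{Lz-\ell^N_p};F\Big)+\oint_\Gamma\frac{\Phi_N^+(Lz)\,dz}{2\pi\mathsf i\,S_v(Lz)}K_k(F;z)\,M\Big(\prod_{p=1}^k\frac{Lz-\ell^k_p+\theta-1}{Lz-\ell^k_p-1};F\Big)$$ $$+\frac{\theta}{1-\theta}\sum_{j=k+1}^N\mathbf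 1_{<j}(F)\oint_\Gamma\frac{\Phi_N^+(Lz)\,dz}{2\pi\mathsf i\,S_v(Lz)}K_j(F;z)\,M\Big(\prod_{p=1}^j\frac{Lz-\ell^j_p-\theta}{Lz-\ell^j_p-1}\prod_{p=1}^{j-1}\frac{Lz-\ell^{j-1}_p+\theta-1}{Lz-\ell^{j-1}_p};F\Big)\Bigg\}.$$ If $\theta=1$, then $$0=\sum_{\substack{F_r\subseteq[\![1,m_r]\!]\\ r=k,\dots,N}}\Bigg\{\mathbf 1_{<N+1}(F)\oint_\Gamma\frac{\Phi_N^-(Lz)\,dz}{2\pi\mathsf i\,S_v(Lz)}\,M\Big(\prod_{p=1}^N\frac{Lz-\ell^N_p-1}{Lz-\ell^N_p};F\Big)+\oint_\Gamma\frac{\Phi_N^+(Lz)\,dz}{2\pi\mathsf i\,S_v(Lz)}K_k(F;z)\,M\Big(\prod_{p=1}^k\frac{Lz-\ell^k_p}{Lz-\ell^k_p-1};F\Big)$$ $$+\sum_{j=k+1}^N\mathbf 1_{<j}(F)\oint_\Gamma\frac{\Phi_N^+(Lz)\,dz}{2\pi\mathsf i\,S_v(Lz)}K_j(F;z)\,M\Big(\sum_{p=1}^j\frac1{Lz-\ell^j_p-1}-\sum_{p=1}^{j-1}\frac1{Lz-\ell^{j-1}_p};F\Big)\Bigg\}.$$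 (If $(M+1-\theta)/L$ lies on $\Gamma$, the integrands have a removable singularity there.) -/

import Mathlib

noncomputable section

namespace BetaCorners

/-! ### Closed contours in the complex plane -/

/-- The trace of a curve parametrized by `[0, 1]`. -/
def trace (γ : ℝ → ℂ) : Set ℂ := γ '' Set.Icc 0 1

/-- The points enclosed by the curve: those off the curve whose connected component in the
complement of the curve is bounded. -/
def inside (γ : ℝ → ℂ) : Set ℂ :=
  {z | z ∈ (trace γ)ᶜ ∧ Bornology.IsBounded (connectedComponentIn (trace γ)ᶜ z)}

/-- The points outside of the curve: those off the curve whose connected component in the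
complement of the curve is unbounded. -/
def outside (γ : ℝ → ℂ) : Set ℂ :=
  {z | z ∈ (trace γ)ᶜ ∧ ¬ Bornology.IsBounded (connectedComponentIn (trace γ)ᶜ z)}

/-- The contour integral `∮_γ f(z) dz` of a piecewise `C¹` curve parametrized by `[0, 1]`. -/
def contourIntegral (γ : ℝ → ℂ) (f : ℂ → ℂ) : ℂ :=
  ∫ t in (0 : ℝ)..1, f (γ t) * deriv γ t

/-- The winding number of the closed curve `γ` about `z`. -/
def windingNumber (γ : ℝ → ℂ) (z : ℂ) : ℂ :=
  (2 * Real.pi * Complex.I)⁻¹ * contourIntegral γ (fun ζ => 1 / (ζ - z))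

/-- `γ`, restricted to `[0, 1]`, is piecewise continuously differentiable. -/
def PiecewiseC1 (γ : ℝ → ℂ) : Prop :=
  ContinuousOn γ (Set.Icc 0 1) ∧
  ∃ (n : ℕ) (t : Fin (n + 1) → ℝ), StrictMono t ∧ t 0 = 0 ∧ t (Fin.last n) = 1 ∧
    ∀ i : Fin n, ContDiffOn ℝ 1 γ (Set.Icc (t i.castSucc) (t i.succ))

/-- Positively oriented simple (closed, piecewise `C¹`) contours. -/
structure IsPositiveSimpleContour (γ : ℝ → ℂ) : Prop where
  piecewiseC1 : PiecewiseC1 γ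
  closed : γ 0 = γ 1
  simple : Set.InjOn γ (Set.Ico 0 1)
  positive : ∀ z ∈ inside γ, windingNumber γ z = 1

/-! ### Joint cumulants on a finite probability space -/

/-- Expectation of a complex random variable on a finite space with point masses `P`. -/
def expect {Ω : Type*} [Fintype Ω] (P : Ω → ℝ) (X : Ω → ℂ) : ℂ :=
  ∑ ω, (P ω : ℂ) * X ω

/-- The logarithm `z ↦ log 𝔼[exp (∑ i, z i * X i)]`. -/
def logMGF {Ω ι : Type*} [Fintype Ω] [Fintype ι] (P : Ω → ℝ) (X : ι → Ω → ℂ)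
    (z : ι → ℂ) : ℂ :=
  Complex.log (expect P (fun ω => Complex.exp (∑ i, z i * X i ω)))

/-- The joint cumulant `M((X i)_{i ∈ ι})`: the mixed partial derivative at the origin of
`logMGF P X`, taken once in each of the variables `z i`, `i ∈ ι`. Since `logMGF P X` is
analytic near the origin, the order of differentiation is immaterial. -/
def jointCumulant {Ω ι : Type*} [Fintype Ω] [Fintype ι] [DecidableEq ι]
    (P : Ω → ℝ) (X : ι → Ω → ℂ) : ℂ :=
  iteratedFDeriv ℂ (Fintype.card ι) (logMGF P X) 0
    (fun a => Pi.single ((Fintype.equivFin ι).symm a) 1)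

/-! ### Discrete `β`-corners processes -/

/-- The set of levels `{k, …, N}`. -/
abbrev Level (k N : ℕ) : Type := Finset.Icc k N

/-- The state space, through the integer coordinates: for every level `j ∈ {k, …, N}` a weakly
decreasing row `M ≥ λ^j_1 ≥ ⋯ ≥ λ^j_j ≥ 0`, such that consecutive rows interlace,
`λ^{j+1}_p ≥ λ^j_p ≥ λ^{j+1}_{p+1}`. Rows are indexed from `0`. -/
def State (N k M : ℕ) : Type :=
  {lam : (j : Level k N) → Fin j.1 → Fin (M + 1) //
    (∀ j, Antitone (lam j)) ∧
    ∀ (j : ℕ) (hj : j ∈ Finset.Icc k N) (hj' : j + 1 ∈ Finset.Icc k N) (p : Fin j),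
      lam ⟨j, hj⟩ p ≤ lam ⟨j + 1, hj'⟩ p.castSucc ∧
      lam ⟨j + 1, hj'⟩ p.succ ≤ lam ⟨j, hj⟩ p}

instance (N k M : ℕ) : Fintype (State N k M) := by
  classical
  unfold State
  infer_instance

/-- The particle locations `ℓ^j_p = λ^j_p - p θ` (with `p` counted from `1`) on the level
`j ∈ {k, …, N}`; the value for other `j` is never used. -/
def row {N k M : ℕ} (θ : ℝ) (ω : State N k M) (j : ℕ) (p : Fin j) : ℝ :=
  if h : j ∈ Finset.Icc k N then ((ω.1 ⟨j, h⟩ p : ℕ) : ℝ) - ((p : ℕ) + 1) * θ else 0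

/-- The interaction `I(ℓ^{j+1}, ℓ^j)` of two consecutive levels, `x = ℓ^{j+1}`, `y = ℓ^j`. -/
def interaction (θ : ℝ) {j : ℕ} (x : Fin (j + 1) → ℝ) (y : Fin j → ℝ) : ℝ :=
  (∏ p : Fin (j + 1), ∏ q ∈ Finset.Ioi p,
      Real.Gamma (x p - x q + 1 - θ) / Real.Gamma (x p - x q)) *
  (∏ p : Fin j, ∏ q ∈ Finset.Ioi p,
      Real.Gamma (y p - y q + 1) / Real.Gamma (y p - y q + θ)) *
  (∏ p : Fin j, ∏ q ∈ Finset.Ioi p.castSucc,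
      Real.Gamma (y p - x q) / Real.Gamma (y p - x q + 1 - θ)) *
  (∏ p : Fin j, ∏ q ∈ Finset.Ici p,
      Real.Gamma (x p.castSucc - y q + θ) / Real.Gamma (x p.castSucc - y q + 1))

/-- The top-level factor `H^t(ℓ^N)` with weight `w = w_N`. -/
def topFactor (θ : ℝ) (w : ℝ → ℝ) {N : ℕ} (x : Fin N → ℝ) : ℝ :=
  (∏ p : Fin N, ∏ q ∈ Finset.Ioi p,
      Real.Gamma (x p - x q + 1) / Real.Gamma (x p - x q + 1 - θ)) * ∏ p : Fin N, w (x p)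

/-- The bottom-level factor `H^b(ℓ^k)`. -/
def bottomFactor (θ : ℝ) {k : ℕ} (x : Fin k → ℝ) : ℝ :=
  ∏ p : Fin k, ∏ q ∈ Finset.Ioi p,
    Real.Gamma (x p - x q + θ) / Real.Gamma (x p - x q)

/-- The unnormalized weight of a configuration. -/
def weight {N k M : ℕ} (θ : ℝ) (w : ℝ → ℝ) (ω : State N k M) : ℝ :=
  topFactor θ w (row θ ω N) * bottomFactor θ (row θ ω k) *
    ∏ j ∈ Finset.Ico k N, interaction θ (row θ ω (j + 1)) (row θ ω j)

/-- The probability `ℙ(ℓ^N, …, ℓ^k)` of a configuration. -/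
def prob {N k M : ℕ} (θ : ℝ) (w : ℝ → ℝ) (ω : State N k M) : ℝ :=
  weight θ w ω / ∑ ω' : State N k M, weight θ w ω'

/-- The Stieltjes transform `G_L^j(z) = ∑_p 1 / (z - ℓ^j_p / L)`. -/
def stieltjes {N k M : ℕ} (θ L : ℝ) (j : ℕ) (z : ℂ) (ω : State N k M) : ℂ :=
  ∑ p : Fin j, 1 / (z - ((row θ ω j p / L : ℝ) : ℂ))

/-! ### The terms of the cumulant identities -/

/-- `M(ξ; F_k, …, F_N)`: the joint cumulant of `ξ` and all `G_L^j(v^j_i)` with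
`j ∈ {k, …, N}`, `i ∈ F_j`. The index `none` stands for `ξ`. -/
def cumulantWith {N k M : ℕ} (θ L : ℝ) (w : ℝ → ℝ) {m : ℕ → ℕ}
    (v : (j : ℕ) → Fin (m j) → ℂ) (F : (j : Level k N) → Finset (Fin (m j.1)))
    (ξ : State N k M → ℂ) : ℂ :=
  jointCumulant (ι := Option {s : (j : Level k N) × Fin (m j.1) // s.2 ∈ F s.1}) (prob θ w)
    (fun o => match o with
      | none => ξ
      | some s => stieltjes θ L s.1.1.1 (v s.1.1.1 s.1.2))

/-- `∏_{i = k}^{j - 1} 1{F_i = {1, …, m_i}}`. -/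
def fullBelow {N k : ℕ} {m : ℕ → ℕ} (F : (j : Level k N) → Finset (Fin (m j.1)))
    (j : ℕ) : ℂ :=
  ∏ i : Level k N with i.1 < j, if F i = Finset.univ then 1 else 0

/-- `∏_{i = j}^{N} ∏_{f ∈ F_i^c} 1 / (L (v^i_f - z) (v^i_f - z + L⁻¹))`. -/
def kernelFrom {N k : ℕ} (L : ℝ) {m : ℕ → ℕ} (v : (j : ℕ) → Fin (m j) → ℂ)
    (F : (j : Level k N) → Finset (Fin (m j.1))) (j : ℕ) (z : ℂ) : ℂ :=
  ∏ i : Level k N with j ≤ i.1, ∏ f ∈ (F i)ᶜ,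
    1 / ((L : ℂ) * (v i.1 f - z) * (v i.1 f - z + (L : ℂ)⁻¹))

/-- `S_v(u) = (u - L v) / ((u + N θ) (u - M - 1 + θ))`, so that
`S_v(L z) = L (z - v) / ((L z + N θ) (L z - M - 1 + θ))`. -/
def auxS (N M : ℕ) (θ L : ℝ) (v u : ℂ) : ℂ :=
  (u - L * v) / ((u + N * θ) * (u - M - 1 + θ))

/-- `∏_{p = 1}^N (u - ℓ^N_p - θ) / (u - ℓ^N_p)`. -/
def topObs {N k M : ℕ} (θ : ℝ) (u : ℂ) (ω : State N k M) : ℂ :=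
  ∏ p : Fin N, (u - row θ ω N p - θ) / (u - row θ ω N p)

/-- `∏_{p = 1}^k (u - ℓ^k_p + θ - 1) / (u - ℓ^k_p - 1)`. -/
def bottomObs {N k M : ℕ} (θ : ℝ) (u : ℂ) (ω : State N k M) : ℂ :=
  ∏ p : Fin k, (u - row θ ω k p + θ - 1) / (u - row θ ω k p - 1)

/-- With `j = n + 1`:
`∏_{p = 1}^j (u - ℓ^j_p - θ) / (u - ℓ^j_p - 1) *
  ∏_{p = 1}^{j-1} (u - ℓ^{j-1}_p + θ - 1) / (u - ℓ^{j-1}_p)`. -/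
def middleObs {N k M : ℕ} (θ : ℝ) (n : ℕ) (u : ℂ) (ω : State N k M) : ℂ :=
  (∏ p : Fin (n + 1), (u - row θ ω (n + 1) p - θ) / (u - row θ ω (n + 1) p - 1)) *
    ∏ p : Fin n, (u - row θ ω n p + θ - 1) / (u - row θ ω n p)

/-- With `j = n + 1`:
`∑_{p = 1}^j 1 / (u - ℓ^j_p - 1) - ∑_{p = 1}^{j-1} 1 / (u - ℓ^{j-1}_p)`. -/
def middleObsOne {N k M : ℕ} (θ : ℝ) (n : ℕ) (u : ℂ) (ω : State N k M) : ℂ :=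
  (∑ p : Fin (n + 1), 1 / (u - row θ ω (n + 1) p - 1)) -
    ∑ p : Fin n, 1 / (u - row θ ω n p)

end BetaCorners

end

section

open Set Filter Topology MeasureTheory
namespace BetaCorners

/-! ### Integration along piecewise `C¹` curves -/

/-! The identity is a loop equation. In the variable `u = L z` the integrands can only have poles at
particle sites and at sites shifted by one. At each such point `X` the residues, summed over all
observables and all `F`, cancel, so Cauchy's theorem applies to the total integrand.

The weight is a product over a chain of edges `k, ..., N + 1`: the bottom factor, the interactions
and the top factor, each carrying one observable. Up to the common factor `θ`, the residue of the
edge `j` at `X` consists of terms with `ℓ^j_p + 1 = X` (`upFactor`) minus terms with `ℓ^{j-1}_p = X`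
(`downFactor`). These cancel in pairs between different states: starting at level `j`, the particle
`p` is raised by one on the maximal run of levels `j ≤ i < β` on which it sits at `X - 1`
(`IsShift`), and the up term of the old state at `j` equals the down term of the new state at `β`.
By `Γ(z + 1) = z Γ(z)` the weight changes by rational factors. Those of a moved level on its two
adjacent edges compensate through `skew`, so only the edges `j` and `β` survive
(`IsShift.weight_mul_eq`). If `β = N + 1`, the ratio `w X / w (X - 1)` appears and turns `Φ⁻` into
`Φ⁺`. A move blocked by a neighbour has residue zero; a move blocked by a wall needs `X = -Nθ` or `X
= M + 1 - θ`, where `1 / S_v` vanishes. This gives `sum_upFactor_eq_sum_downFactor`.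

The cumulant `M(ξ; F)` is linear in `ξ`, with coefficients built from the inverse of the moments
under subset convolution (`jointCumulant_eq_sum`). Summing over `F` against the kernels `κ`
assembles products of `G + κ` (`sum_prod_compl_mul`), and `G + κ` takes the same value at both ends
of a shift (`IsShift.param_add_edgeKernel`). Hence the pairing survives the insertion of the
parameters (`sum_residue_eq_zero`).

For a contour whose interior is defined by bounded components, Cauchy's theorem is proved by Dixon's
argument (`PiecewiseC1.contourIntegral_eq_zero`). Singularities lying on the contour are removable
one by one. -/

theorem PiecewiseC1.isCompact_trace {γ : ℝ → ℂ} (hγ : PiecewiseC1 γ) : IsCompact (trace γ) :=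
  isCompact_Icc.image_of_continuousOn hγ.1

theorem mem_trace {γ : ℝ → ℂ} {t : ℝ} (ht : t ∈ Icc (0 : ℝ) 1) : γ t ∈ trace γ :=
  mem_image_of_mem _ ht

theorem PiecewiseC1.exists_bound_deriv {γ : ℝ → ℂ} (hγ : PiecewiseC1 γ) :
    ∃ S : Set ℝ, S.Finite ∧ ∃ C : ℝ, 0 ≤ C ∧
      ∀ x ∈ Ioo (0 : ℝ) 1 \ S, DifferentiableAt ℝ γ x ∧ ‖deriv γ x‖ ≤ C := by
  obtain ⟨-, n, t, -, h0, h1, hC⟩ := hγ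
  have hb : ∀ i : Fin n, ∃ C : ℝ, t i.castSucc < t i.succ →
      ∀ x ∈ Icc (t i.castSucc) (t i.succ),
        ‖derivWithin γ (Icc (t i.castSucc) (t i.succ)) x‖ ≤ C := by
    intro i
    by_cases hi : t i.castSucc < t i.succ
    · obtain ⟨C, hC'⟩ := isCompact_Icc.exists_bound_of_continuousOn
        ((hC i).continuousOn_derivWithin (uniqueDiffOn_Icc hi) le_rfl)
      exact ⟨C, fun _ => hC'⟩
    · exact ⟨0, fun h => absurd h hi⟩
  choose C hC' using hb
  refine ⟨range t, finite_range t, ∑ i, |C i|, Finset.sum_nonneg fun _ _ => abs_nonneg _, ?_⟩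
  rintro x ⟨⟨hx0, hx1⟩, hxt⟩
  have hne : ∀ i, t i ≠ x := fun i hi => hxt ⟨i, hi⟩
  -- Otherwise all breakpoints would lie below `x`, by induction along the partition, although the
  -- last one is `1`.
  have : ∃ i : Fin n, t i.castSucc < x ∧ x < t i.succ := by
    by_contra! hcon
    have key : ∀ i : Fin (n + 1), t i < x := by
      intro i
      induction i using Fin.induction with
      | zero => rwa [h0]
      | succ i ih => exact lt_of_le_of_ne (hcon i ih) (hne _)
    have := key (Fin.last n)
    rw [h1] at this
    linarith
  obtain ⟨i, hi1, hi2⟩ := this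
  have hnhds : Icc (t i.castSucc) (t i.succ) ∈ 𝓝 x := Icc_mem_nhds hi1 hi2
  refine ⟨((hC i).differentiableOn one_ne_zero).differentiableAt hnhds, ?_⟩
  rw [← derivWithin_of_mem_nhds hnhds]
  refine (hC' i (hi1.trans hi2) x ⟨hi1.le, hi2.le⟩).trans ((le_abs_self _).trans ?_)
  exact Finset.single_le_sum (f := fun i => |C i|) (fun _ _ => abs_nonneg _) (Finset.mem_univ i)

theorem PiecewiseC1.exists_bound_deriv_ae {γ : ℝ → ℂ} (hγ : PiecewiseC1 γ) :
    ∃ C : ℝ, 0 ≤ C ∧ ∀ᵐ x : ℝ, x ∈ uIoc (0 : ℝ) 1 → ‖deriv γ x‖ ≤ C := by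
  obtain ⟨S, hS, C, hC0, hC⟩ := hγ.exists_bound_deriv
  refine ⟨C, hC0, ?_⟩
  have h1 : ∀ᵐ x : ℝ, x ∉ S ∪ {1} := (hS.union (finite_singleton 1)).countable.ae_notMem _
  filter_upwards [h1] with x hx hx'
  rw [uIoc_of_le zero_le_one] at hx'
  simp only [union_singleton, mem_insert_iff, not_or] at hx
  exact (hC x ⟨⟨hx'.1, lt_of_le_of_ne hx'.2 hx.1⟩, hx.2⟩).2

theorem PiecewiseC1.intervalIntegrable_deriv {γ : ℝ → ℂ} (hγ : PiecewiseC1 γ) :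
    IntervalIntegrable (deriv γ) volume 0 1 := by
  obtain ⟨C, -, hC⟩ := hγ.exists_bound_deriv_ae
  rw [intervalIntegrable_iff]
  refine Measure.integrableOn_of_bounded (M := C) (by simp) (measurable_deriv γ).aestronglyMeasurable ?_
  exact (ae_restrict_iff' measurableSet_uIoc).2 hC

theorem PiecewiseC1.intervalIntegrable_mul_deriv {γ : ℝ → ℂ} (hγ : PiecewiseC1 γ) {g : ℝ → ℂ}
    (hg : ContinuousOn g (Icc 0 1)) :
    IntervalIntegrable (fun t => g t * deriv γ t) volume 0 1 :=
  hγ.intervalIntegrable_deriv.continuousOn_mul (by rwa [uIcc_of_le zero_le_one])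

theorem PiecewiseC1.intervalIntegrable {γ : ℝ → ℂ} (hγ : PiecewiseC1 γ) {f : ℂ → ℂ}
    (hf : ContinuousOn f (trace γ)) :
    IntervalIntegrable (fun t => f (γ t) * deriv γ t) volume 0 1 :=
  hγ.intervalIntegrable_mul_deriv (hf.comp hγ.1 fun _ => mem_trace)

theorem PiecewiseC1.norm_contourIntegral_le {γ : ℝ → ℂ} (hγ : PiecewiseC1 γ) :
    ∃ C : ℝ, 0 ≤ C ∧ ∀ (f : ℂ → ℂ) (B : ℝ), (∀ ζ ∈ trace γ, ‖f ζ‖ ≤ B) →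
      ‖contourIntegral γ f‖ ≤ B * C := by
  obtain ⟨C, hC0, hC⟩ := hγ.exists_bound_deriv_ae
  refine ⟨C, hC0, fun f B hB => ?_⟩
  have := intervalIntegral.norm_integral_le_of_norm_le_const_ae (a := (0 : ℝ)) (b := 1)
    (f := fun t => f (γ t) * deriv γ t) (C := B * C) ?_
  · simpa [contourIntegral] using this
  · filter_upwards [hC] with x hx hx'
    rw [norm_mul]
    have hx2 : x ∈ Icc (0 : ℝ) 1 := by
      rw [uIoc_of_le zero_le_one] at hx'; exact ⟨hx'.1.le, hx'.2⟩
    have := hB _ (mem_trace (γ := γ) hx2)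
    exact mul_le_mul this (hx hx') (norm_nonneg _) ((norm_nonneg _).trans this)

theorem PiecewiseC1.contourIntegral_deriv_eq_zero {γ : ℝ → ℂ} (hγ : PiecewiseC1 γ)
    (hcl : γ 0 = γ 1) {f f' : ℂ → ℂ} (hf : ∀ z ∈ trace γ, HasDerivAt f (f' z) z)
    (hf' : ContinuousOn f' (trace γ)) : contourIntegral γ f' = 0 := by
  obtain ⟨S, hS, C, hC0, hC⟩ := hγ.exists_bound_deriv
  have := integral_eq_of_hasDerivAt_off_countable_of_le (fun t => f (γ t))
    (fun t => f' (γ t) * deriv γ t) zero_le_one hS.countable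
    (ContinuousOn.comp (t := trace γ) (fun z hz => (hf z hz).continuousAt.continuousWithinAt) hγ.1
      fun _ => mem_trace)
    (fun x hx => (hf _ (mem_trace ⟨hx.1.1.le, hx.1.2.le⟩)).comp x (hC x hx).1.hasDerivAt)
    (hγ.intervalIntegrable hf')
  rw [contourIntegral, this, hcl, sub_self]

theorem PiecewiseC1.contourIntegral_add {γ : ℝ → ℂ} (hγ : PiecewiseC1 γ) {f g : ℂ → ℂ}
    (hf : ContinuousOn f (trace γ)) (hg : ContinuousOn g (trace γ)) :
    contourIntegral γ (fun z => f z + g z) = contourIntegral γ f + contourIntegral γ g := by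
  simp only [contourIntegral, add_mul]
  exact intervalIntegral.integral_add (hγ.intervalIntegrable hf) (hγ.intervalIntegrable hg)

theorem contourIntegral_const_mul {γ : ℝ → ℂ} (c : ℂ) (f : ℂ → ℂ) :
    contourIntegral γ (fun z => c * f z) = c * contourIntegral γ f := by
  simp only [contourIntegral, mul_assoc]
  exact intervalIntegral.integral_const_mul _ _

theorem contourIntegral_congr {γ : ℝ → ℂ} {f g : ℂ → ℂ} (h : ∀ z ∈ trace γ, f z = g z) :
    contourIntegral γ f = contourIntegral γ g := by
  refine intervalIntegral.integral_congr fun t ht => ?_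
  rw [uIcc_of_le zero_le_one] at ht
  simp only [h _ (mem_trace ht)]

/-- Differentiation under a contour integral; no measurability of the derivative is needed. -/
theorem PiecewiseC1.hasDerivAt_contourIntegral {γ : ℝ → ℂ} (hγ : PiecewiseC1 γ)
    {φ : ℂ → ℂ → ℂ} {z₀ : ℂ} {r B : ℝ} (hr : 0 < r)
    (hb : ∀ z ∈ Metric.ball z₀ r, ∀ ζ ∈ trace γ, ‖φ z ζ‖ ≤ B)
    (hd : ∀ ζ ∈ trace γ, DifferentiableOn ℂ (fun z => φ z ζ) (Metric.ball z₀ r))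
    (hc : ∀ z ∈ Metric.ball z₀ r, ContinuousOn (φ z) (trace γ)) :
    HasDerivAt (fun z => contourIntegral γ (φ z))
      (contourIntegral γ (fun ζ => deriv (fun z => φ z ζ) z₀)) z₀ := by
  obtain ⟨C, hC0, hC⟩ := hγ.exists_bound_deriv_ae
  have hI : ∀ t ∈ uIoc (0 : ℝ) 1, t ∈ Icc (0 : ℝ) 1 := by
    intro t ht
    rw [uIoc_of_le zero_le_one] at ht
    exact ⟨ht.1.le, ht.2⟩
  have hz₀ : z₀ ∈ Metric.ball z₀ r := Metric.mem_ball_self hr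
  have hmeas : ∀ z ∈ Metric.ball z₀ r,
      AEStronglyMeasurable (fun t => φ z (γ t)) (volume.restrict (uIoc (0 : ℝ) 1)) := by
    intro z hz
    refine AEStronglyMeasurable.mono_set hI ?_
    exact ((hc z hz).comp hγ.1 fun _ => mem_trace).aestronglyMeasurable measurableSet_Icc
  have hdm : AEStronglyMeasurable (deriv γ) (volume.restrict (uIoc (0 : ℝ) 1)) :=
    (measurable_deriv γ).aestronglyMeasurable
  have hball : ∀ x ∈ Metric.ball z₀ (r / 2), Metric.closedBall x (r / 4) ⊆ Metric.ball z₀ r := by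
    intro x hx y hy
    rw [Metric.mem_ball] at hx ⊢
    rw [Metric.mem_closedBall] at hy
    have := dist_triangle y x z₀
    linarith
  have hda : ∀ ζ ∈ trace γ, ∀ x ∈ Metric.ball z₀ (r / 2),
      HasDerivAt (fun z => φ z ζ) (deriv (fun z => φ z ζ) x) x := by
    intro ζ hζ x hx
    refine ((hd ζ hζ).differentiableAt (Metric.isOpen_ball.mem_nhds ?_)).hasDerivAt
    exact Metric.ball_subset_ball (by linarith) hx
  refine (intervalIntegral.hasDerivAt_integral_of_dominated_loc_of_deriv_le
    (F := fun z t => φ z (γ t) * deriv γ t)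
    (F' := fun z t => deriv (fun z => φ z (γ t)) z * deriv γ t)
    (bound := fun _ => B / (r / 4) * C)
    (Metric.ball_mem_nhds z₀ (half_pos hr)) ?_ ?_ ?_ ?_ ?_ ?_).2
  · filter_upwards [Metric.ball_mem_nhds z₀ hr] with z hz
    exact (hmeas z hz).mul hdm
  · exact hγ.intervalIntegrable (hc z₀ hz₀)
  · refine AEStronglyMeasurable.mul ?_ hdm
    -- The derivative in the parameter is a pointwise limit of difference quotients with steps `r /
    -- 2 / (n + 1)`, and each quotient is measurable along the curve.
    have hh : ∀ n : ℕ, 0 < r / 2 / ((n : ℝ) + 1) ∧ r / 2 / ((n : ℝ) + 1) < r := by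
      intro n
      refine ⟨by positivity, ?_⟩
      rw [div_lt_iff₀ (by positivity)]
      nlinarith [(Nat.cast_nonneg n : (0 : ℝ) ≤ n)]
    have hlim : Tendsto (fun n : ℕ => ((r / 2 / ((n : ℝ) + 1) : ℝ) : ℂ)) atTop (𝓝[≠] 0) := by
      rw [tendsto_nhdsWithin_iff]
      refine ⟨?_, Eventually.of_forall fun n => ?_⟩
      · have : Tendsto (fun n : ℕ => (r / 2 / ((n : ℝ) + 1) : ℝ)) atTop (𝓝 0) :=
          tendsto_const_nhds.div_atTop
            (tendsto_atTop_add_const_right _ _ tendsto_natCast_atTop_atTop)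
        exact_mod_cast (Complex.continuous_ofReal.tendsto 0).comp this
      · exact Complex.ofReal_ne_zero.2 (hh n).1.ne'
    refine aestronglyMeasurable_of_tendsto_ae atTop
      (f := fun (n : ℕ) t => ((r / 2 / ((n : ℝ) + 1) : ℝ) : ℂ)⁻¹ •
        (φ (z₀ + ((r / 2 / ((n : ℝ) + 1) : ℝ) : ℂ)) (γ t) - φ z₀ (γ t))) ?_ ?_
    · intro n
      refine ((hmeas (z₀ + ((r / 2 / ((n : ℝ) + 1) : ℝ) : ℂ)) ?_).fun_sub
        (hmeas _ hz₀)).fun_const_smul _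
      rw [Metric.mem_ball, dist_self_add_left, Complex.norm_real, Real.norm_of_nonneg (hh n).1.le]
      exact (hh n).2
    · refine (ae_restrict_iff' measurableSet_uIoc).2 (Eventually.of_forall fun t ht => ?_)
      exact (hda _ (mem_trace (hI t ht)) z₀ (Metric.mem_ball_self (half_pos hr))).tendsto_slope_zero.comp
        hlim
  · filter_upwards [hC] with t ht ht' x hx
    rw [norm_mul]
    -- Cauchy's estimate on the circle of radius `r / 4` about `x` bounds the derivative by `B / (r
    -- / 4)`; the circle stays in the ball of radius `r`.
    have hdc : DiffContOnCl ℂ (fun z => φ z (γ t)) (Metric.ball x (r / 4)) := by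
      refine DifferentiableOn.diffContOnCl ?_
      rw [closure_ball _ (by positivity)]
      exact (hd _ (mem_trace (hI t ht'))).mono (hball x hx)
    have h1 := Complex.norm_deriv_le_of_forall_mem_sphere_norm_le (by positivity : 0 < r / 4) hdc
      (C := B) fun z hz => hb z (hball x hx (Metric.sphere_subset_closedBall hz)) _
        (mem_trace (hI t ht'))
    exact mul_le_mul h1 (ht ht') (norm_nonneg _) ((norm_nonneg _).trans h1)
  · exact intervalIntegrable_const
  · refine Eventually.of_forall fun t ht x hx => ?_
    exact (hda _ (mem_trace (hI t ht)) x hx).mul_const _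

end BetaCorners

end

section

open Set Filter Topology MeasureTheory
namespace BetaCorners

/-! ### Cauchy's theorem for simple closed curves -/

theorem PiecewiseC1.hasDerivAt_cauchyTransform {γ : ℝ → ℂ} (hγ : PiecewiseC1 γ) {f : ℂ → ℂ}
    (hf : ContinuousOn f (trace γ)) {z₀ : ℂ} (hz₀ : z₀ ∉ trace γ) :
    HasDerivAt (fun z => contourIntegral γ (fun ζ => f ζ / (ζ - z)))
      (contourIntegral γ (fun ζ => f ζ / (ζ - z₀) ^ 2)) z₀ := by
  obtain ⟨r, hr, hball⟩ := Metric.isOpen_iff.1 hγ.isCompact_trace.isClosed.isOpen_compl z₀ hz₀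
  obtain ⟨B, hB⟩ := hγ.isCompact_trace.exists_bound_of_continuousOn hf
  have hfar : ∀ z ∈ Metric.ball z₀ (r / 2), ∀ ζ ∈ trace γ, r / 2 ≤ ‖ζ - z‖ := by
    intro z hz ζ hζ
    have h1 : r ≤ dist ζ z₀ := by
      by_contra! h
      exact hball (Metric.mem_ball.2 h) hζ
    rw [Metric.mem_ball] at hz
    have := dist_triangle ζ z z₀
    rw [← dist_eq_norm]
    linarith
  have hne : ∀ z ∈ Metric.ball z₀ (r / 2), ∀ ζ ∈ trace γ, ζ - z ≠ 0 := fun z hz ζ hζ =>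
    norm_pos_iff.1 ((half_pos hr).trans_le (hfar z hz ζ hζ))
  have hz₀' : z₀ ∈ Metric.ball z₀ (r / 2) := Metric.mem_ball_self (half_pos hr)
  have hder : ∀ z ∈ Metric.ball z₀ (r / 2), ∀ ζ ∈ trace γ,
      HasDerivAt (fun z => f ζ / (ζ - z)) (f ζ / (ζ - z) ^ 2) z := by
    intro z hz ζ hζ
    have := (((hasDerivAt_id z).const_sub ζ).inv (hne z hz ζ hζ)).const_mul (f ζ)
    simpa [div_eq_mul_inv] using this
  have := hγ.hasDerivAt_contourIntegral (φ := fun z ζ => f ζ / (ζ - z)) (z₀ := z₀) (half_pos hr)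
    (B := B / (r / 2)) ?_ ?_ ?_
  · rwa [contourIntegral_congr fun ζ hζ => (hder z₀ hz₀' ζ hζ).deriv] at this
  · intro z hz ζ hζ
    rw [norm_div]
    exact div_le_div₀ ((norm_nonneg _).trans (hB ζ hζ)) (hB ζ hζ) (half_pos hr) (hfar z hz ζ hζ)
  · exact fun ζ hζ z hz => (hder z hz ζ hζ).differentiableAt.differentiableWithinAt
  · exact fun z hz => hf.div (continuousOn_id.sub continuousOn_const) (hne z hz)

theorem PiecewiseC1.exists_bound_trace {γ : ℝ → ℂ} (hγ : PiecewiseC1 γ) :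
    ∃ R : ℝ, 0 ≤ R ∧ ∀ ζ ∈ trace γ, ‖ζ‖ ≤ R := by
  obtain ⟨R, hR⟩ := hγ.isCompact_trace.isBounded.exists_norm_le
  exact ⟨max R 0, le_max_right _ _, fun ζ hζ => (hR ζ hζ).trans (le_max_left _ _)⟩

theorem PiecewiseC1.exists_norm_cauchyTransform_le {γ : ℝ → ℂ} (hγ : PiecewiseC1 γ) {f : ℂ → ℂ}
    (hf : ContinuousOn f (trace γ)) :
    ∃ A R : ℝ, 0 ≤ A ∧ (∀ ζ ∈ trace γ, ‖ζ‖ ≤ R) ∧ ∀ z : ℂ, R < ‖z‖ →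
      ‖contourIntegral γ (fun ζ => f ζ / (ζ - z))‖ ≤ A / (‖z‖ - R) := by
  obtain ⟨R, hR0, hR⟩ := hγ.exists_bound_trace
  obtain ⟨C, hC0, hC⟩ := hγ.norm_contourIntegral_le
  obtain ⟨B, hB⟩ := hγ.isCompact_trace.exists_bound_of_continuousOn hf
  refine ⟨|B| * C, R, by positivity, hR, fun z hz => ?_⟩
  have := hC (fun ζ => f ζ / (ζ - z)) (|B| / (‖z‖ - R)) ?_
  · rwa [div_mul_eq_mul_div] at this
  · intro ζ hζ
    rw [norm_div]
    refine div_le_div₀ (abs_nonneg _) ((hB ζ hζ).trans (le_abs_self _)) (sub_pos.2 hz) ?_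
    have := norm_sub_norm_le z ζ
    rw [norm_sub_rev] at this
    linarith [hR ζ hζ]

theorem connectedComponentIn_subset_outside {γ : ℝ → ℂ} {z : ℂ} (hz : z ∈ outside γ) :
    connectedComponentIn (trace γ)ᶜ z ⊆ outside γ := by
  intro y hy
  refine ⟨connectedComponentIn_subset _ _ hy, ?_⟩
  rw [← connectedComponentIn_eq hy]
  exact hz.2

theorem PiecewiseC1.connectedComponentIn_mem_nhds {γ : ℝ → ℂ} (hγ : PiecewiseC1 γ) {z : ℂ}
    (hz : z ∉ trace γ) : connectedComponentIn (trace γ)ᶜ z ∈ 𝓝 z :=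
  hγ.isCompact_trace.isClosed.isOpen_compl.connectedComponentIn.mem_nhds
    (mem_connectedComponentIn hz)

theorem PiecewiseC1.isOpen_outside {γ : ℝ → ℂ} (hγ : PiecewiseC1 γ) : IsOpen (outside γ) :=
  isOpen_iff_mem_nhds.2 fun _ hz => mem_of_superset (hγ.connectedComponentIn_mem_nhds hz.1)
    (connectedComponentIn_subset_outside hz)

/-- The derivative in `z` integrates the exact form `dζ / (ζ - z) ^ 2` around a closed curve, so the
transform is constant on each component of the complement. On an unbounded component it also decays
at infinity. -/
theorem PiecewiseC1.contourIntegral_inv_eq_zero {γ : ℝ → ℂ} (hγ : PiecewiseC1 γ)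
    (hcl : γ 0 = γ 1) {z : ℂ} (hz : z ∈ outside γ) :
    contourIntegral γ (fun ζ => 1 / (ζ - z)) = 0 := by
  set V := connectedComponentIn (trace γ)ᶜ z
  have hVo : IsOpen V := hγ.isCompact_trace.isClosed.isOpen_compl.connectedComponentIn
  have hder : ∀ y ∈ V, HasDerivAt (fun z => contourIntegral γ (fun ζ => 1 / (ζ - z))) 0 y := by
    intro y hy
    have hyt : y ∉ trace γ := connectedComponentIn_subset _ _ hy
    have h1 := hγ.hasDerivAt_cauchyTransform (f := fun _ => 1) continuousOn_const hyt
    have hne : ∀ ζ ∈ trace γ, ζ - y ≠ 0 := fun ζ hζ h => hyt (sub_eq_zero.1 h ▸ hζ)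
    rwa [hγ.contourIntegral_deriv_eq_zero hcl (f := fun ζ => -(ζ - y)⁻¹)] at h1
    · intro ζ hζ
      have := (((hasDerivAt_id ζ).sub_const y).fun_inv (hne ζ hζ)).fun_neg
      simpa [neg_div, neg_neg] using this
    · exact continuousOn_const.div ((continuousOn_id.sub continuousOn_const).pow 2)
        fun ζ hζ => pow_ne_zero 2 (hne ζ hζ)
  obtain ⟨A, R, hA, -, hAR⟩ := hγ.exists_norm_cauchyTransform_le (f := fun _ => 1) continuousOn_const
  have hconst : ∀ y ∈ V, contourIntegral γ (fun ζ => 1 / (ζ - y)) =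
      contourIntegral γ (fun ζ => 1 / (ζ - z)) := fun y hy =>
    hVo.is_const_of_deriv_eq_zero isPreconnected_connectedComponentIn
      (fun x hx => (hder x hx).differentiableAt.differentiableWithinAt)
      (fun x hx => (hder x hx).deriv) hy (mem_connectedComponentIn hz.1)
  by_contra hne
  set c := contourIntegral γ (fun ζ => 1 / (ζ - z))
  have hc : 0 < ‖c‖ := norm_pos_iff.2 hne
  have hub := hz.2
  rw [isBounded_iff_forall_norm_le] at hub
  push Not at hub
  -- At such a distance the decay bound `A / (‖y‖ - R)` is already smaller than `‖c‖`.
  obtain ⟨y, hy, hyR⟩ := hub (R + A / ‖c‖ + 1)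
  have hpos : 0 ≤ A / ‖c‖ := by positivity
  have h1 := hAR y (by linarith)
  rw [hconst y hy, le_div_iff₀ (by linarith)] at h1
  have h2 : ‖c‖ * (A / ‖c‖ + 1) ≤ A :=
    (mul_le_mul_of_nonneg_left (by linarith) hc.le).trans h1
  rw [mul_add, mul_div_cancel₀ _ hc.ne'] at h2
  linarith

/-- The ray from `z` away from the origin misses the disc containing the curve, so the component of
`z` contains an unbounded set. -/
theorem mem_outside_of_norm_lt {γ : ℝ → ℂ} {R : ℝ} (hR : ∀ ζ ∈ trace γ, ‖ζ‖ ≤ R) {z : ℂ}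
    (hR0 : 0 ≤ R) (hz : R < ‖z‖) : z ∈ outside γ := by
  have hzt : z ∉ trace γ := fun h => absurd (hR z h) (not_le.2 hz)
  refine ⟨hzt, fun hb => ?_⟩
  set ray : Set ℂ := (fun s : ℝ => (s : ℂ) * z) '' Ici 1
  have hray : IsPreconnected ray := isPreconnected_Ici.image _ (by fun_prop)
  have hsub : ray ⊆ (trace γ)ᶜ := by
    rintro _ ⟨s, hs, rfl⟩ h
    have := hR _ h
    rw [norm_mul, Complex.norm_real, Real.norm_of_nonneg (zero_le_one.trans hs)] at this
    have hs' : (1 : ℝ) ≤ s := hs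
    nlinarith [norm_nonneg z]
  have h2 := hray.subset_connectedComponentIn (x := z) ⟨1, self_mem_Ici, by simp⟩ hsub
  obtain ⟨K, hK⟩ := isBounded_iff_forall_norm_le.1 (hb.subset h2)
  have hzpos : 0 < ‖z‖ := hR0.trans_lt hz
  have := hK _ ⟨|K| / ‖z‖ + 1, by simp only [mem_Ici, le_add_iff_nonneg_left]; positivity, rfl⟩
  rw [norm_mul, Complex.norm_real, Real.norm_of_nonneg (by positivity), add_mul,
    div_mul_cancel₀ _ hzpos.ne'] at this
  linarith [le_abs_self K]

theorem dslope_symm (f : ℂ → ℂ) (a b : ℂ) : dslope f a b = dslope f b a := by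
  rcases eq_or_ne a b with rfl | h
  · rfl
  · rw [dslope_of_ne f h.symm, dslope_of_ne f h, slope_comm]

/-- The slopes are bounded uniformly over the trace: by the derivative of `f` when `ζ` is near `z₀`,
by the values of `f` when it is far. Holomorphy in the base point follows from the symmetry of
`dslope`. -/
theorem PiecewiseC1.differentiableAt_contourIntegral_dslope {γ : ℝ → ℂ} (hγ : PiecewiseC1 γ)
    {U : Set ℂ} (hU : IsOpen U) (hUt : trace γ ⊆ U) {f : ℂ → ℂ} (hf : DifferentiableOn ℂ f U)
    {z₀ : ℂ} (hz₀ : z₀ ∈ U) :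
    DifferentiableAt ℂ (fun z => contourIntegral γ (dslope f z)) z₀ := by
  obtain ⟨ε, hε, hball⟩ := Metric.isOpen_iff.1 hU z₀ hz₀
  set r := ε / 3
  have hr : 0 < r := by positivity
  have hsub : Metric.closedBall z₀ (2 * r) ⊆ U := fun y hy => hball <| by
    rw [Metric.mem_closedBall] at hy
    rw [Metric.mem_ball]
    have : 3 * r = ε := by simp only [r]; ring
    linarith
  have hsub' : Metric.ball z₀ r ⊆ Metric.closedBall z₀ (2 * r) :=
    Metric.ball_subset_closedBall.trans (Metric.closedBall_subset_closedBall (by linarith))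
  obtain ⟨B₁, hB₁⟩ := (isCompact_closedBall z₀ (2 * r)).exists_bound_of_continuousOn
    ((hf.deriv hU).continuousOn.mono hsub)
  obtain ⟨B₂, hB₂⟩ := (isCompact_closedBall z₀ (2 * r)).exists_bound_of_continuousOn
    (hf.continuousOn.mono hsub)
  obtain ⟨B₃, hB₃⟩ := hγ.isCompact_trace.exists_bound_of_continuousOn (hf.continuousOn.mono hUt)
  have hslope : ∀ a ∈ U, DifferentiableOn ℂ (dslope f a) U := fun a ha =>
    (Complex.differentiableOn_dslope (hU.mem_nhds ha)).2 hf
  refine (hγ.hasDerivAt_contourIntegral (φ := dslope f) (r := r)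
    (B := max B₁ ((B₂ + B₃) / r)) hr ?_ ?_ ?_).differentiableAt
  · intro z hz ζ hζ
    have hzc := hsub' hz
    by_cases hζb : ζ ∈ Metric.closedBall z₀ (2 * r)
    · refine le_trans ?_ (le_max_left _ _)
      rcases eq_or_ne ζ z with rfl | hne
      · rw [dslope_same]
        exact hB₁ _ hζb
      · rw [dslope_of_ne f hne, slope_def_field, norm_div,
          div_le_iff₀ (norm_pos_iff.2 (sub_ne_zero.2 hne))]
        exact (convex_closedBall z₀ (2 * r)).norm_image_sub_le_of_norm_deriv_le
          (fun x hx => hf.differentiableAt (hU.mem_nhds (hsub hx))) hB₁ hzc hζb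
    · refine le_trans ?_ (le_max_right _ _)
      have hfar : r ≤ ‖ζ - z‖ := by
        rw [Metric.mem_closedBall, not_le] at hζb
        rw [Metric.mem_ball] at hz
        have := dist_triangle ζ z z₀
        rw [← dist_eq_norm]
        linarith
      have hne : ζ ≠ z := fun h => by
        rw [h, sub_self, norm_zero] at hfar
        linarith
      rw [dslope_of_ne f hne, slope_def_field, norm_div]
      have h1 : ‖f ζ - f z‖ ≤ B₂ + B₃ :=
        (norm_sub_le _ _).trans (by linarith [hB₂ z hzc, hB₃ ζ hζ])
      exact div_le_div₀ ((norm_nonneg _).trans h1) h1 hr hfar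
  · intro ζ hζ
    simp only [dslope_symm f _ ζ]
    exact (hslope ζ (hUt hζ)).mono (hsub'.trans hsub)
  · exact fun z hz => ((hslope z (hsub (hsub' hz))).mono hUt).continuousOn

/-- The two integrands differ by `f z / (ζ - z)`, whose integral vanishes for `z` outside. This
agreement glues the two branches of Dixon's function. -/
theorem PiecewiseC1.contourIntegral_dslope {γ : ℝ → ℂ} (hγ : PiecewiseC1 γ) {f : ℂ → ℂ}
    (hf : ContinuousOn f (trace γ)) (hcl : γ 0 = γ 1) {z : ℂ} (hz : z ∈ outside γ) :
    contourIntegral γ (dslope f z) = contourIntegral γ (fun ζ => f ζ / (ζ - z)) := by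
  have hne : ∀ ζ ∈ trace γ, ζ - z ≠ 0 := fun ζ hζ h => hz.1 (sub_eq_zero.1 h ▸ hζ)
  have hinv : ContinuousOn (fun ζ => 1 / (ζ - z)) (trace γ) :=
    continuousOn_const.div (continuousOn_id.sub continuousOn_const) hne
  have h1 : contourIntegral γ (dslope f z) =
      contourIntegral γ (fun ζ => f ζ / (ζ - z) + (-f z) * (1 / (ζ - z))) := by
    refine contourIntegral_congr fun ζ hζ => ?_
    rw [dslope_of_ne f (sub_ne_zero.1 (hne ζ hζ)), slope_def_field]
    ring
  rw [h1, hγ.contourIntegral_add (f := fun ζ => f ζ / (ζ - z))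
    (g := fun ζ => -f z * (1 / (ζ - z))) (hf.div (continuousOn_id.sub continuousOn_const) hne)
    (continuousOn_const.mul hinv), contourIntegral_const_mul,
    hγ.contourIntegral_inv_eq_zero hcl hz, mul_zero, add_zero]

/-- **Cauchy's theorem**, by Dixon's argument. -/
theorem PiecewiseC1.contourIntegral_eq_zero {γ : ℝ → ℂ} (hγ : PiecewiseC1 γ) (hcl : γ 0 = γ 1)
    {U : Set ℂ} (hU : IsOpen U) (hγU : trace γ ∪ inside γ ⊆ U) {f : ℂ → ℂ}
    (hf : DifferentiableOn ℂ f U) : contourIntegral γ f = 0 := by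
  classical
  have hUt : trace γ ⊆ U := subset_union_left.trans hγU
  have houtside : ∀ z, z ∉ U → z ∈ outside γ := by
    intro z hz
    have hzt : z ∉ trace γ := fun h => hz (hUt h)
    exact ⟨hzt, fun h => hz (hγU (Or.inr ⟨hzt, h⟩))⟩
  have key : ∀ g : ℂ → ℂ, DifferentiableOn ℂ g U → ∀ z ∈ outside γ,
      contourIntegral γ (fun ζ => g ζ / (ζ - z)) = 0 := by
    intro g hg z hz
    have hgc := hg.continuousOn.mono hUt
    -- Dixon's function. Its branches agree on `outside γ`, which is open and contains the
    -- complement of `U`, so it is entire. It tends to zero at infinity and vanishes by Liouville's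
    -- theorem.
    set h : ℂ → ℂ := fun z => if z ∈ U then contourIntegral γ (dslope g z)
      else contourIntegral γ (fun ζ => g ζ / (ζ - z)) with hh
    have hout : ∀ z ∈ outside γ, h z = contourIntegral γ (fun ζ => g ζ / (ζ - z)) := by
      intro z hz
      simp only [hh]
      split_ifs
      · exact hγ.contourIntegral_dslope hgc hcl hz
      · rfl
    have hdiff : Differentiable ℂ h := by
      intro z
      by_cases hzU : z ∈ U
      · refine (hγ.differentiableAt_contourIntegral_dslope hU hUt hg hzU).congr_of_eventuallyEq ?_
        filter_upwards [hU.mem_nhds hzU] with y hy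
        simp only [hh, if_pos hy]
      · have hzo := houtside z hzU
        refine (hγ.hasDerivAt_cauchyTransform hgc hzo.1).differentiableAt.congr_of_eventuallyEq ?_
        filter_upwards [hγ.isOpen_outside.mem_nhds hzo] with y hy using hout y hy
    obtain ⟨A, R, hA, hR, hAR⟩ := hγ.exists_norm_cauchyTransform_le hgc
    have hR0 : 0 ≤ R :=
      (norm_nonneg _).trans (hR _ (mem_trace (γ := γ) (t := 0) ⟨le_rfl, zero_le_one⟩))
    have hlim : Tendsto h (cocompact ℂ) (𝓝 0) := by
      have h1 : Tendsto (fun z : ℂ => A / (‖z‖ - R)) (cocompact ℂ) (𝓝 0) :=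
        tendsto_const_nhds.div_atTop
          (tendsto_atTop_add_const_right _ (-R) (tendsto_norm_cocompact_atTop (E := ℂ)))
      refine squeeze_zero_norm' ?_ h1
      filter_upwards [(tendsto_norm_cocompact_atTop (E := ℂ)).eventually_gt_atTop R] with y hy
      rw [hout y (mem_outside_of_norm_lt hR hR0 hy)]
      exact hAR y hy
    rw [← hout z hz]
    exact hdiff.apply_eq_of_tendsto_cocompact z hlim
  obtain ⟨R, hR0, hR⟩ := hγ.exists_bound_trace
  have hz : ((R + 1 : ℝ) : ℂ) ∈ outside γ := mem_outside_of_norm_lt hR hR0 (by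
    rw [Complex.norm_real, Real.norm_of_nonneg (by linarith)]
    linarith)
  -- With a point `a` outside the curve, the Cauchy transform at `a` of `(ζ - a) * f ζ` is the
  -- integral of `f` itself.
  rw [← key (fun ζ => (ζ - ((R + 1 : ℝ) : ℂ)) * f ζ)
    ((differentiableOn_id.sub (differentiableOn_const _)).mul hf) _ hz]
  refine contourIntegral_congr fun ζ hζ => ?_
  rw [mul_div_cancel_left₀]
  exact fun h => hz.1 (sub_eq_zero.1 h ▸ hζ)

/-! ### Removable singularities -/

/-- Riemann's theorem removes the points of `P` one at a time; altering the value at one point does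
not affect the punctured limits at the others. -/
theorem exists_differentiableOn_extension {P : Set ℂ} (hP : P.Finite) {U : Set ℂ} (hU : IsOpen U) :
    ∀ f : ℂ → ℂ, DifferentiableOn ℂ f (U \ P) →
      (∀ c ∈ P, c ∈ U → Tendsto (fun z => (z - c) * f z) (𝓝[≠] c) (𝓝 0)) →
      ∃ g : ℂ → ℂ, DifferentiableOn ℂ g U ∧ ∀ z ∈ U \ P, g z = f z := by
  classical
  induction P, hP using Set.Finite.induction_on with
  | empty => exact fun f hf _ => ⟨f, by simpa using hf, fun _ _ => rfl⟩
  | @insert c P hcP hP ih =>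
    intro f hf hlim
    by_cases hcU : c ∈ U
    · have hopen : IsOpen (U \ P) := hU.sdiff hP.isClosed
      have hset : (U \ P) \ {c} = U \ insert c P := by
        ext z
        simp only [Set.mem_sdiff, mem_singleton_iff, mem_insert_iff]
        tauto
      have hdiff := Complex.differentiableOn_update_limUnder_of_isLittleO
        (hopen.mem_nhds ⟨hcU, hcP⟩) (by rwa [hset]) (f := f) ?_
      · have hlim' : ∀ a ∈ P, a ∈ U → Tendsto (fun z => (z - a) *
            Function.update f c (limUnder (𝓝[≠] c) f) z) (𝓝[≠] a) (𝓝 0) := by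
          intro a ha haU
          have hac : a ≠ c := fun h => hcP (h ▸ ha)
          refine (hlim a (mem_insert_of_mem _ ha) haU).congr' ?_
          filter_upwards [mem_nhdsWithin_of_mem_nhds (isOpen_ne.mem_nhds hac)] with z hz
          rw [Function.update_of_ne hz]
        obtain ⟨g, hg, hgf⟩ := ih _ hdiff hlim'
        refine ⟨g, hg, fun z hz => ?_⟩
        rw [← hset] at hz
        rw [hgf z hz.1, Function.update_of_ne hz.2]
      · rw [Asymptotics.isLittleO_iff_tendsto']
        · have h1 : Tendsto (fun z => (z - c) * f c) (𝓝[≠] c) (𝓝 0) := by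
            have : Tendsto (fun z => (z - c) * f c) (𝓝 c) (𝓝 ((c - c) * f c)) :=
              Continuous.tendsto (by fun_prop) c
            rw [sub_self, zero_mul] at this
            exact this.mono_left nhdsWithin_le_nhds
          have h2 := (hlim c (mem_insert _ _) hcU).sub h1
          rw [sub_zero] at h2
          refine h2.congr fun z => ?_
          rw [div_inv_eq_mul]
          ring
        · filter_upwards [self_mem_nhdsWithin] with z hz h
          exact absurd (inv_eq_zero.1 h) (sub_ne_zero.2 hz)
    · have hset : U \ insert c P = U \ P := by
        ext z
        simp only [Set.mem_sdiff, mem_insert_iff]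
        constructor
        · tauto
        · rintro ⟨h1, h2⟩
          exact ⟨h1, fun h => h.elim (fun h => hcU (h ▸ h1)) h2⟩
      rw [hset] at hf ⊢
      exact ih f hf fun a ha => hlim a (mem_insert_of_mem _ ha)

/-- A simple curve visits each point at most once before time `1`, so it meets a finite set only
finitely often. -/
theorem ae_notMem_finite {γ : ℝ → ℂ} (hs : InjOn γ (Ico 0 1)) {P : Set ℂ} (hP : P.Finite) :
    ∀ᵐ t : ℝ, t ∈ uIoc (0 : ℝ) 1 → γ t ∉ P := by
  have hfin : {t | t ∈ Ico (0 : ℝ) 1 ∧ γ t ∈ P}.Finite :=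
    Set.Finite.of_injOn (f := γ) (fun t ht => ht.2) (hs.mono fun t ht => ht.1) hP
  filter_upwards [(hfin.union (finite_singleton 1)).countable.ae_notMem volume] with t ht ht' hP
  rw [uIoc_of_le zero_le_one] at ht'
  refine ht ?_
  rcases eq_or_lt_of_le ht'.2 with h | h
  · exact Or.inr h
  · exact Or.inl ⟨⟨ht'.1.le, h⟩, hP⟩

/-- A removable singularity may sit on the contour. Each single integral must still converge there,
because the integral of a sum is later split into a sum of integrals. -/
theorem PiecewiseC1.intervalIntegrable_of_removable {γ : ℝ → ℂ} (hγ : PiecewiseC1 γ)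
    (hs : InjOn γ (Ico 0 1)) {U P : Set ℂ} (hU : IsOpen U) (hP : P.Finite) (hγU : trace γ ⊆ U)
    {f : ℂ → ℂ} (hf : DifferentiableOn ℂ f (U \ P))
    (hlim : ∀ c ∈ P, c ∈ trace γ → Tendsto (fun z => (z - c) * f z) (𝓝[≠] c) (𝓝 0)) :
    IntervalIntegrable (fun t => f (γ t) * deriv γ t) volume 0 1 := by
  have hfin : (P \ trace γ).Finite := hP.subset sdiff_subset
  have hsub : (U \ (P \ trace γ)) \ (P ∩ trace γ) ⊆ U \ P := fun z hz =>
    ⟨hz.1.1, fun h => hz.1.2 ⟨h, fun ht => hz.2 ⟨h, ht⟩⟩⟩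
  obtain ⟨g, hg, hgf⟩ := exists_differentiableOn_extension (hP.subset (inter_subset_left (t := trace γ)))
    (hU.sdiff hfin.isClosed) f (hf.mono hsub) fun c hc _ =>
      hlim c hc.1 hc.2
  · have hγU' : trace γ ⊆ U \ (P \ trace γ) := fun z hz => ⟨hγU hz, fun h => h.2 hz⟩
    refine (hγ.intervalIntegrable (hg.continuousOn.mono hγU')).congr_ae ?_
    refine (ae_restrict_iff' measurableSet_uIoc).2 ?_
    filter_upwards [ae_notMem_finite hs hP] with t ht ht'
    have htI : t ∈ Icc (0 : ℝ) 1 := by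
      rw [uIoc_of_le zero_le_one] at ht'
      exact ⟨ht'.1.le, ht'.2⟩
    rw [hgf _ ⟨hγU' (mem_trace htI), fun h => ht ht' h.1⟩]

/-- Singularities off the contour and its interior are cut out of `U`; the others are filled in by a
holomorphic extension, which the curve distinguishes from `f` only at finitely many times. -/
theorem PiecewiseC1.contourIntegral_eq_zero_of_removable {γ : ℝ → ℂ} (hγ : PiecewiseC1 γ)
    (hcl : γ 0 = γ 1) (hs : InjOn γ (Ico 0 1)) {U P : Set ℂ} (hU : IsOpen U) (hP : P.Finite)
    (hγU : trace γ ∪ inside γ ⊆ U) {f : ℂ → ℂ} (hf : DifferentiableOn ℂ f (U \ P))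
    (hlim : ∀ c ∈ P, c ∈ trace γ ∪ inside γ →
      Tendsto (fun z => (z - c) * f z) (𝓝[≠] c) (𝓝 0)) :
    contourIntegral γ f = 0 := by
  have hfin : (P \ (trace γ ∪ inside γ)).Finite := hP.subset sdiff_subset
  have hsub : (U \ (P \ (trace γ ∪ inside γ))) \ (P ∩ (trace γ ∪ inside γ)) ⊆ U \ P := fun z hz =>
    ⟨hz.1.1, fun h => hz.1.2 ⟨h, fun ht => hz.2 ⟨h, ht⟩⟩⟩
  obtain ⟨g, hg, hgf⟩ := exists_differentiableOn_extension
    (hP.subset (inter_subset_left (t := trace γ ∪ inside γ)))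
    (hU.sdiff hfin.isClosed) f (hf.mono hsub) fun c hc _ =>
      hlim c hc.1 hc.2
  · have hγU' : trace γ ∪ inside γ ⊆ U \ (P \ (trace γ ∪ inside γ)) :=
      fun z hz => ⟨hγU hz, fun h => h.2 hz⟩
    rw [← hγ.contourIntegral_eq_zero hcl (hU.sdiff hfin.isClosed) hγU' hg]
    refine intervalIntegral.integral_congr_ae ?_
    filter_upwards [ae_notMem_finite hs hP] with t ht ht'
    have htI : t ∈ Icc (0 : ℝ) 1 := by
      rw [uIoc_of_le zero_le_one] at ht'
      exact ⟨ht'.1.le, ht'.2⟩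
    rw [hgf _ ⟨hγU' (Or.inl (mem_trace htI)), fun h => ht ht' h.1⟩]

end BetaCorners

end

section

open Filter Topology
namespace BetaCorners

/-! ### Mixed directional derivatives -/

/-- The derivative of `f` in the directions `d a`, `a ∈ l`; the last entry of `l` acts first. -/
noncomputable def mixedDeriv {E σ : Type*} [NormedAddCommGroup E] [NormedSpace ℂ E] (d : σ → E) (f : E → ℂ) :
    List σ → E → ℂ
  | [] => f
  | a :: l => fun z => fderiv ℂ (mixedDeriv d f l) z (d a)

section MixedDeriv

variable {E σ : Type*} [NormedAddCommGroup E] [NormedSpace ℂ E] {d : σ → E}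

theorem mixedDeriv_map {τ : Type*} (g : τ → σ) (f : E → ℂ) (l : List τ) :
    mixedDeriv d f (l.map g) = mixedDeriv (d ∘ g) f l := by
  induction l with
  | nil => rfl
  | cons a l ih => simp only [List.map_cons, mixedDeriv, ih, Function.comp]

theorem mixedDeriv_append (f : E → ℂ) (l l' : List σ) :
    mixedDeriv d f (l ++ l') = mixedDeriv d (mixedDeriv d f l') l := by
  induction l with
  | nil => rfl
  | cons a l ih => simp only [List.cons_append, mixedDeriv, ih]

theorem mixedDeriv_analyticAt {f : E → ℂ} {x : E} (hf : AnalyticAt ℂ f x) (l : List σ) :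
    AnalyticAt ℂ (mixedDeriv d f l) x := by
  induction l with
  | nil => exact hf
  | cons a l ih =>
    exact ((ContinuousLinearMap.apply ℂ ℂ (d a)).analyticAt _).comp ih.fderiv

theorem mixedDeriv_congr {f g : E → ℂ} {x : E} (h : f =ᶠ[𝓝 x] g) (l : List σ) :
    mixedDeriv d f l =ᶠ[𝓝 x] mixedDeriv d g l := by
  induction l with
  | nil => exact h
  | cons a l ih =>
    filter_upwards [ih.fderiv (𝕜 := ℂ)] with z hz
    simp only [mixedDeriv, hz]

theorem mixedDeriv_const (c : ℂ) (l : List σ) :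
    mixedDeriv d (fun _ : E => c) l = fun _ => if l = [] then c else 0 := by
  induction l with
  | nil => rfl
  | cons a l ih => simp [mixedDeriv, ih]

theorem iteratedFDeriv_eq_mixedDeriv {f : E → ℂ} (l : List σ) {x : E} (hf : AnalyticAt ℂ f x) :
    iteratedFDeriv ℂ l.length f x (fun i => d (l.get i)) = mixedDeriv d f l x := by
  induction l generalizing x with
  | nil => simp [mixedDeriv]
  | cons a l ih =>
    have hd : DifferentiableAt ℂ (iteratedFDeriv ℂ l.length f) x :=
      (hf.contDiffAt (n := ⊤)).differentiableAt_iteratedFDeriv (by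
        exact_mod_cast WithTop.coe_lt_top _)
    have h := hd.iteratedFDeriv_succ_apply_left' (m := fun i => d ((a :: l).get i))
    refine h.trans ?_
    have h1 : (fun y => iteratedFDeriv ℂ l.length f y
        (Fin.tail fun i => d ((a :: l).get i))) =ᶠ[𝓝 x] mixedDeriv d f l := by
      filter_upwards [hf.eventually_analyticAt] with y hy using ih hy
    rw [h1.fderiv_eq]
    rfl

/-- Leibniz rule, with `S` the set of directions falling on `f`. A new direction `a` splits each
term into those for `S` and `insert a S`; the absence of repetitions lets subsets of directions
stand for sublists. -/
theorem mixedDeriv_mul [DecidableEq σ] {f g : E → ℂ} {l : List σ} (hl : l.Nodup) {x : E}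
    (hf : AnalyticAt ℂ f x) (hg : AnalyticAt ℂ g x) :
    mixedDeriv d (fun z => f z * g z) l x = ∑ S ∈ l.toFinset.powerset,
      mixedDeriv d f (l.filter (· ∈ S)) x * mixedDeriv d g (l.filter (· ∉ S)) x := by
  induction l generalizing x with
  | nil => simp [mixedDeriv]
  | cons a l ih =>
    obtain ⟨hal, hl⟩ := List.nodup_cons.1 hl
    have hev : mixedDeriv d (fun z => f z * g z) l =ᶠ[𝓝 x] fun z => ∑ S ∈ l.toFinset.powerset,
        mixedDeriv d f (l.filter (· ∈ S)) z * mixedDeriv d g (l.filter (· ∉ S)) z := by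
      filter_upwards [hf.eventually_analyticAt, hg.eventually_analyticAt] with y hy hy'
      exact ih hl hy hy'
    have hal' : a ∉ l.toFinset := by simpa using hal
    rw [List.toFinset_cons, Finset.sum_powerset_insert hal']
    change fderiv ℂ (mixedDeriv d (fun z => f z * g z) l) x (d a) = _
    rw [hev.fderiv_eq, fderiv_fun_sum fun S _ => ((mixedDeriv_analyticAt hf _).fun_mul
        (mixedDeriv_analyticAt hg _)).differentiableAt, sum_apply,
      ← Finset.sum_add_distrib]
    refine Finset.sum_congr rfl fun S hS => ?_
    have haS : a ∉ S := fun h => hal' (Finset.mem_powerset.1 hS h)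
    rw [fderiv_fun_mul (mixedDeriv_analyticAt hf _).differentiableAt
      (mixedDeriv_analyticAt hg _).differentiableAt]
    have e1 : (a :: l).filter (· ∈ S) = l.filter (· ∈ S) := by simp [haS]
    have e2 : (a :: l).filter (· ∉ S) = a :: l.filter (· ∉ S) := by simp [haS]
    have e3 : (a :: l).filter (· ∈ insert a S) = a :: l.filter (· ∈ S) := by
      rw [List.filter_cons_of_pos (by simp)]
      congr 1
      refine List.filter_congr fun b hb => ?_
      have : b ≠ a := fun h => hal (h ▸ hb)
      simp [this]
    have e4 : (a :: l).filter (· ∉ insert a S) = l.filter (· ∉ S) := by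
      rw [List.filter_cons_of_neg (by simp)]
      refine List.filter_congr fun b hb => ?_
      have : b ≠ a := fun h => hal (h ▸ hb)
      simp [this]
    rw [e1, e2, e3, e4]
    simp only [mixedDeriv, add_apply, smul_apply, smul_eq_mul]
    ring

end MixedDeriv

/-! ### Joint cumulants with one distinguished variable -/

/-- The inverse of `m` under the subset convolution. -/
noncomputable def subsetInv {σ : Type*} [DecidableEq σ] (m : Finset σ → ℂ) : Finset σ → ℂ :=
  Finset.strongInduction fun B ih =>
    (if B = ∅ then 1 else 0) -
      ∑ S ∈ B.ssubsets.attach, ih S.1 (Finset.mem_ssubsets.1 S.2) * m (B \ S.1)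

theorem subsetInv_eq {σ : Type*} [DecidableEq σ] (m : Finset σ → ℂ) (B : Finset σ) :
    subsetInv m B = (if B = ∅ then 1 else 0) - ∑ S ∈ B.ssubsets, subsetInv m S * m (B \ S) := by
  rw [← Finset.sum_attach B.ssubsets (fun S => subsetInv m S * m (B \ S))]
  exact Finset.strongInduction_eq _ _

section Cumulant

variable {Ω ι : Type*} [Fintype Ω] [Fintype ι]

/-- The exponential sum `z ↦ ∑ ω, c ω * exp (∑ i, z i * X i ω)`. -/
noncomputable def expSum (X : ι → Ω → ℂ) (c : Ω → ℂ) (z : ι → ℂ) : ℂ :=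
  ∑ ω, c ω * Complex.exp (∑ i, z i * X i ω)

theorem expSum_zero (X : ι → Ω → ℂ) (c : Ω → ℂ) : expSum X c 0 = ∑ ω, c ω := by
  simp [expSum]

theorem expSum_analyticAt (X : ι → Ω → ℂ) (c : Ω → ℂ) (z : ι → ℂ) :
    AnalyticAt ℂ (expSum X c) z := by
  unfold expSum
  refine Finset.analyticAt_fun_sum _ fun ω _ => analyticAt_const.mul (AnalyticAt.cexp ?_)
  exact Finset.analyticAt_fun_sum _ fun i _ =>
    ((ContinuousLinearMap.proj (R := ℂ) (φ := fun _ : ι => ℂ) i).analyticAt _).mul analyticAt_const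

theorem fderiv_expSum (X : ι → Ω → ℂ) (c : Ω → ℂ) (z v : ι → ℂ) :
    fderiv ℂ (expSum X c) z v = expSum X (fun ω => c ω * ∑ i, v i * X i ω) z := by
  have h1 : ∀ ω, HasFDerivAt (fun z : ι → ℂ => ∑ i, z i * X i ω)
      (∑ i, (X i ω) • (ContinuousLinearMap.proj (R := ℂ) (φ := fun _ : ι => ℂ) i)) z := fun ω =>
    HasFDerivAt.fun_sum fun i _ => (hasFDerivAt_apply i z).mul_const (X i ω)
  have h2 : HasFDerivAt (expSum X c) _ z :=
    HasFDerivAt.fun_sum fun ω (_ : ω ∈ Finset.univ) => ((h1 ω).cexp.const_mul (c ω))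
  rw [h2.fderiv]
  simp only [sum_apply, smul_apply, ContinuousLinearMap.proj_apply,
    smul_eq_mul, expSum]
  refine Finset.sum_congr rfl fun ω _ => ?_
  rw [mul_assoc, mul_comm (Complex.exp _)]
  simp only [mul_comm (X _ ω)]

theorem mixedDeriv_expSum [DecidableEq ι] {σ : Type*} (X : ι → Ω → ℂ) (c : Ω → ℂ) (e : σ → ι)
    (l : List σ) :
    mixedDeriv (fun s => (Pi.single (e s) 1 : ι → ℂ)) (expSum X c) l =
      expSum X (fun ω => c ω * (l.map fun s => X (e s) ω).prod) := by
  induction l with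
  | nil => simp [mixedDeriv]
  | cons a l ih =>
    ext z
    simp only [mixedDeriv, ih, fderiv_expSum]
    congr 1
    ext ω
    simp [Pi.single_apply]
    ring

/-- The enumeration inside `jointCumulant` is arbitrary. Symmetry of iterated derivatives of an
analytic function allows any other one, in particular one with the distinguished variable at the
end. -/
theorem jointCumulant_eq_mixedDeriv [DecidableEq ι] {P : Ω → ℝ} {X : ι → Ω → ℂ}
    (hf : AnalyticAt ℂ (logMGF P X) 0) {l : List ι} (hl : l.Nodup) (hl' : ∀ i, i ∈ l) :
    jointCumulant P X = mixedDeriv (fun i => (Pi.single i 1 : ι → ℂ)) (logMGF P X) l 0 := by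
  have key : ∀ (n : ℕ) (e : Fin n ≃ ι), jointCumulant P X =
      iteratedFDeriv ℂ n (logMGF P X) 0 (fun a => Pi.single (e a) 1) := by
    intro n e
    obtain rfl : n = Fintype.card ι := by simpa using Fintype.card_congr e
    have h := hf.contDiffAt.iteratedFDeriv_comp_perm
      (fun a => (Pi.single ((Fintype.equivFin ι).symm a) 1 : ι → ℂ))
      (e.trans (Fintype.equivFin ι))
    rw [jointCumulant, ← h]
    congr 1
    ext a : 1
    simp
  rw [key _ (hl.getEquivOfForallMemList l hl'), ← iteratedFDeriv_eq_mixedDeriv l hf]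
  rfl

theorem logMGF_eq (P : Ω → ℝ) (X : ι → Ω → ℂ) :
    logMGF P X = fun z => Complex.log (expSum X (fun ω => (P ω : ℂ)) z) := rfl

/-- A joint cumulant is a combination of moments with coefficients that do not depend on the
distinguished variable `X i₀`. -/
theorem jointCumulant_eq_sum [DecidableEq ι] {σ : Type*} [DecidableEq σ] {P : Ω → ℝ}
    (hP : ∑ ω, P ω = 1) (G : σ → Ω → ℂ) {X : ι → Ω → ℂ} (i₀ : ι) (e : σ → ι) {F : Finset σ}
    (he : ∀ s ∈ F, e s ≠ i₀) (hinj : Set.InjOn e F) (hsurj : ∀ i, i ≠ i₀ → ∃ s ∈ F, e s = i)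
    (hX : ∀ s ∈ F, X (e s) = G s) :
    jointCumulant P X = ∑ B ∈ F.powerset,
      subsetInv (fun T => expect P fun ω => ∏ s ∈ T, G s ω) (F \ B) *
        expect P (fun ω => X i₀ ω * ∏ s ∈ B, G s ω) := by
  set m : Finset σ → ℂ := fun T => expect P fun ω => ∏ s ∈ T, G s ω
  set Z := expSum X (fun ω => (P ω : ℂ))
  have hZ0 : Z 0 = 1 := by
    simp only [Z, expSum_zero]
    exact_mod_cast hP
  have hZa : AnalyticAt ℂ Z 0 := expSum_analyticAt _ _ _
  have hslit : Z 0 ∈ Complex.slitPlane := by rw [hZ0]; exact Complex.one_mem_slitPlane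
  have hlog : AnalyticAt ℂ (logMGF P X) 0 := by
    rw [logMGF_eq]
    exact hZa.clog hslit
  have hev : ∀ᶠ z in 𝓝 (0 : ι → ℂ), Z z ∈ Complex.slitPlane :=
    hZa.continuousAt.eventually_mem (Complex.isOpen_slitPlane.mem_nhds hslit)
  set d : σ → ι → ℂ := fun s => Pi.single (e s) 1
  have hmom : ∀ (c : Ω → ℂ) (l : List σ), l.Nodup → (∀ s ∈ l, s ∈ F) →
      mixedDeriv d (expSum X c) l 0 = ∑ ω, c ω * ∏ s ∈ l.toFinset, G s ω := by
    intro c l hl hlF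
    rw [mixedDeriv_expSum, expSum_zero]
    refine Finset.sum_congr rfl fun ω _ => ?_
    rw [List.prod_toFinset _ hl]
    congr 2
    exact List.map_congr_left fun s hs => by rw [hX s (hlF s hs)]
  have hinvA : AnalyticAt ℂ (fun z => (Z z)⁻¹) 0 := hZa.fun_inv (by rw [hZ0]; exact one_ne_zero)
  -- The Leibniz rule for `Z⁻¹ * Z = 1` gives the derivatives of `Z⁻¹` at the origin exactly the
  -- recursion of `subsetInv`.
  have hinv : ∀ (n : ℕ) (l : List σ), l.length = n → l.Nodup → (∀ s ∈ l, s ∈ F) →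
      mixedDeriv d (fun z => (Z z)⁻¹) l 0 = subsetInv m l.toFinset := by
    intro n
    induction n using Nat.strong_induction_on with
    | _ n ih =>
      intro l hln hl hlF
      have h1 := mixedDeriv_mul (d := d) hl hinvA hZa
      have h2 : mixedDeriv d (fun z => (Z z)⁻¹ * Z z) l 0 = if l = [] then 1 else 0 := by
        have : (fun z => (Z z)⁻¹ * Z z) =ᶠ[𝓝 0] fun _ => 1 := by
          filter_upwards [hev] with z hz
          exact inv_mul_cancel₀ (Complex.slitPlane_ne_zero hz)
        rw [(mixedDeriv_congr this l).self_of_nhds, mixedDeriv_const]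
      rw [h2] at h1
      have h3 : ∀ S ∈ l.toFinset.powerset,
          mixedDeriv d Z (l.filter (· ∉ S)) 0 = m (l.toFinset \ S) := by
        intro S hS
        rw [hmom _ _ (hl.filter _) fun s hs => hlF s (List.mem_of_mem_filter hs)]
        have : (l.filter (· ∉ S)).toFinset = l.toFinset \ S := by
          ext s
          simp
        rw [this]
        rfl
      have h4 : (if l.toFinset = ∅ then 1 else 0 : ℂ) = if l = [] then 1 else 0 := by
        simp only [List.toFinset_eq_empty_iff]
      rw [subsetInv_eq, h4, h1, eq_sub_iff_add_eq, Finset.ssubsets,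
        ← Finset.insert_erase (Finset.mem_powerset_self l.toFinset),
        Finset.sum_insert (Finset.notMem_erase _ _)]
      congr 1
      · rw [h3 _ (Finset.mem_powerset_self _), Finset.sdiff_self]
        have hm : m ∅ = 1 := by
          simp only [m, expect, Finset.prod_empty, mul_one]
          exact_mod_cast hP
        rw [hm, mul_one]
        congr 1
        exact (List.filter_eq_self.2 fun s hs => by simpa using hs).symm
      · rw [Finset.erase_insert (Finset.notMem_erase _ _)]
        refine Finset.sum_congr rfl fun S hS => ?_
        obtain ⟨hS1, hS2⟩ := Finset.mem_erase.1 hS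
        rw [h3 S hS2]
        have hSl := Finset.mem_powerset.1 hS2
        have hfil : (l.filter (· ∈ S)).toFinset = S := by
          ext s
          simpa using fun h => by simpa using hSl h
        congr 1
        rw [ih _ _ _ rfl (hl.filter _) fun s hs => hlF s (List.mem_of_mem_filter hs), hfil]
        rw [← hln, ← List.toFinset_card_of_nodup (hl.filter _), hfil,
          ← List.toFinset_card_of_nodup hl]
        exact Finset.card_lt_card (lt_of_le_of_ne hSl hS1)
  set l := F.toList
  have hlnd : l.Nodup := F.nodup_toList
  have hlF : ∀ s ∈ l, s ∈ F := fun s => Finset.mem_toList.1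
  -- The last entry acts first: a single derivative in the direction `i₀` replaces the logarithm by
  -- `Z⁻¹` times an exponential sum linear in `X i₀`.
  have hfull : (l.map e ++ [i₀]).Nodup := by
    refine List.Nodup.append (List.Nodup.map_on ?_ hlnd) (List.nodup_singleton _) ?_
    · exact fun s hs t ht h => hinj (hlF s hs) (hlF t ht) h
    · intro i hi hi'
      obtain ⟨s, hs, rfl⟩ := List.mem_map.1 hi
      exact he s (hlF s hs) (by simpa using hi')
  rw [jointCumulant_eq_mixedDeriv hlog hfull, mixedDeriv_append, mixedDeriv_map]
  · have hder : mixedDeriv (fun i => (Pi.single i 1 : ι → ℂ)) (logMGF P X) [i₀] =ᶠ[𝓝 0]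
        fun z => (Z z)⁻¹ * expSum X (fun ω => P ω * X i₀ ω) z := by
      filter_upwards [hev] with z hz
      have hd := (expSum_analyticAt X (fun ω => (P ω : ℂ)) z).differentiableAt.hasFDerivAt.clog hz
      simp only [mixedDeriv]
      rw [logMGF_eq, hd.fderiv, smul_apply, fderiv_expSum, smul_eq_mul]
      congr 2
      ext ω
      simp [Pi.single_apply]
    rw [(mixedDeriv_congr hder l).self_of_nhds]
    change mixedDeriv d _ l 0 = _
    rw [mixedDeriv_mul hlnd hinvA (expSum_analyticAt _ _ _)]
    have hlt : l.toFinset = F := F.toList_toFinset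
    rw [hlt]
    -- The Leibniz sum is indexed by the directions falling on `Z⁻¹`, the claim by those falling on
    -- the moment.
    refine Finset.sum_nbij' (fun S => F \ S) (fun S => F \ S) ?_ ?_ ?_ ?_ ?_
    · exact fun S _ => Finset.mem_powerset.2 Finset.sdiff_subset
    · exact fun S _ => Finset.mem_powerset.2 Finset.sdiff_subset
    · exact fun S hS => Finset.sdiff_sdiff_eq_self (Finset.mem_powerset.1 hS)
    · exact fun S hS => Finset.sdiff_sdiff_eq_self (Finset.mem_powerset.1 hS)
    · intro S hS
      have hSF := Finset.mem_powerset.1 hS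
      rw [Finset.sdiff_sdiff_eq_self hSF, hinv _ _ rfl (hlnd.filter _)
        fun s hs => hlF s (List.mem_of_mem_filter hs), hmom _ _ (hlnd.filter _)
        fun s hs => hlF s (List.mem_of_mem_filter hs)]
      have h1 : (l.filter (· ∈ S)).toFinset = S := by
        ext s
        simpa [l] using fun h => hSF h
      have h2 : (l.filter (· ∉ S)).toFinset = F \ S := by
        ext s
        simp [l]
      rw [h1, h2]
      simp only [expect, mul_assoc]
  · intro i
    by_cases h : i = i₀
    · simp [h]
    · obtain ⟨s, hs, rfl⟩ := hsurj i h
      exact List.mem_append_left _ (List.mem_map_of_mem (Finset.mem_toList.2 hs))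

end Cumulant

end BetaCorners

end

section

open Finset
namespace BetaCorners

/-! ### Products over pairs -/

/-- The product of `g (x p - y q)` over `p < m`, `q < n` with `rel p q`. -/
noncomputable def pairProd (rel : ℕ → ℕ → Prop) [DecidableRel rel] (m n : ℕ) (g : ℝ → ℝ)
    (x y : ℕ → ℝ) : ℝ :=
  ∏ p ∈ range m, ∏ q ∈ range n, if rel p q then g (x p - y q) else 1

theorem prod_prod_ite_row {m n P : ℕ} (hP : P < m) (h : ℕ → ℝ) :
    (∏ p ∈ range m, ∏ q ∈ range n, if p = P then h q else 1) = ∏ q ∈ range n, h q := by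
  rw [prod_comm]
  refine prod_congr rfl fun q _ => ?_
  rw [prod_ite_eq', if_pos (mem_range.2 hP)]

theorem prod_prod_ite_col {m n P : ℕ} (hP : P < n) (h : ℕ → ℝ) :
    (∏ p ∈ range m, ∏ q ∈ range n, if q = P then h p else 1) = ∏ p ∈ range m, h p := by
  refine prod_congr rfl fun q _ => ?_
  rw [prod_ite_eq', if_pos (mem_range.2 hP)]

/-- `x` with the entry `P` raised by one. -/
noncomputable def raiseAt (x : ℕ → ℝ) (P : ℕ) : ℕ → ℝ := Function.update x P (x P + 1)

theorem raiseAt_self (x : ℕ → ℝ) (P : ℕ) : raiseAt x P P = x P + 1 := Function.update_self ..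

theorem raiseAt_of_ne (x : ℕ → ℝ) {P q : ℕ} (h : q ≠ P) : raiseAt x P q = x q :=
  Function.update_of_ne h ..

theorem pairProd_raise_left {rel : ℕ → ℕ → Prop} [DecidableRel rel] {m n P : ℕ} (hP : P < m)
    {g : ℝ → ℝ} {x y r : ℕ → ℝ}
    (hr : ∀ q < n, rel P q → g (x P + 1 - y q) = g (x P - y q) * r q) :
    pairProd rel m n g (raiseAt x P) y =
      pairProd rel m n g x y * ∏ q ∈ range n, if rel P q then r q else 1 := by
  rw [← prod_prod_ite_row hP, pairProd, pairProd, ← prod_mul_distrib]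
  refine prod_congr rfl fun p _ => ?_
  rw [← prod_mul_distrib]
  refine prod_congr rfl fun q hq => ?_
  by_cases hp : p = P
  · subst hp
    by_cases hrel : rel p q
    · simp [hrel, raiseAt_self, hr q (mem_range.1 hq) hrel]
    · simp [hrel]
  · simp [raiseAt_of_ne x hp, hp]

theorem pairProd_raise_right {rel : ℕ → ℕ → Prop} [DecidableRel rel] {m n P : ℕ} (hP : P < n)
    {g : ℝ → ℝ} {x y r : ℕ → ℝ}
    (hr : ∀ p < m, rel p P → g (x p - (y P + 1)) = g (x p - y P) * r p) :
    pairProd rel m n g x (raiseAt y P) =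
      pairProd rel m n g x y * ∏ p ∈ range m, if rel p P then r p else 1 := by
  rw [← prod_prod_ite_col hP, pairProd, pairProd, ← prod_mul_distrib]
  refine prod_congr rfl fun p hp => ?_
  rw [← prod_mul_distrib]
  refine prod_congr rfl fun q _ => ?_
  by_cases hq : q = P
  · subst hq
    by_cases hrel : rel p q
    · simp [hrel, raiseAt_self, hr p (mem_range.1 hp) hrel]
    · simp [hrel]
  · simp [raiseAt_of_ne y hq, hq]

/-- A pair containing `P` has it as first index when `q > P` and as second index when `q < P`; a
single family `r` records both kinds of ratios. -/
theorem pairProd_raise_self {n P : ℕ} (hP : P < n) {g : ℝ → ℝ} {x r : ℕ → ℝ}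
    (h1 : ∀ q < n, P < q → g (x P + 1 - x q) = g (x P - x q) * r q)
    (h2 : ∀ q < P, g (x q - (x P + 1)) = g (x q - x P) * r q) :
    pairProd (· < ·) n n g (raiseAt x P) (raiseAt x P) =
      pairProd (· < ·) n n g x x * ∏ q ∈ (range n).erase P, r q := by
  have h3 : ∏ q ∈ (range n).erase P, r q = (∏ q ∈ range n, if P < q then r q else 1) *
      ∏ q ∈ range n, if q < P then r q else 1 := by
    rw [← prod_mul_distrib, ← mul_prod_erase _ _ (mem_range.2 hP)]
    simp only [lt_irrefl, if_false, mul_one, one_mul]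
    refine prod_congr rfl fun q hq => ?_
    rcases lt_or_gt_of_ne (ne_of_mem_erase hq) with h | h
    · simp [h, h.le.not_gt]
    · simp [h, h.le.not_gt]
  rw [pairProd_raise_left hP (r := r), pairProd_raise_right hP (r := r), h3]
  · ring
  · exact fun p _ hp => h2 p hp
  · intro q hq hPq
    rw [raiseAt_of_ne x hPq.ne', h1 q hq hPq]

/-! ### The weight of a configuration under shifts of particles -/

/-- The product of the squares of interaction numerators and denominators that measures the
asymmetry between the two sides of the particle `P`. -/
noncomputable def skew (θ X : ℝ) (n P : ℕ) (x : ℕ → ℝ) : ℝ :=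
  ∏ q ∈ (range n).erase P, if q < P then
    ((X - x q - 1 + θ) * (X - x q - θ)) / ((X - x q - 1) * (X - x q)) else 1

/-- `interaction` for sequences indexed by natural numbers. -/
noncomputable def interactionSeq (θ : ℝ) (j : ℕ) (x y : ℕ → ℝ) : ℝ :=
  pairProd (· < ·) (j + 1) (j + 1) (fun d => Real.Gamma (d + 1 - θ) / Real.Gamma d) x x *
  pairProd (· < ·) j j (fun d => Real.Gamma (d + 1) / Real.Gamma (d + θ)) y y *
  pairProd (· < ·) j (j + 1) (fun d => Real.Gamma d / Real.Gamma (d + 1 - θ)) y x *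
  pairProd (· ≤ ·) j j (fun d => Real.Gamma (d + θ) / Real.Gamma (d + 1)) x y

/-- `topFactor` for sequences indexed by natural numbers. -/
noncomputable def topFactorSeq (θ : ℝ) (w : ℝ → ℝ) (n : ℕ) (x : ℕ → ℝ) : ℝ :=
  pairProd (· < ·) n n (fun d => Real.Gamma (d + 1) / Real.Gamma (d + 1 - θ)) x x *
    ∏ p ∈ range n, w (x p)

/-- `bottomFactor` for sequences indexed by natural numbers. -/
noncomputable def bottomFactorSeq (θ : ℝ) (n : ℕ) (x : ℕ → ℝ) : ℝ :=
  pairProd (· < ·) n n (fun d => Real.Gamma (d + θ) / Real.Gamma d) x x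

/-- The first `n` entries of `x` decrease with gaps at least `θ`. -/
def Spaced (θ : ℝ) (n : ℕ) (x : ℕ → ℝ) : Prop :=
  ∀ p q, p < q → q < n → θ ≤ x p - x q

/-- The gaps between two consecutive rows. -/
structure Interlaced (θ : ℝ) (j : ℕ) (x y : ℕ → ℝ) : Prop where
  upper : Spaced θ (j + 1) x
  lower : Spaced θ j y
  lower_upper : ∀ p q, p < q → q < j + 1 → θ ≤ y p - x q
  upper_lower : ∀ p q, p ≤ q → q < j → 0 ≤ x p - y q

theorem Gamma_div_Gamma_succ {a b : ℝ} (ha : a ≠ 0) (hb : b ≠ 0) :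
    Real.Gamma (a + 1) / Real.Gamma (b + 1) = Real.Gamma a / Real.Gamma b * (a / b) := by
  rw [Real.Gamma_add_one ha, Real.Gamma_add_one hb, mul_div_mul_comm, mul_comm]

theorem Gamma_div_Gamma_pred {a b : ℝ} (ha : a ≠ 0) (hb : b ≠ 0) :
    Real.Gamma a / Real.Gamma b = Real.Gamma (a + 1) / Real.Gamma (b + 1) * (b / a) := by
  rw [Gamma_div_Gamma_succ ha hb, mul_assoc, div_mul_div_cancel₀ hb, div_self ha, mul_one]

theorem Gamma_ratio_raise {a b d : ℝ} (ha : d + a ≠ 0) (hb : d + b ≠ 0) :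
    Real.Gamma (d + 1 + a) / Real.Gamma (d + 1 + b) =
      Real.Gamma (d + a) / Real.Gamma (d + b) * ((d + a) / (d + b)) := by
  rw [← Gamma_div_Gamma_succ ha hb]
  congr 2 <;> ring

theorem Gamma_ratio_lower {a b d : ℝ} (ha : d - 1 + a ≠ 0) (hb : d - 1 + b ≠ 0) :
    Real.Gamma (d - 1 + a) / Real.Gamma (d - 1 + b) =
      Real.Gamma (d + a) / Real.Gamma (d + b) * ((d - 1 + b) / (d - 1 + a)) := by
  rw [Gamma_div_Gamma_pred ha hb]
  congr 3 <;> ring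

theorem Spaced.gap_below {θ : ℝ} {n P : ℕ} {x : ℕ → ℝ} (h : Spaced θ n (raiseAt x P))
    (hP : P < n) {q : ℕ} (hq : q < P) : θ ≤ x q - x P - 1 := by
  have := h q P hq hP
  rw [raiseAt_self, raiseAt_of_ne x hq.ne] at this
  linarith

/-- `Γ(z + 1) = z Γ(z)` changes each pair containing `P` by a rational factor. The product on the
right uses for every `q` the form valid for `q > P`; for `q < P` the gap shrinks instead, and the
discrepancy is collected in `skew`. Spacing before and after the move keeps the divisors nonzero. -/
theorem topFactorSeq_raiseAt {θ : ℝ} (hθ : 0 < θ) {w : ℝ → ℝ} {n P : ℕ} {x : ℕ → ℝ} (hP : P < n)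
    (h : Spaced θ n x) (h' : Spaced θ n (raiseAt x P)) (hw : w (x P) ≠ 0) :
    topFactorSeq θ w n (raiseAt x P) = topFactorSeq θ w n x *
      ((∏ q ∈ (range n).erase P, (x P + 1 - x q) / (x P + 1 - x q - θ)) *
        (w (x P + 1) / w (x P)) * skew θ (x P + 1) n P x) := by
  have hw' : ∏ p ∈ range n, w (raiseAt x P p) =
      (∏ p ∈ range n, w (x p)) * (w (x P + 1) / w (x P)) := by
    rw [← mul_prod_erase _ _ (mem_range.2 hP), ← mul_prod_erase _ _ (mem_range.2 hP),
      raiseAt_self, prod_congr rfl fun q hq => by rw [raiseAt_of_ne x (ne_of_mem_erase hq)]]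
    field_simp
  rw [topFactorSeq, topFactorSeq, hw', skew, pairProd_raise_self hP
    (r := fun q => (x P + 1 - x q) / (x P + 1 - x q - θ) * if q < P then
      ((x P + 1 - x q - 1 + θ) * (x P + 1 - x q - θ)) /
        ((x P + 1 - x q - 1) * (x P + 1 - x q)) else 1), prod_mul_distrib]
  · ring
  · intro q hq hPq
    have := h P q hPq hq
    rw [if_neg hPq.not_gt, mul_one]
    have := Gamma_ratio_raise (d := x P - x q) (a := 1) (b := 1 - θ) (by linarith) (by linarith)
    convert this using 2 <;> ring_nf
  · intro q hq
    have he := h'.gap_below hP hq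
    have h2 := Gamma_ratio_lower (d := x q - x P) (a := 1) (b := 1 - θ) (by linarith) (by linarith)
    rw [if_pos hq]
    convert h2 using 2
    · ring_nf
    · ring_nf
    · ring_nf
    · rw [show x P + 1 - x q = -(x q - x P - 1) by ring]
      generalize x q - x P - 1 = e at he
      have e1 : e ≠ 0 := by linarith
      have e2 : -e - θ ≠ 0 := by linarith
      have e3 : -e - 1 ≠ 0 := by linarith
      have e4 : e + 1 ≠ 0 := by linarith
      field_simp
      ring

/-- Here the discrepancy between the two sides of `P` is inverse to that of the top factor, so
`skew` stands in the denominator. -/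
theorem bottomFactorSeq_raiseAt {θ : ℝ} (hθ : 0 < θ) {n P : ℕ} {x : ℕ → ℝ} (hP : P < n)
    (h : Spaced θ n x) (h' : Spaced θ n (raiseAt x P)) :
    bottomFactorSeq θ n (raiseAt x P) = bottomFactorSeq θ n x *
      ((∏ q ∈ (range n).erase P, (x P + 1 - x q - 1 + θ) / (x P + 1 - x q - 1)) /
        skew θ (x P + 1) n P x) := by
  rw [bottomFactorSeq, bottomFactorSeq, skew, pairProd_raise_self hP
    (r := fun q => (x P + 1 - x q - 1 + θ) / (x P + 1 - x q - 1) / if q < P then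
      ((x P + 1 - x q - 1 + θ) * (x P + 1 - x q - θ)) /
        ((x P + 1 - x q - 1) * (x P + 1 - x q)) else 1), prod_div_distrib]
  · intro q hq hPq
    have := h P q hPq hq
    rw [if_neg hPq.not_gt, div_one]
    have := Gamma_ratio_raise (d := x P - x q) (a := θ) (b := 0) (by linarith) (by linarith)
    convert this using 2 <;> ring_nf
  · intro q hq
    have he := h'.gap_below hP hq
    have h2 := Gamma_ratio_lower (d := x q - x P) (a := θ) (b := 0) (by linarith) (by linarith)
    rw [if_pos hq]
    convert h2 using 2
    · ring_nf
    · ring_nf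
    · ring_nf
    · rw [show x P + 1 - x q = -(x q - x P - 1) by ring]
      generalize x q - x P - 1 = e at he
      have e1 : e ≠ 0 := by linarith
      have e2 : -e - θ ≠ 0 := by linarith
      have e3 : -e - 1 ≠ 0 := by linarith
      have e4 : -e - 1 + θ ≠ 0 := by linarith
      have e5 : e + θ ≠ 0 := by linarith
      field_simp
      ring

/-- Only pairs within the row need the correction `skew`. The cross pairs on the two sides of `P`
change by the same rational expression and merge into one product over the lower row. -/
theorem interactionSeq_raiseAt_upper {θ : ℝ} (hθ : 0 < θ) {j P : ℕ} {x y : ℕ → ℝ}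
    (hP : P < j + 1) (h : Interlaced θ j x y) (h' : Interlaced θ j (raiseAt x P) y) :
    interactionSeq θ j (raiseAt x P) y = interactionSeq θ j x y *
      ((∏ q ∈ (range (j + 1)).erase P, (x P + 1 - x q - θ) / (x P + 1 - x q - 1)) *
        (∏ q ∈ range j, (x P + 1 - y q - 1 + θ) / (x P + 1 - y q)) /
          skew θ (x P + 1) (j + 1) P x) := by
  have hself := pairProd_raise_self (x := x) hP
    (g := fun d => Real.Gamma (d + 1 - θ) / Real.Gamma d)
    (r := fun q => (x P + 1 - x q - θ) / (x P + 1 - x q - 1) / if q < P then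
      ((x P + 1 - x q - 1 + θ) * (x P + 1 - x q - θ)) /
        ((x P + 1 - x q - 1) * (x P + 1 - x q)) else 1) ?_ ?_
  · have h1 := pairProd_raise_right (rel := (· < ·)) (m := j) (x := y) (y := x) hP
      (g := fun d => Real.Gamma d / Real.Gamma (d + 1 - θ))
      (r := fun q => (x P + 1 - y q - 1 + θ) / (x P + 1 - y q)) ?_
    · have h2 : pairProd (· ≤ ·) j j (fun d => Real.Gamma (d + θ) / Real.Gamma (d + 1))
          (raiseAt x P) y = pairProd (· ≤ ·) j j
            (fun d => Real.Gamma (d + θ) / Real.Gamma (d + 1)) x y *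
          ∏ q ∈ range j, if P ≤ q then (x P + 1 - y q - 1 + θ) / (x P + 1 - y q) else 1 := by
        -- The last particle of the upper row has no partner in the product over `p ≤ q`.
        rcases Nat.lt_succ_iff_lt_or_eq.1 hP with hPj | rfl
        · refine pairProd_raise_left hPj fun q hq hPq => ?_
          have := h.upper_lower P q hPq hq
          have h3 := Gamma_ratio_raise (d := x P - y q) (a := θ) (b := 1)
            (by linarith) (by linarith)
          convert h3 using 2 <;> ring_nf
        · rw [prod_eq_one fun q hq => if_neg (mem_range.1 hq).not_ge, mul_one]
          refine prod_congr rfl fun p hp => prod_congr rfl fun q _ => ?_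
          rw [raiseAt_of_ne x (mem_range.1 hp).ne]
      have h3 : ∏ q ∈ range j, (x P + 1 - y q - 1 + θ) / (x P + 1 - y q) =
          (∏ q ∈ range j, if q < P then (x P + 1 - y q - 1 + θ) / (x P + 1 - y q) else 1) *
          ∏ q ∈ range j, if P ≤ q then (x P + 1 - y q - 1 + θ) / (x P + 1 - y q) else 1 := by
        rw [← prod_mul_distrib]
        refine prod_congr rfl fun q _ => ?_
        rcases lt_or_ge q P with hq | hq
        · simp [hq, hq.not_ge]
        · simp [hq, hq.not_gt]
      rw [interactionSeq, interactionSeq, hself, h1, h2, h3, skew, prod_div_distrib]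
      ring
    · intro q hq hqP
      have he := h'.lower_upper q P hqP hP
      rw [raiseAt_self] at he
      have h2 := Gamma_ratio_lower (d := y q - x P) (a := 0) (b := 1 - θ)
        (by linarith) (by linarith)
      convert h2 using 2
      · ring_nf
      · ring_nf
      · ring_nf
      · rw [show x P + 1 - y q = -(y q - x P - 1) by ring]
        have he' : θ ≤ y q - x P - 1 := by linarith
        generalize y q - x P - 1 = e at he'
        rw [add_zero, div_neg, ← neg_div]
        congr 1
        ring
  · intro q hq hPq
    have := h.upper P q hPq hq
    rw [if_neg hPq.not_gt, div_one]
    have := Gamma_ratio_raise (d := x P - x q) (a := 1 - θ) (b := 0) (by linarith) (by linarith)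
    convert this using 2 <;> ring_nf
  · intro q hq
    have he := h'.upper.gap_below hP hq
    have h2 := Gamma_ratio_lower (d := x q - x P) (a := 1 - θ) (b := 0)
      (by linarith) (by linarith)
    rw [if_pos hq]
    convert h2 using 2
    · ring_nf
    · ring_nf
    · ring_nf
    · rw [show x P + 1 - x q = -(x q - x P - 1) by ring]
      generalize x q - x P - 1 = e at he
      have e1 : e ≠ 0 := by linarith
      have e2 : -e - θ ≠ 0 := by linarith
      have e3 : -e - 1 ≠ 0 := by linarith
      have e4 : -e - 1 + θ ≠ 0 := by linarith
      have e5 : e + (1 - θ) ≠ 0 := by linarith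
      field_simp
      ring

/-- The power of `skew` is opposite to that of a moved upper row. Hence a level that moves as the
upper row of one edge and the lower row of the next leaves no correction. -/
theorem interactionSeq_raiseAt_lower {θ : ℝ} (hθ : 0 < θ) {j P : ℕ} {x y : ℕ → ℝ}
    (hP : P < j) (h : Interlaced θ j x y) (h' : Interlaced θ j x (raiseAt y P)) :
    interactionSeq θ j x (raiseAt y P) = interactionSeq θ j x y *
      ((∏ q ∈ (range j).erase P, (y P + 1 - y q) / (y P + 1 - y q - 1 + θ)) *
        (∏ q ∈ range (j + 1), (y P + 1 - x q - 1) / (y P + 1 - x q - θ)) *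
          skew θ (y P + 1) j P y) := by
  have hself := pairProd_raise_self (x := y) hP
    (g := fun d => Real.Gamma (d + 1) / Real.Gamma (d + θ))
    (r := fun q => (y P + 1 - y q) / (y P + 1 - y q - 1 + θ) * if q < P then
      ((y P + 1 - y q - 1 + θ) * (y P + 1 - y q - θ)) /
        ((y P + 1 - y q - 1) * (y P + 1 - y q)) else 1) ?_ ?_
  · have h1 := pairProd_raise_left (rel := (· < ·)) (n := j + 1) (x := y) (y := x) hP
      (g := fun d => Real.Gamma d / Real.Gamma (d + 1 - θ))
      (r := fun q => (y P + 1 - x q - 1) / (y P + 1 - x q - θ)) ?_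
    · have h2 := pairProd_raise_right (rel := (· ≤ ·)) (m := j) (x := x) (y := y) hP
        (g := fun d => Real.Gamma (d + θ) / Real.Gamma (d + 1))
        (r := fun q => (y P + 1 - x q - 1) / (y P + 1 - x q - θ)) ?_
      · have h3 : ∏ q ∈ range (j + 1), (y P + 1 - x q - 1) / (y P + 1 - x q - θ) =
            (∏ q ∈ range (j + 1), if P < q then
              (y P + 1 - x q - 1) / (y P + 1 - x q - θ) else 1) *
            ∏ q ∈ range j, if q ≤ P then (y P + 1 - x q - 1) / (y P + 1 - x q - θ) else 1 := by
          rw [prod_range_succ, prod_range_succ _ j, if_pos hP, mul_right_comm, ← prod_mul_distrib]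
          congr 1
          refine prod_congr rfl fun q _ => ?_
          rcases lt_or_ge P q with hq | hq
          · simp [hq, hq.not_ge]
          · simp [hq, hq.not_gt]
        rw [interactionSeq, interactionSeq, hself, h1, h2, h3, skew, prod_mul_distrib]
        ring
      · intro q hq hqP
        have he := h'.upper_lower q P hqP hP
        rw [raiseAt_self] at he
        have h2 := Gamma_ratio_lower (d := x q - y P) (a := θ) (b := 1)
          (by linarith) (by linarith)
        convert h2 using 2
        · ring_nf
        · ring_nf
        · rw [show y P + 1 - x q - 1 = -(x q - y P - 1 + 1) by ring,
            show y P + 1 - x q - θ = -(x q - y P - 1 + θ) by ring, neg_div_neg_eq]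
    · intro q hq hPq
      have := h.lower_upper P q hPq hq
      have h3 := Gamma_ratio_raise (d := y P - x q) (a := 0) (b := 1 - θ)
        (by linarith) (by linarith)
      convert h3 using 2 <;> ring_nf
  · intro q hq hPq
    have := h.lower P q hPq hq
    rw [if_neg hPq.not_gt, mul_one]
    have := Gamma_ratio_raise (d := y P - y q) (a := 1) (b := θ) (by linarith) (by linarith)
    convert this using 2 <;> ring_nf
  · intro q hq
    have he := h'.lower.gap_below hP hq
    have h2 := Gamma_ratio_lower (d := y q - y P) (a := 1) (b := θ)
      (by linarith) (by linarith)
    rw [if_pos hq]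
    convert h2 using 2
    · ring_nf
    · ring_nf
    · rw [show y P + 1 - y q = -(y q - y P - 1) by ring]
      generalize y q - y P - 1 = e at he
      have e1 : e ≠ 0 := by linarith
      have e2 : e + 1 ≠ 0 := by linarith
      have e3 : -e - 1 ≠ 0 := by linarith
      have e4 : -e - 1 + θ ≠ 0 := by linarith
      field_simp
      ring

theorem skew_ne_zero {θ : ℝ} (hθ : 0 < θ) {n P : ℕ} {x : ℕ → ℝ} (hP : P < n)
    (h' : Spaced θ n (raiseAt x P)) : skew θ (x P + 1) n P x ≠ 0 := by
  refine prod_ne_zero_iff.2 fun q _ => ?_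
  split_ifs with hqP
  · have he := h'.gap_below hP hqP
    rw [show x P + 1 - x q = -(x q - x P - 1) by ring]
    generalize x q - x P - 1 = e at he
    have e1 : -e ≠ 0 := by linarith
    have e2 : -e - θ ≠ 0 := by linarith
    have e3 : -e - 1 ≠ 0 := by linarith
    have e4 : -e - 1 + θ ≠ 0 := by linarith
    positivity
  · exact one_ne_zero

/-- Move the upper row, then the lower one. The rational products cancel for `q ≠ P`; the diagonal
cross pair contributes `θ` in the first move and `(-1) / (-θ)` in the second. Only the two
corrections remain. -/
theorem interactionSeq_raiseAt_both {θ : ℝ} (hθ : 0 < θ) {j P : ℕ} {x y : ℕ → ℝ}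
    (hP : P < j) (hxy : x P = y P) (h : Interlaced θ j x y) (h' : Interlaced θ j (raiseAt x P) y)
    (h'' : Interlaced θ j (raiseAt x P) (raiseAt y P)) :
    interactionSeq θ j (raiseAt x P) (raiseAt y P) = interactionSeq θ j x y *
      (skew θ (y P + 1) j P y / skew θ (x P + 1) (j + 1) P x) := by
  rw [interactionSeq_raiseAt_lower hθ hP h' h'', interactionSeq_raiseAt_upper hθ (by omega) h h',
    ← mul_prod_erase _ _ (mem_range.2 hP),
    ← mul_prod_erase (range (j + 1)) _ (mem_range.2 (by omega : P < j + 1)), raiseAt_self, hxy]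
  have e1 : ∏ q ∈ (range j).erase P, (y P + 1 - y q - 1 + θ) / (y P + 1 - y q) =
      (∏ q ∈ (range j).erase P, (y P + 1 - y q) / (y P + 1 - y q - 1 + θ))⁻¹ := by
    rw [← prod_inv_distrib]
    exact prod_congr rfl fun q _ => (inv_div _ _).symm
  have e2 : ∏ q ∈ (range (j + 1)).erase P,
        (y P + 1 - raiseAt x P q - 1) / (y P + 1 - raiseAt x P q - θ) =
      (∏ q ∈ (range (j + 1)).erase P, (y P + 1 - x q - θ) / (y P + 1 - x q - 1))⁻¹ := by
    rw [← prod_inv_distrib]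
    refine prod_congr rfl fun q hq => ?_
    rw [inv_div, raiseAt_of_ne x (ne_of_mem_erase hq)]
  have n1 : ∏ q ∈ (range j).erase P, (y P + 1 - y q) / (y P + 1 - y q - 1 + θ) ≠ 0 := by
    refine prod_ne_zero_iff.2 fun q hq => ?_
    rcases lt_or_gt_of_ne (ne_of_mem_erase hq) with hqP | hqP
    · have he := h''.lower.gap_below hP hqP
      exact div_ne_zero (by linarith) (by linarith)
    · have he := h.lower P q hqP (mem_range.1 (mem_of_mem_erase hq))
      exact div_ne_zero (by linarith) (by linarith)
  have n2 : ∏ q ∈ (range (j + 1)).erase P, (y P + 1 - x q - θ) / (y P + 1 - x q - 1) ≠ 0 := by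
    refine prod_ne_zero_iff.2 fun q hq => ?_
    rcases lt_or_gt_of_ne (ne_of_mem_erase hq) with hqP | hqP
    · have he := h''.upper.gap_below (by omega) hqP
      exact div_ne_zero (by linarith) (by linarith)
    · have he := h.upper P q hqP (mem_range.1 (mem_of_mem_erase hq))
      exact div_ne_zero (by linarith) (by linarith)
  rw [e1, e2, show y P + 1 - y P - 1 + θ = θ by ring, show y P + 1 - y P = 1 by ring,
    show y P + 1 - (y P + 1) - 1 = -1 by ring, show y P + 1 - (y P + 1) - θ = -θ by ring]
  field_simp

end BetaCorners

end

section

open Finset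
namespace BetaCorners

/-! ### States in coordinates indexed by natural numbers -/

section States

variable {N k M : ℕ}

/-- The coordinate `λ^j_{q + 1}`, with value `0` outside of the range of the indices. -/
def height (ω : State N k M) (j q : ℕ) : ℕ :=
  if h : j ∈ Icc k N ∧ q < j then ω.1 ⟨j, h.1⟩ ⟨q, h.2⟩ else 0

/-- The location `ℓ^j_{q + 1}` of a particle. -/
noncomputable def pos (θ : ℝ) (ω : State N k M) (j q : ℕ) : ℝ := height ω j q - (q + 1) * θ

theorem height_of_not {ω : State N k M} {j q : ℕ} (h : ¬(j ∈ Icc k N ∧ q < j)) :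
    height ω j q = 0 := dif_neg h

theorem row_eq_pos (θ : ℝ) (ω : State N k M) {j : ℕ} (hj : j ∈ Icc k N) (p : Fin j) :
    row θ ω j p = pos θ ω j p := by
  simp only [row, pos, height]
  rw [dif_pos hj, dif_pos ⟨hj, p.2⟩]

theorem height_le (ω : State N k M) (j q : ℕ) : height ω j q ≤ M := by
  rw [height]
  split_ifs
  · exact Nat.lt_succ_iff.1 (Fin.is_lt _)
  · exact Nat.zero_le _

theorem height_anti (ω : State N k M) {j q q' : ℕ} (hq : q ≤ q') (hq' : q' < j) :
    height ω j q' ≤ height ω j q := by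
  by_cases hj : j ∈ Icc k N
  · rw [height, height, dif_pos ⟨hj, hq'⟩, dif_pos ⟨hj, hq.trans_lt hq'⟩]
    exact ω.2.1 ⟨j, hj⟩ (Fin.mk_le_mk.2 hq)
  · rw [height_of_not fun h => hj h.1]
    exact Nat.zero_le _

theorem height_le_succ (ω : State N k M) {j q : ℕ} (hj : k ≤ j) (hj' : j + 1 ≤ N) (hq : q < j) :
    height ω j q ≤ height ω (j + 1) q := by
  have h1 : j ∈ Icc k N := mem_Icc.2 ⟨hj, by omega⟩
  have h2 : j + 1 ∈ Icc k N := mem_Icc.2 ⟨by omega, hj'⟩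
  rw [height, height, dif_pos ⟨h1, hq⟩, dif_pos ⟨h2, by omega⟩]
  exact (ω.2.2 j h1 h2 ⟨q, hq⟩).1

theorem height_succ_succ_le (ω : State N k M) {j q : ℕ} (hj : k ≤ j) (hj' : j + 1 ≤ N)
    (hq : q < j) : height ω (j + 1) (q + 1) ≤ height ω j q := by
  have h1 : j ∈ Icc k N := mem_Icc.2 ⟨hj, by omega⟩
  have h2 : j + 1 ∈ Icc k N := mem_Icc.2 ⟨by omega, hj'⟩
  rw [height, height, dif_pos ⟨h2, by omega⟩, dif_pos ⟨h1, hq⟩]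
  exact (ω.2.2 j h1 h2 ⟨q, hq⟩).2

theorem height_mono (ω : State N k M) {i j q : ℕ} (hi : k ≤ i) (hij : i ≤ j) (hj : j ≤ N)
    (hq : q < i) : height ω i q ≤ height ω j q := by
  induction j, hij using Nat.le_induction with
  | base => exact le_rfl
  | succ j hij ih => exact (ih (by omega)).trans (height_le_succ ω (by omega) hj (by omega))

theorem state_ext {ω ω' : State N k M} (h : ∀ i q, height ω i q = height ω' i q) : ω = ω' := by
  refine Subtype.ext (funext fun j => funext fun q => Fin.ext ?_)
  have := h j.1 q
  rwa [height, height, dif_pos ⟨j.2, q.2⟩, dif_pos ⟨j.2, q.2⟩] at this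

theorem exists_state {h : ℕ → ℕ → ℕ} (h0 : ∀ i q, ¬(i ∈ Icc k N ∧ q < i) → h i q = 0)
    (hM : ∀ i q, h i q ≤ M)
    (hanti : ∀ i ∈ Icc k N, ∀ q, q + 1 < i → h i (q + 1) ≤ h i q)
    (h1 : ∀ i q, k ≤ i → i + 1 ≤ N → q < i → h i q ≤ h (i + 1) q)
    (h2 : ∀ i q, k ≤ i → i + 1 ≤ N → q < i → h (i + 1) (q + 1) ≤ h i q) :
    ∃ ω : State N k M, ∀ i q, height ω i q = h i q := by
  have hanti' : ∀ i ∈ Icc k N, ∀ q q', q ≤ q' → q' < i → h i q' ≤ h i q := by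
    intro i hi q q' hqq'
    induction q', hqq' using Nat.le_induction with
    | base => exact fun _ => le_rfl
    | succ q' _ ih => exact fun hq' => (hanti i hi q' hq').trans (ih (by omega))
  let lam : (j : Level k N) → Fin j.1 → Fin (M + 1) := fun j q =>
    ⟨h j.1 q, Nat.lt_succ_iff.2 (hM _ _)⟩
  have hlam : ∀ j, Antitone (lam j) := fun j q q' hqq' => hanti' j.1 j.2 q q' hqq' q'.2
  refine ⟨⟨lam, hlam, ?_⟩, ?_⟩
  · intro j hj hj' p
    exact ⟨h1 j p (mem_Icc.1 hj).1 (mem_Icc.1 hj').2 p.2,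
      h2 j p (mem_Icc.1 hj).1 (mem_Icc.1 hj').2 p.2⟩
  · intro i q
    by_cases hiq : i ∈ Icc k N ∧ q < i
    · simp only [height, dif_pos hiq, lam]
    · rw [h0 i q hiq]
      exact height_of_not hiq

instance : Nonempty (State N k M) :=
  ⟨(exists_state (h := fun _ _ => 0) (by simp) (by simp) (by simp) (by simp) (by simp)).choose⟩

variable {θ : ℝ}

theorem pos_sub_pos (ω ω' : State N k M) (i j p q : ℕ) :
    pos θ ω i p - pos θ ω' j q =
      ((height ω i p : ℝ) - height ω' j q) + ((q : ℝ) - p) * θ := by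
  simp only [pos]
  ring

theorem pos_mem (hθ : 0 < θ) (ω : State N k M) {j q : ℕ} (hj : j ≤ N) (hq : q < j) :
    pos θ ω j q ∈ Set.Icc (-(N * θ)) (M - θ) := by
  have h1 : (height ω j q : ℝ) ≤ M := by exact_mod_cast height_le ω j q
  have h2 : (q : ℝ) + 1 ≤ N := by exact_mod_cast (by omega : q + 1 ≤ N)
  have h3 : (0 : ℝ) ≤ height ω j q := Nat.cast_nonneg _
  have h4 : (0 : ℝ) ≤ q := Nat.cast_nonneg _
  constructor <;> simp only [pos] <;> nlinarith

theorem spaced_pos (hθ : 0 < θ) (ω : State N k M) (j : ℕ) : Spaced θ j (pos θ ω j) := by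
  intro p q hpq hq
  rw [pos_sub_pos]
  have h1 : (height ω j q : ℝ) ≤ height ω j p := by exact_mod_cast height_anti ω hpq.le hq
  have h2 : (p : ℝ) + 1 ≤ q := by exact_mod_cast hpq
  nlinarith

theorem interlaced_pos (hθ : 0 < θ) (ω : State N k M) {j : ℕ} (hj : k ≤ j) (hj' : j + 1 ≤ N) :
    Interlaced θ j (pos θ ω (j + 1)) (pos θ ω j) where
  upper := spaced_pos hθ ω _
  lower := spaced_pos hθ ω _
  lower_upper := by
    intro p q hpq hq
    rw [pos_sub_pos]
    obtain ⟨q, rfl⟩ : ∃ r, q = r + 1 := ⟨q - 1, by omega⟩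
    have h1 : (height ω (j + 1) (q + 1) : ℝ) ≤ height ω j p := by
      exact_mod_cast (height_succ_succ_le ω hj hj' (by omega)).trans
        (height_anti ω (by omega : p ≤ q) (by omega))
    have h2 : (p : ℝ) + 1 ≤ (q + 1 : ℕ) := by exact_mod_cast hpq
    nlinarith
  upper_lower := by
    intro p q hpq hq
    rw [pos_sub_pos]
    have h1 : (height ω j q : ℝ) ≤ height ω (j + 1) p := by
      exact_mod_cast (height_anti ω hpq hq).trans (height_le_succ ω hj hj' (by omega))
    have h2 : (p : ℝ) ≤ q := by exact_mod_cast hpq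
    nlinarith

/-! ### The weight as a product over edges -/

theorem prod_Ioi_fin {n : ℕ} (p : Fin n) (f : ℕ → ℝ) :
    ∏ q ∈ Ioi p, f q = ∏ q ∈ range n, if (p : ℕ) < q then f q else 1 := by
  rw [prod_range, ← prod_filter]
  refine prod_congr ?_ fun _ _ => rfl
  ext q
  simp

theorem topFactor_eq (w : ℝ → ℝ) {n : ℕ} {x : Fin n → ℝ} {x' : ℕ → ℝ} (h : ∀ p : Fin n, x p = x' p) :
    topFactor θ w x = topFactorSeq θ w n x' := by
  simp only [topFactor, topFactorSeq, pairProd, h]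
  congr 1
  · rw [prod_range]
    exact prod_congr rfl fun p _ => prod_Ioi_fin p fun q =>
      Real.Gamma (x' p - x' q + 1) / Real.Gamma (x' p - x' q + 1 - θ)
  · rw [prod_range]

theorem bottomFactor_eq {n : ℕ} {x : Fin n → ℝ} {x' : ℕ → ℝ} (h : ∀ p : Fin n, x p = x' p) :
    bottomFactor θ x = bottomFactorSeq θ n x' := by
  simp only [bottomFactor, bottomFactorSeq, pairProd, h]
  rw [prod_range]
  exact prod_congr rfl fun p _ => prod_Ioi_fin p fun q =>
    Real.Gamma (x' p - x' q + θ) / Real.Gamma (x' p - x' q)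

theorem interaction_eq {n : ℕ} {x : Fin (n + 1) → ℝ} {y : Fin n → ℝ} {x' y' : ℕ → ℝ}
    (hx : ∀ p : Fin (n + 1), x p = x' p) (hy : ∀ p : Fin n, y p = y' p) :
    interaction θ x y = interactionSeq θ n x' y' := by
  simp only [interaction, interactionSeq, pairProd, hx, hy]
  congr 1
  · congr 1
    · congr 1
      · rw [prod_range]
        exact prod_congr rfl fun p _ => prod_Ioi_fin p fun q =>
          Real.Gamma (x' p - x' q + 1 - θ) / Real.Gamma (x' p - x' q)
      · rw [prod_range]
        exact prod_congr rfl fun p _ => prod_Ioi_fin p fun q =>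
          Real.Gamma (y' p - y' q + 1) / Real.Gamma (y' p - y' q + θ)
    · rw [prod_range]
      exact prod_congr rfl fun p _ => prod_Ioi_fin p.castSucc fun q =>
          Real.Gamma (y' p - x' q) / Real.Gamma (y' p - x' q + 1 - θ)
  · rw [prod_range]
    refine prod_congr rfl fun p _ => ?_
    rw [prod_range, ← prod_filter]
    refine prod_congr ?_ fun _ _ => rfl
    ext q
    simp

/-- The factor of the weight that belongs to the edge between the levels `j - 1` and `j`; the
bottom and the top factors belong to the edges `k` and `N + 1`. -/
noncomputable def edgeWeight (θ : ℝ) (w : ℝ → ℝ) (ω : State N k M) (j : ℕ) : ℝ :=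
  if j = k then bottomFactorSeq θ k (pos θ ω k)
  else if j = N + 1 then topFactorSeq θ w N (pos θ ω N)
  else interactionSeq θ (j - 1) (pos θ ω j) (pos θ ω (j - 1))

theorem edgeWeight_bot (w : ℝ → ℝ) (ω : State N k M) :
    edgeWeight θ w ω k = bottomFactorSeq θ k (pos θ ω k) := if_pos rfl

theorem edgeWeight_top (hkN : k ≤ N) (w : ℝ → ℝ) (ω : State N k M) :
    edgeWeight θ w ω (N + 1) = topFactorSeq θ w N (pos θ ω N) := by
  rw [edgeWeight, if_neg (by omega), if_pos rfl]

theorem edgeWeight_succ (w : ℝ → ℝ) (ω : State N k M) {i : ℕ} (h1 : k ≤ i) (h2 : i < N) :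
    edgeWeight θ w ω (i + 1) = interactionSeq θ i (pos θ ω (i + 1)) (pos θ ω i) := by
  rw [edgeWeight, if_neg (by omega), if_neg (by omega), Nat.add_sub_cancel]

theorem edgeWeight_congr (w : ℝ → ℝ) {ω ω' : State N k M} {i : ℕ} (h1 : pos θ ω' i = pos θ ω i)
    (h2 : k < i → pos θ ω' (i - 1) = pos θ ω (i - 1)) (hi : k ≤ i) :
    edgeWeight θ w ω' i = edgeWeight θ w ω i := by
  rw [edgeWeight, edgeWeight]
  split_ifs with h3 h4
  · subst h3
    rw [h1]
  · have := h2 (by omega)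
    rw [h4, Nat.add_sub_cancel] at this
    rw [this]
  · rw [h1, h2 (by omega)]

theorem weight_eq_prod (hkN : k ≤ N) (w : ℝ → ℝ) (ω : State N k M) :
    weight θ w ω = ∏ j ∈ Ico k (N + 2), edgeWeight θ w ω j := by
  rw [prod_eq_prod_Ico_succ_bot (by omega), prod_Ico_succ_top (by omega), ← prod_Ico_add']
  have e1 : edgeWeight θ w ω k = bottomFactor θ (row θ ω k) := by
    rw [edgeWeight, if_pos rfl]
    exact (bottomFactor_eq fun p => row_eq_pos θ ω (mem_Icc.2 ⟨le_rfl, hkN⟩) p).symm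
  have e2 : edgeWeight θ w ω (N + 1) = topFactor θ w (row θ ω N) := by
    rw [edgeWeight, if_neg (by omega), if_pos rfl]
    exact (topFactor_eq w fun p => row_eq_pos θ ω (mem_Icc.2 ⟨hkN, le_rfl⟩) p).symm
  have e3 : ∀ j ∈ Ico k N, edgeWeight θ w ω (j + 1) =
      interaction θ (row θ ω (j + 1)) (row θ ω j) := by
    intro j hj
    rw [mem_Ico] at hj
    rw [edgeWeight, if_neg (by omega), if_neg (by omega)]
    exact (interaction_eq (row_eq_pos θ ω (mem_Icc.2 (by omega)))
      (row_eq_pos θ ω (mem_Icc.2 (by omega)))).symm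
  rw [e1, e2, prod_congr rfl e3, weight]
  ring

theorem pairProd_pos {rel : ℕ → ℕ → Prop} [DecidableRel rel] {m n : ℕ} {g : ℝ → ℝ} {x y : ℕ → ℝ}
    (h : ∀ p < m, ∀ q < n, rel p q → 0 < g (x p - y q)) : 0 < pairProd rel m n g x y := by
  refine prod_pos fun p hp => prod_pos fun q hq => ?_
  split_ifs with hpq
  · exact h p (mem_range.1 hp) q (mem_range.1 hq) hpq
  · exact one_pos

theorem weight_pos (hθ : 0 < θ) (hkN : k ≤ N) {w : ℝ → ℝ}
    (hw : ∀ x ∈ Set.Icc (-(N * θ)) (M - θ), 0 < w x) (ω : State N k M) : 0 < weight θ w ω := by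
  rw [weight_eq_prod hkN]
  refine prod_pos fun j hj => ?_
  rw [mem_Ico] at hj
  have hΓ : ∀ {a b : ℝ}, 0 < a → 0 < b → 0 < Real.Gamma a / Real.Gamma b := fun ha hb =>
    div_pos (Real.Gamma_pos_of_pos ha) (Real.Gamma_pos_of_pos hb)
  rw [edgeWeight]
  split_ifs with h1 h2
  · refine pairProd_pos fun p _ q hq hpq => ?_
    have := spaced_pos hθ ω k p q hpq hq
    exact hΓ (by linarith) (by linarith)
  · refine mul_pos (pairProd_pos fun p _ q hq hpq => ?_) (prod_pos fun p hp => ?_)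
    · have := spaced_pos hθ ω N p q hpq hq
      exact hΓ (by linarith) (by linarith)
    · exact hw _ (pos_mem hθ ω le_rfl (mem_range.1 hp))
  · obtain ⟨i, rfl⟩ : ∃ i, j = i + 1 := ⟨j - 1, by omega⟩
    have hI := interlaced_pos hθ ω (j := i) (by omega) (by omega)
    rw [Nat.add_sub_cancel]
    refine mul_pos (mul_pos (mul_pos ?_ ?_) ?_) ?_ <;>
      refine pairProd_pos fun p _ q hq hpq => ?_
    · have := hI.upper p q hpq hq
      exact hΓ (by linarith) (by linarith)
    · have := hI.lower p q hpq hq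
      exact hΓ (by linarith) (by linarith)
    · have := hI.lower_upper p q hpq hq
      exact hΓ (by linarith) (by linarith)
    · have := hI.upper_lower p q hpq hq
      exact hΓ (by linarith) (by linarith)

theorem sum_prob (hθ : 0 < θ) (hkN : k ≤ N) {w : ℝ → ℝ}
    (hw : ∀ x ∈ Set.Icc (-(N * θ)) (M - θ), 0 < w x) :
    ∑ ω : State N k M, prob θ w ω = 1 := by
  simp only [prob]
  rw [← sum_div, div_self]
  exact (sum_pos (fun ω _ => weight_pos hθ hkN hw ω) univ_nonempty).ne'

/-! ### Raising a particle on consecutive levels -/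

/-- `ω'` arises from `ω` by raising the particle `p` by one on the levels `j ≤ i < β`, on which
its coordinate in `ω` is constant. -/
structure IsShift (ω : State N k M) (j β p : ℕ) (ω' : State N k M) : Prop where
  le_left : k ≤ j
  lt : j < β
  le_right : β ≤ N + 1
  index_lt : p < j
  const : ∀ i, j ≤ i → i < β → height ω i p = height ω j p
  height_eq : ∀ i q, height ω' i q = height ω i q + if j ≤ i ∧ i < β ∧ q = p then 1 else 0

/-- The factor by which a particle `p` of level `j`, raised to `X`, changes the edge `j`. -/
noncomputable def upFactor (θ X : ℝ) (ω : State N k M) (j p : ℕ) : ℝ :=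
  if j = k then ∏ q ∈ (range k).erase p, (X - pos θ ω k q - 1 + θ) / (X - pos θ ω k q - 1)
  else (∏ q ∈ (range j).erase p, (X - pos θ ω j q - θ) / (X - pos θ ω j q - 1)) *
    ∏ q ∈ range (j - 1), (X - pos θ ω (j - 1) q - 1 + θ) / (X - pos θ ω (j - 1) q)

/-- The factor by which a particle `p` of level `j - 1`, lowered from `X`, changes the edge `j`. -/
noncomputable def downFactor (θ X : ℝ) (ω : State N k M) (j p : ℕ) : ℝ :=
  if j = N + 1 then ∏ q ∈ (range N).erase p, (X - pos θ ω N q - θ) / (X - pos θ ω N q)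
  else (∏ q ∈ range j, (X - pos θ ω j q - θ) / (X - pos θ ω j q - 1)) *
    ∏ q ∈ (range (j - 1)).erase p,
      (X - pos θ ω (j - 1) q - 1 + θ) / (X - pos θ ω (j - 1) q)

/-- The joint move passes through an admissible intermediate configuration if the upper row goes
first. -/
theorem Interlaced.of_raise {j P : ℕ} {x y : ℕ → ℝ} (h : Interlaced θ j x y)
    (h' : Interlaced θ j (raiseAt x P) (raiseAt y P)) : Interlaced θ j (raiseAt x P) y where
  upper := h'.upper
  lower := h.lower
  lower_upper := by
    intro p q hpq hq
    by_cases hp : p = P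
    · subst hp
      rw [raiseAt_of_ne x hpq.ne']
      exact h.lower_upper p q hpq hq
    · have := h'.lower_upper p q hpq hq
      rwa [raiseAt_of_ne y hp] at this
  upper_lower := by
    intro p q hpq hq
    have := h.upper_lower p q hpq hq
    by_cases hp : p = P
    · subst hp
      rw [raiseAt_self]
      linarith
    · rwa [raiseAt_of_ne x hp]

theorem IsShift.pos_of_mem {ω ω' : State N k M} {j β p i : ℕ} (h : IsShift ω j β p ω')
    (h1 : j ≤ i) (h2 : i < β) : pos θ ω' i = raiseAt (pos θ ω i) p := by
  ext q
  by_cases hq : q = p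
  · subst hq
    rw [raiseAt_self, pos, pos, h.height_eq, if_pos ⟨h1, h2, rfl⟩]
    push_cast
    ring
  · rw [raiseAt_of_ne _ hq, pos, pos, h.height_eq, if_neg (by tauto), add_zero]

theorem IsShift.pos_of_notMem {ω ω' : State N k M} {j β p i : ℕ} (h : IsShift ω j β p ω')
    (h1 : ¬(j ≤ i ∧ i < β)) : pos θ ω' i = pos θ ω i := by
  ext q
  rw [pos, pos, h.height_eq, if_neg (by tauto), add_zero]

theorem IsShift.pos_const {ω ω' : State N k M} {j β p i : ℕ} (h : IsShift ω j β p ω')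
    (h1 : j ≤ i) (h2 : i < β) : pos θ ω i p = pos θ ω j p := by
  rw [pos, pos, h.const i h1 h2]

/-- The edge `j` sees only its upper row move, the edge `β` only its lower row, the edges strictly
between see both, and the remaining ones see neither. The corrections `skew` are kept in indicator
form so that they telescope in the product over all edges. -/
theorem IsShift.edgeWeight_eq (hθ : 0 < θ) {w : ℝ → ℝ}
    (hw : ∀ x ∈ Set.Icc (-(N * θ)) (M - θ), 0 < w x) {ω ω' : State N k M} {j β p : ℕ}
    (h : IsShift ω j β p ω') {X : ℝ} (hX : pos θ ω j p + 1 = X) {i : ℕ} (hi : k ≤ i)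
    (hi' : i ≤ N + 1) :
    edgeWeight θ w ω' i = edgeWeight θ w ω i *
      ((if j ≤ i ∧ i < β then skew θ X i p (pos θ ω i) else 1)⁻¹ *
        (if j + 1 ≤ i ∧ i < β + 1 then skew θ X (i - 1) p (pos θ ω (i - 1)) else 1) *
        (if i = j then upFactor θ X ω j p else 1) *
        if i = β then (downFactor θ X ω β p)⁻¹ *
          (if β = N + 1 then w X / w (X - 1) else 1) else 1) := by
  obtain ⟨hkj, hjβ, hβN, hpj, -, -⟩ := id h
  have hposX : ∀ i, j ≤ i → i < β → pos θ ω i p + 1 = X := fun i h1 h2 => by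
    rw [h.pos_const h1 h2, hX]
  have hkN : k ≤ N := by omega
  rcases lt_trichotomy i j with hij | rfl | hij
  · rw [if_neg (by omega), if_neg (by omega), if_neg (by omega), if_neg (by omega),
      edgeWeight_congr w (h.pos_of_notMem (by omega)) (fun _ => h.pos_of_notMem (by omega)) hi]
    simp
  · have hpi := h.pos_of_mem (θ := θ) le_rfl hjβ
    rw [if_pos ⟨le_rfl, hjβ⟩, if_neg (by omega), if_pos rfl, if_neg (by omega)]
    rcases eq_or_lt_of_le hi with rfl | hki
    · have hs := spaced_pos hθ ω' k
      rw [hpi] at hs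
      rw [edgeWeight_bot, edgeWeight_bot, hpi,
        bottomFactorSeq_raiseAt hθ hpj (spaced_pos hθ ω k) hs, hX, upFactor, if_pos rfl]
      ring
    · obtain ⟨i, rfl⟩ : ∃ r, i = r + 1 := ⟨i - 1, by omega⟩
      have hI := interlaced_pos hθ ω (j := i) (by omega) (by omega)
      have hI' := interlaced_pos hθ ω' (j := i) (by omega) (by omega)
      have hpl := h.pos_of_notMem (θ := θ) (i := i) (by omega)
      rw [hpi, hpl] at hI'
      rw [edgeWeight_succ w ω (by omega) (by omega), edgeWeight_succ w ω' (by omega) (by omega),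
        hpi, hpl, interactionSeq_raiseAt_upper hθ (by omega) hI hI', hX, upFactor,
        if_neg (by omega), Nat.add_sub_cancel]
      ring
  · obtain ⟨i, rfl⟩ : ∃ r, i = r + 1 := ⟨i - 1, by omega⟩
    rcases lt_trichotomy (i + 1) β with hiβ | rfl | hiβ
    · rw [if_pos ⟨hij.le, hiβ⟩, if_pos (by omega), if_neg (by omega), if_neg (by omega)]
      have hpi := h.pos_of_mem (θ := θ) (i := i + 1) (by omega) (by omega)
      have hpl := h.pos_of_mem (θ := θ) (i := i) (by omega) (by omega)
      have hI := interlaced_pos hθ ω (j := i) (by omega) (by omega)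
      have hI' := interlaced_pos hθ ω' (j := i) (by omega) (by omega)
      have hXi := hposX (i + 1) (by omega) hiβ
      have hXl := hposX i (by omega) (by omega)
      rw [hpi, hpl] at hI'
      rw [edgeWeight_succ w ω (by omega) (by omega), edgeWeight_succ w ω' (by omega) (by omega),
        hpi, hpl, interactionSeq_raiseAt_both hθ (by omega) (by linarith) hI
          (hI.of_raise hI') hI', hXi, hXl, Nat.add_sub_cancel]
      ring
    · rw [if_neg (by omega), if_pos (by omega), if_neg (by omega), if_pos rfl,
        Nat.add_sub_cancel]
      have hXi := hposX i (by omega) (by omega)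
      have hpl := h.pos_of_mem (θ := θ) (i := i) (by omega) (by omega)
      rcases eq_or_lt_of_le (Nat.lt_succ_iff.1 hi') with rfl | hiN
      · have hs := spaced_pos hθ ω' i
        rw [hpl] at hs
        rw [edgeWeight_top hkN, edgeWeight_top hkN, hpl,
          topFactorSeq_raiseAt hθ (by omega) (spaced_pos hθ ω i) hs
          (hw _ (pos_mem hθ ω le_rfl (by omega))).ne', hXi,
          show X - 1 = pos θ ω i p by linarith, downFactor, if_pos rfl, if_pos rfl,
          ← prod_inv_distrib]
        simp only [inv_div]
        ring
      · have hI := interlaced_pos hθ ω (j := i) (by omega) (by omega)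
        have hI' := interlaced_pos hθ ω' (j := i) (by omega) (by omega)
        have hpi := h.pos_of_notMem (θ := θ) (i := i + 1) (by omega)
        rw [hpi, hpl] at hI'
        rw [edgeWeight_succ w ω (by omega) (by omega), edgeWeight_succ w ω' (by omega) (by omega),
          hpi, hpl, interactionSeq_raiseAt_lower hθ (by omega) hI hI', hXi, downFactor,
          if_neg (by omega), if_neg (by omega), Nat.add_sub_cancel, mul_inv, ← prod_inv_distrib,
          ← prod_inv_distrib]
        simp only [inv_div]
        ring
    · rw [if_neg (by omega), if_neg (by omega), if_neg (by omega), if_neg (by omega),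
        edgeWeight_congr w (h.pos_of_notMem (by omega)) (fun _ => h.pos_of_notMem (by omega)) hi]
      simp

end States

end BetaCorners

end

/-! ### Change of the total weight under a shift, and existence of shifts -/

section

open Finset
namespace BetaCorners

section States

variable {N k M : ℕ} {θ : ℝ}

theorem prod_ite_Ico {a b c d : ℕ} (hac : a ≤ c) (hdb : d ≤ b) (f : ℕ → ℝ) :
    (∏ i ∈ Ico a b, if c ≤ i ∧ i < d then f i else 1) = ∏ i ∈ Ico c d, f i := by
  rw [← prod_filter]
  refine prod_congr ?_ fun _ _ => rfl
  ext i
  simp only [mem_filter, mem_Ico]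
  omega

theorem IsShift.skew_ne_zero (hθ : 0 < θ) {ω ω' : State N k M} {j β p : ℕ}
    (h : IsShift ω j β p ω') {i : ℕ} (h1 : j ≤ i) (h2 : i < β) :
    skew θ (pos θ ω j p + 1) i p (pos θ ω i) ≠ 0 := by
  have hs := spaced_pos hθ ω' i
  rw [h.pos_of_mem h1 h2] at hs
  have := BetaCorners.skew_ne_zero hθ (by have := h.index_lt; omega) hs
  rwa [h.pos_const h1 h2] at this

theorem IsShift.weight_eq (hθ : 0 < θ) {w : ℝ → ℝ}
    (hw : ∀ x ∈ Set.Icc (-(N * θ)) (M - θ), 0 < w x) {ω ω' : State N k M} {j β p : ℕ}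
    (h : IsShift ω j β p ω') {X : ℝ} (hX : pos θ ω j p + 1 = X) :
    weight θ w ω' = weight θ w ω * (upFactor θ X ω j p * ((downFactor θ X ω β p)⁻¹ *
      if β = N + 1 then w X / w (X - 1) else 1)) := by
  obtain ⟨hkj, hjβ, hβN, hpj, -, -⟩ := id h
  rw [weight_eq_prod (by omega), weight_eq_prod (by omega),
    prod_congr rfl fun i hi => h.edgeWeight_eq hθ hw hX (mem_Ico.1 hi).1
      (by have := (mem_Ico.1 hi).2; omega)]
  simp only [prod_mul_distrib, prod_inv_distrib]
  -- The edge `i` carries the inverse correction of level `i`, the edge `i + 1` the correction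
  -- itself. After an index shift the two products over `Ico j β` are inverse to each other.
  rw [prod_ite_Ico hkj (by omega), prod_ite_Ico (by omega : k ≤ j + 1) (by omega), prod_ite_eq',
    prod_ite_eq', if_pos (mem_Ico.2 (by omega)), if_pos (mem_Ico.2 (by omega)), ← prod_Ico_add']
  simp only [Nat.add_sub_cancel]
  rw [inv_mul_cancel₀, one_mul]
  refine prod_ne_zero_iff.2 fun i hi => ?_
  rw [mem_Ico] at hi
  rw [← hX]
  exact h.skew_ne_zero hθ hi.1 hi.2

theorem IsShift.downFactor_eq {ω ω' : State N k M} {j β p : ℕ}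
    (h : IsShift ω j β p ω') (X : ℝ) : downFactor θ X ω' β p = downFactor θ X ω β p := by
  obtain ⟨hkj, hjβ, hβN, hpj, -, -⟩ := id h
  have hpl := h.pos_of_mem (θ := θ) (i := β - 1) (by omega) (by omega)
  have key : ∀ q ∈ (range (β - 1)).erase p, pos θ ω' (β - 1) q = pos θ ω (β - 1) q :=
    fun q hq => by rw [hpl, raiseAt_of_ne _ (ne_of_mem_erase hq)]
  rw [downFactor, downFactor]
  split_ifs with hβ
  · rw [hβ, Nat.add_sub_cancel] at key
    exact prod_congr rfl fun q hq => by rw [key q hq]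
  · rw [h.pos_of_notMem (i := β) (by omega)]
    congr 1
    exact prod_congr rfl fun q hq => by rw [key q hq]

/-- Admissibility before and after the move keeps `X` away from every zero and every pole of the
factor. -/
theorem IsShift.downFactor_ne_zero (hθ : 0 < θ) {ω ω' : State N k M} {j β p : ℕ}
    (h : IsShift ω j β p ω') {X : ℝ} (hX : pos θ ω j p + 1 = X) :
    downFactor θ X ω β p ≠ 0 := by
  obtain ⟨hkj, hjβ, hβN, hpj, -, -⟩ := id h
  obtain ⟨i, rfl⟩ : ∃ i, β = i + 1 := ⟨β - 1, by omega⟩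
  have hpl := h.pos_of_mem (θ := θ) (i := i) (by omega) (by omega)
  have hs := spaced_pos hθ ω i
  have hs' := spaced_pos hθ ω' i
  rw [hpl] at hs'
  have hXi : X = pos θ ω i p + 1 := by rw [h.pos_const (by omega) (by omega), hX]
  rw [downFactor, hXi]
  split_ifs with hβ
  · obtain rfl : i = N := by omega
    refine prod_ne_zero_iff.2 fun q hq => ?_
    rcases lt_or_gt_of_ne (ne_of_mem_erase hq) with hqp | hqp
    · have he := hs'.gap_below (by omega) hqp
      exact div_ne_zero (by linarith) (by linarith)
    · have he := hs p q hqp (mem_range.1 (mem_of_mem_erase hq))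
      exact div_ne_zero (by linarith) (by linarith)
  · have hI := interlaced_pos hθ ω (j := i) (by omega) (by omega)
    have hI' := interlaced_pos hθ ω' (j := i) (by omega) (by omega)
    rw [hpl, h.pos_of_notMem (by omega)] at hI'
    rw [Nat.add_sub_cancel]
    refine mul_ne_zero (prod_ne_zero_iff.2 fun q hq => ?_) (prod_ne_zero_iff.2 fun q hq => ?_)
    · rw [mem_range] at hq
      rcases lt_or_ge p q with hqp | hqp
      · have := hI.lower_upper p q hqp hq
        exact div_ne_zero (by linarith) (by linarith)
      · have := hI'.upper_lower q p hqp (by omega)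
        rw [raiseAt_self] at this
        exact div_ne_zero (by linarith) (by linarith)
    · rcases lt_or_gt_of_ne (ne_of_mem_erase hq) with hqp | hqp
      · have he := hs'.gap_below (by omega) hqp
        exact div_ne_zero (by linarith) (by linarith)
      · have he := hs p q hqp (mem_range.1 (mem_of_mem_erase hq))
        exact div_ne_zero (by linarith) (by linarith)

/-- The balance equation behind the cancellation: the down term of the new state at `β` against the
up term of the old state at `j`. -/
theorem IsShift.weight_mul_eq (hθ : 0 < θ) {w : ℝ → ℝ}
    (hw : ∀ x ∈ Set.Icc (-(N * θ)) (M - θ), 0 < w x) {ω ω' : State N k M} {j β p : ℕ}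
    (h : IsShift ω j β p ω') {X : ℝ} (hX : pos θ ω j p + 1 = X) :
    weight θ w ω' * downFactor θ X ω' β p = weight θ w ω * upFactor θ X ω j p *
      if β = N + 1 then w X / w (X - 1) else 1 := by
  rw [h.weight_eq hθ hw hX, h.downFactor_eq]
  field_simp [h.downFactor_ne_zero hθ hX]

/-! ### Existence and uniqueness of shifts -/

/-- If `β₁ < β₂`, the coordinate `p` of `ω` agrees on the levels `β₁ - 1` and `β₁`, and `ω₁` raises
only the lower of the two, against interlacing. -/
theorem IsShift.right_unique {ω ω₁ ω₂ : State N k M} {j β₁ β₂ p : ℕ}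
    (h₁ : IsShift ω j β₁ p ω₁) (h₂ : IsShift ω j β₂ p ω₂) : β₁ = β₂ ∧ ω₁ = ω₂ := by
  have key : ∀ {β₁ β₂ : ℕ} {ω₁ ω₂ : State N k M}, IsShift ω j β₁ p ω₁ → IsShift ω j β₂ p ω₂ →
      ¬β₁ < β₂ := by
    intro β₁ β₂ ω₁ ω₂ h₁ h₂ hlt
    have e1 := h₁.height_eq (β₁ - 1) p
    have e2 := h₁.height_eq β₁ p
    have e3 := h₂.const (β₁ - 1) (by have := h₁.lt; omega) (by omega)
    have e4 := h₂.const β₁ h₁.lt.le hlt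
    rw [if_pos ⟨by have := h₁.lt; omega, by have := h₁.lt; omega, rfl⟩] at e1
    rw [if_neg (by omega)] at e2
    have h3 := h₁.lt
    have h4 := h₂.le_right
    have h5 := h₁.le_left
    have h6 := h₁.index_lt
    have := height_mono ω₁ (i := β₁ - 1) (j := β₁) (q := p) (by omega) (by omega) (by omega)
      (by omega)
    omega
  have hβ : β₁ = β₂ := by
    have := key h₁ h₂
    have := key h₂ h₁
    omega
  subst hβ
  exact ⟨rfl, state_ext fun i q => by rw [h₁.height_eq, h₂.height_eq]⟩

/-- If `j₁ < j₂`, the coordinate `p` of `ω` agrees on the levels `j₂ - 1` and `j₂`, and `ω₂` arises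
by lowering only the upper of the two, against interlacing. -/
theorem IsShift.left_unique {ω ω₁ ω₂ : State N k M} {j₁ j₂ β p : ℕ}
    (h₁ : IsShift ω₁ j₁ β p ω) (h₂ : IsShift ω₂ j₂ β p ω) : j₁ = j₂ ∧ ω₁ = ω₂ := by
  have key : ∀ {j₁ j₂ : ℕ} {ω₁ ω₂ : State N k M}, IsShift ω₁ j₁ β p ω → IsShift ω₂ j₂ β p ω →
      ¬j₁ < j₂ := by
    intro j₁ j₂ ω₁ ω₂ h₁ h₂ hlt
    have h3 := h₂.lt
    have h4 := h₁.le_right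
    have h5 := h₁.le_left
    have h6 := h₁.index_lt
    have e1 := h₂.height_eq (j₂ - 1) p
    have e2 := h₂.height_eq j₂ p
    have e3 := h₁.height_eq (j₂ - 1) p
    have e4 := h₁.height_eq j₂ p
    have e5 := h₁.const (j₂ - 1) (by omega) (by omega)
    have e6 := h₁.const j₂ (by omega) (by omega)
    rw [if_neg (by omega)] at e1
    rw [if_pos ⟨by omega, by omega, rfl⟩] at e2 e3 e4
    have := height_mono ω₂ (i := j₂ - 1) (j := j₂) (q := p) (by omega) (by omega) (by omega)
      (by omega)
    omega
  have hj : j₁ = j₂ := by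
    have := key h₁ h₂
    have := key h₂ h₁
    omega
  subst hj
  refine ⟨rfl, state_ext fun i q => ?_⟩
  have e1 := h₁.height_eq i q
  have e2 := h₂.height_eq i q
  omega

theorem exists_raise (ω : State N k M) {j p : ℕ} (hkj : k ≤ j) (hjN : j ≤ N) (hpj : p < j)
    (hbot : 0 < p → j = k → height ω k p < height ω k (p - 1))
    (hmid : 0 < p → k < j → height ω j p < height ω (j - 1) (p - 1))
    (hM : p = 0 → height ω j p < M) : ∃ β ω', IsShift ω j β p ω' := by
  classical
  -- `β` is the first level above `j` at which the coordinate leaves its value on level `j`, or `N +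
  -- 1` if there is none. On such a level `β ≤ N` the coordinate is strictly larger, so the raised
  -- run fits below it.
  have hex : ∃ i, j < i ∧ (i = N + 1 ∨ height ω i p ≠ height ω j p) := ⟨N + 1, by omega, Or.inl rfl⟩
  set β := Nat.find hex with hβ
  obtain ⟨hjβ, hβe⟩ := Nat.find_spec hex
  rw [← hβ] at hjβ hβe
  have hβN : β ≤ N + 1 := Nat.find_min' hex ⟨by omega, Or.inl rfl⟩
  have hconst : ∀ i, j ≤ i → i < β → height ω i p = height ω j p := by
    intro i h1 h2
    rcases eq_or_lt_of_le h1 with rfl | h1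
    · rfl
    · have := Nat.find_min hex h2
      by_contra h3
      exact this ⟨h1, Or.inr h3⟩
  have hβ' : β ≤ N → height ω j p < height ω β p := by
    intro h
    have h1 : height ω β p ≠ height ω j p := hβe.resolve_left (by omega)
    have h2 := height_mono ω (q := p) hkj hjβ.le h hpj
    omega
  -- The room below the particle `p - 1` persists upwards, since that coordinate can only grow with
  -- the level.
  have hleft : ∀ i, j ≤ i → i < β → 0 < p → height ω j p < height ω i (p - 1) := by
    intro i h1 h2 hp
    rcases eq_or_lt_of_le hkj with rfl | hkj'
    · exact (hbot hp rfl).trans_le (height_mono ω le_rfl h1 (by omega) (by omega))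
    · exact (hmid hp hkj').trans_le (height_mono ω (by omega) (by omega) (by omega) (by omega))
  suffices hst : ∃ ω' : State N k M, ∀ i q,
      height ω' i q = height ω i q + if j ≤ i ∧ i < β ∧ q = p then 1 else 0 from
    hst.elim fun ω' hω' => ⟨β, ω', hkj, hjβ, hβN, hpj, hconst, hω'⟩
  refine exists_state ?_ ?_ ?_ ?_ ?_
  · intro i q h
    rw [mem_Icc] at h
    rw [height_of_not (by rwa [mem_Icc]), if_neg]
    rintro ⟨h1, h2, rfl⟩
    exact h ⟨by omega, by omega⟩
  · intro i q
    have hle := height_le ω i q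
    split_ifs with h
    · obtain ⟨h1, h2, rfl⟩ := h
      rw [hconst i h1 h2] at hle ⊢
      rcases Nat.eq_zero_or_pos q with rfl | hq
      · exact hM rfl
      · have := hleft i h1 h2 hq
        have := height_le ω i (q - 1)
        omega
    · omega
  · intro i hi q hq
    have h1 := height_anti ω (j := i) (q := q) (q' := q + 1) (by omega) hq
    split_ifs with h2 h3 h3
    · omega
    · obtain ⟨h4, h5, h6⟩ := h2
      have := hleft i h4 h5 (by omega)
      rw [h6, hconst i h4 h5]
      have h7 : p - 1 = q := by omega
      rw [h7] at this
      omega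
    · omega
    · omega
  · intro i q hi hi' hq
    have h1 := height_le_succ ω hi hi' hq
    split_ifs with h2 h3 h3
    · omega
    · obtain ⟨h4, h5, rfl⟩ := h2
      have h7 : β = i + 1 := by omega
      have := hβ' (by omega)
      rw [h7] at this
      rw [hconst i h4 h5]
      omega
    · omega
    · omega
  · intro i q hi hi' hq
    have h1 := height_succ_succ_le ω hi hi' hq
    split_ifs with h2 h3 h3
    · omega
    · obtain ⟨h4, h5, h6⟩ := h2
      have h7 : p - 1 = q := by omega
      rw [h6, hconst (i + 1) h4 h5]
      rcases eq_or_lt_of_le h4 with h8 | h8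
      · have := hmid (by omega) (by omega)
        rw [h7, h8, Nat.add_sub_cancel] at this
        rw [h8]
        omega
      · have := hleft i (by omega) (by omega) (by omega)
        rw [h7] at this
        omega
    · omega
    · omega

theorem exists_lower (ω' : State N k M) {β p : ℕ} (hkβ : k < β) (hβN : β ≤ N + 1) (hpβ : p + 1 < β)
    (hmid : β ≤ N → height ω' β (p + 1) < height ω' (β - 1) p)
    (htop : β = N + 1 → p + 1 < N → height ω' N (p + 1) < height ω' N p)
    (h0 : β = N + 1 → p + 1 = N → 0 < height ω' N p) : ∃ j ω, IsShift ω j β p ω' := by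
  classical
  -- `j` is the lowest level containing the index `p` from which the coordinate stays at its value
  -- on level `β - 1`.
  have hex : ∃ j, k ≤ j ∧ p < j ∧ j < β ∧ ∀ i, j ≤ i → i < β →
      height ω' i p = height ω' (β - 1) p :=
    ⟨β - 1, by omega, by omega, by omega, fun i h1 h2 => by rw [show i = β - 1 by omega]⟩
  set j := Nat.find hex with hj
  obtain ⟨hkj, hpj, hjβ, hconst⟩ := Nat.find_spec hex
  rw [← hj] at hkj hpj hjβ hconst
  set b := height ω' (β - 1) p with hb
  -- Positivity protects the subtraction in `ℕ` below from truncation.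
  have hb0 : 0 < b := by
    rcases eq_or_lt_of_le hβN with rfl | hβ
    · rw [Nat.add_sub_cancel] at hb
      rcases eq_or_lt_of_le (by omega : p + 1 ≤ N) with h | h
      · have := h0 rfl h
        omega
      · have := htop rfl h
        omega
    · have := hmid (by omega)
      omega
  have hjlow : k ≤ j - 1 → p < j - 1 → height ω' (j - 1) p < b := by
    intro h1 h2
    have h3 := height_mono ω' (q := p) h1 (by omega : j - 1 ≤ j) (by omega) h2
    rw [hconst j le_rfl hjβ] at h3
    refine lt_of_le_of_ne h3 fun h4 => ?_
    refine Nat.find_min hex (m := j - 1) (by omega) ⟨h1, h2, by omega, fun i h5 h6 => ?_⟩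
    rcases eq_or_lt_of_le h5 with h7 | h7
    · rw [← h7]
      exact h4
    · exact hconst i (by omega) h6
  have hright : ∀ i, j ≤ i → i < β → p + 1 < i → height ω' i (p + 1) < b := by
    intro i h1 h2 h3
    rcases eq_or_lt_of_le hβN with h4 | h4
    · have h5 : β - 1 = N := by omega
      rw [h5] at hb
      have := htop h4 (by omega)
      exact (height_mono ω' (by omega) (by omega : i ≤ N) le_rfl h3).trans_lt (by omega)
    · exact (height_mono ω' (by omega) h2.le (by omega) h3).trans_lt (hmid (by omega))
  suffices hst : ∃ ω : State N k M, ∀ i q,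
      height ω i q = height ω' i q - if j ≤ i ∧ i < β ∧ q = p then 1 else 0 by
    obtain ⟨ω, hω⟩ := hst
    refine ⟨j, ω, hkj, hjβ, hβN, hpj, fun i h1 h2 => ?_, fun i q => ?_⟩
    · rw [hω, hω, if_pos ⟨h1, h2, rfl⟩, if_pos ⟨le_rfl, hjβ, rfl⟩, hconst i h1 h2,
        hconst j le_rfl hjβ]
    · rw [hω]
      split_ifs with h
      · obtain ⟨h1, h2, rfl⟩ := h
        have := hconst i h1 h2
        omega
      · omega
  refine exists_state ?_ ?_ ?_ ?_ ?_
  · intro i q h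
    rw [height_of_not h, Nat.zero_sub]
  · intro i q
    exact (Nat.sub_le _ _).trans (height_le ω' i q)
  · intro i hi q hq
    have h1 := height_anti ω' (j := i) (q := q) (q' := q + 1) (by omega) hq
    split_ifs with h2 h3 h3
    · omega
    · omega
    · obtain ⟨h4, h5, rfl⟩ := h3
      have := hright i h4 h5 hq
      rw [hconst i h4 h5]
      omega
    · omega
  · intro i q hi hi' hq
    have h1 := height_le_succ ω' hi hi' hq
    split_ifs with h2 h3 h3
    · omega
    · omega
    · obtain ⟨h4, h5, rfl⟩ := h3
      obtain h6 : j = i + 1 := by omega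
      have := hjlow (by omega) (by omega)
      rw [h6, Nat.add_sub_cancel] at this
      rw [hconst (i + 1) h4 h5]
      omega
    · omega
  · intro i q hi hi' hq
    have h1 := height_succ_succ_le ω' hi hi' hq
    split_ifs with h2 h3 h3
    · omega
    · omega
    · obtain ⟨h4, h5, rfl⟩ := h3
      rw [hconst i h4 h5]
      rcases eq_or_lt_of_le (by omega : i + 1 ≤ β) with h6 | h6
      · have := hmid (by omega)
        rw [h6]
        omega
      · have := hright (i + 1) (by omega) h6 (by omega)
        omega
    · omega

end States

end BetaCorners

end

section

open Finset
namespace BetaCorners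

/-! ### Cancellation of the residues -/

/-- The partner of a term is only known to exist, and only when the term is nonzero; a relation that
is single-valued in both directions is enough to match the sums. -/
theorem sum_eq_sum_of_rel {α β : Type*} {s : Finset α} {t : Finset β} {f : α → ℂ} {g : β → ℂ}
    (R : α → β → Prop) (hs : ∀ a ∈ s, f a ≠ 0 → ∃ b ∈ t, R a b)
    (ht : ∀ b ∈ t, g b ≠ 0 → ∃ a ∈ s, R a b) (hr : ∀ a b b', R a b → R a b' → b = b')
    (hl : ∀ a a' b, R a b → R a' b → a = a') (hfg : ∀ a ∈ s, ∀ b ∈ t, R a b → f a = g b) :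
    ∑ a ∈ s, f a = ∑ b ∈ t, g b := by
  choose i hit hiR using hs
  refine sum_bij_ne_zero i hit (fun a₁ h₁ h₁' a₂ h₂ h₂' h => ?_) (fun b hb hgb => ?_)
    (fun a h h' => hfg a h _ (hit a h h') (hiR a h h'))
  · exact hl _ _ _ (hiR a₁ h₁ h₁') (h ▸ hiR a₂ h₂ h₂')
  · obtain ⟨a, ha, hab⟩ := ht b hb hgb
    have hfa : f a ≠ 0 := by rwa [hfg a ha b hb hab]
    exact ⟨a, ha, hfa, hr _ _ _ (hiR a ha hfa) hab⟩

section States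

variable {N k M : ℕ} {θ : ℝ}

/-- This and the next three lemmas show that a move blocked by a neighbour contributes nothing: the
neighbour then sits exactly where a numerator vanishes. -/
theorem upFactor_eq_zero_bot {X : ℝ} {ω : State N k M} {p : ℕ} (hp : p + 1 < k)
    (hX : pos θ ω k (p + 1) + 1 = X) (h : height ω k p = height ω k (p + 1)) :
    upFactor θ X ω k (p + 1) = 0 := by
  rw [upFactor, if_pos rfl]
  refine prod_eq_zero (i := p) (by simp only [mem_erase, mem_range]; omega) ?_
  rw [← hX, pos, pos, h]
  push_cast
  rw [div_eq_zero_iff]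
  left
  ring

theorem upFactor_eq_zero_mid {X : ℝ} {ω : State N k M} {j p : ℕ} (hj : k < j) (hp : p + 1 < j)
    (hX : pos θ ω j (p + 1) + 1 = X) (h : height ω (j - 1) p = height ω j (p + 1)) :
    upFactor θ X ω j (p + 1) = 0 := by
  rw [upFactor, if_neg (by omega)]
  refine mul_eq_zero_of_right _ (prod_eq_zero (i := p) (by rw [mem_range]; omega) ?_)
  rw [← hX, pos, pos, h]
  push_cast
  rw [div_eq_zero_iff]
  left
  ring

theorem downFactor_eq_zero_top {X : ℝ} {ω : State N k M} {p : ℕ} (hp : p + 1 < N)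
    (hX : pos θ ω N p = X) (h : height ω N (p + 1) = height ω N p) :
    downFactor θ X ω (N + 1) p = 0 := by
  rw [downFactor, if_pos rfl]
  refine prod_eq_zero (i := p + 1) (by simp only [mem_erase, mem_range]; omega) ?_
  rw [← hX, pos, pos, h]
  push_cast
  rw [div_eq_zero_iff]
  left
  ring

theorem downFactor_eq_zero_mid {X : ℝ} {ω : State N k M} {j p : ℕ} (hj : j ≤ N) (hp : p + 1 < j)
    (hX : pos θ ω (j - 1) p = X) (h : height ω j (p + 1) = height ω (j - 1) p) :
    downFactor θ X ω j p = 0 := by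
  rw [downFactor, if_neg (by omega)]
  refine mul_eq_zero_of_left (prod_eq_zero (i := p + 1) (by rw [mem_range]; omega) ?_) _
  rw [← hX, pos, pos, h]
  push_cast
  rw [div_eq_zero_iff]
  left
  ring

/-- A nonzero factor excludes obstruction by neighbours. The remaining obstacle is the ceiling `M`
for the first particle, which would put `X` at `M + 1 - θ`. -/
theorem exists_isShift_of_upFactor {X : ℝ} (hX : X ≠ M + 1 - θ) {ω : State N k M} {j p : ℕ}
    (hkj : k ≤ j) (hjN : j ≤ N) (hpj : p < j) (hpX : pos θ ω j p + 1 = X)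
    (hU : upFactor θ X ω j p ≠ 0) : ∃ β ω', IsShift ω j β p ω' := by
  refine exists_raise ω hkj hjN hpj ?_ ?_ ?_
  · rintro hp rfl
    obtain ⟨p, rfl⟩ : ∃ r, p = r + 1 := ⟨p - 1, by omega⟩
    rw [Nat.add_sub_cancel]
    exact lt_of_le_of_ne (height_anti ω (by omega) hpj) fun h =>
      hU (upFactor_eq_zero_bot hpj hpX h.symm)
  · intro hp hk
    obtain ⟨p, rfl⟩ : ∃ r, p = r + 1 := ⟨p - 1, by omega⟩
    rw [Nat.add_sub_cancel]
    have h1 := height_succ_succ_le ω (j := j - 1) (q := p) (by omega) (by omega) (by omega)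
    rw [Nat.sub_add_cancel (by omega)] at h1
    exact lt_of_le_of_ne h1 fun h => hU (upFactor_eq_zero_mid hk hpj hpX h.symm)
  · rintro rfl
    refine lt_of_le_of_ne (height_le ω j 0) fun h => hX ?_
    rw [← hpX, pos, h]
    push_cast
    ring

/-- The obstacle not seen by the factor is the floor `0` for the last particle of the top row, which
would put `X` at `-Nθ`. -/
theorem exists_isShift_of_downFactor {X : ℝ} (hX : X ≠ -(N * θ)) {ω : State N k M} {β p : ℕ}
    (hkβ : k < β) (hβN : β ≤ N + 1) (hpβ : p < β - 1) (hpX : pos θ ω (β - 1) p = X)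
    (hD : downFactor θ X ω β p ≠ 0) : ∃ j ω', IsShift ω' j β p ω := by
  refine exists_lower ω hkβ hβN (by omega) ?_ ?_ ?_
  · intro hβ
    have h1 := height_succ_succ_le ω (j := β - 1) (q := p) (by omega) (by omega) (by omega)
    rw [Nat.sub_add_cancel (by omega)] at h1
    exact lt_of_le_of_ne h1 fun h => hD (downFactor_eq_zero_mid hβ (by omega) hpX h)
  · rintro rfl hp
    exact lt_of_le_of_ne (height_anti ω (by omega) hp) fun h =>
      hD (downFactor_eq_zero_top hp hpX h)
  · rintro rfl hp
    refine Nat.pos_of_ne_zero fun h => hX ?_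
    rw [Nat.add_sub_cancel] at hpX
    rw [← hpX, pos, h, ← hp]
    push_cast
    ring

/-- Shifts match the nonzero terms on the two sides, indexed by state, edge and particle, and the
balance equation makes matched terms equal. The freedom in `φ` admits any quantity conserved along
shifts; later it carries the spectral parameters. -/
theorem sum_upFactor_eq_sum_downFactor (hθ : 0 < θ) {w : ℝ → ℝ}
    (hw : ∀ x ∈ Set.Icc (-(N * θ)) (M - θ), 0 < w x) {X : ℝ} (hX₁ : X ≠ -(N * θ))
    (hX₂ : X ≠ M + 1 - θ) {cp cm : ℂ}
    (hc : X ∈ Set.Icc (-(N * θ) + 1) (M - θ) → ((w X / w (X - 1) : ℝ) : ℂ) * cm = cp)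
    (φ : State N k M → ℕ → ℂ)
    (hφ : ∀ ω j β p ω', IsShift ω j β p ω' → pos θ ω j p + 1 = X → φ ω j = φ ω' β) :
    ∑ ω : State N k M, ∑ j ∈ Icc k N, ∑ p ∈ range j, (if pos θ ω j p + 1 = X then
        (weight θ w ω : ℂ) * upFactor θ X ω j p * cp * φ ω j else 0) =
      ∑ ω : State N k M, ∑ j ∈ Icc (k + 1) (N + 1), ∑ p ∈ range (j - 1),
        if pos θ ω (j - 1) p = X then (weight θ w ω : ℂ) * downFactor θ X ω j p *
          (if j = N + 1 then cm else cp) * φ ω j else 0 := by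
  simp only [sum_sigma']
  refine sum_eq_sum_of_rel (fun a b => a.2.2 = b.2.2 ∧
    IsShift a.1 a.2.1 b.2.1 a.2.2 b.1 ∧ pos θ a.1 a.2.1 a.2.2 + 1 = X) ?_ ?_ ?_ ?_ ?_
  · rintro ⟨ω, j, p⟩ ha hf
    simp only [mem_sigma, mem_univ, true_and, mem_Icc, mem_range] at ha
    obtain ⟨⟨hkj, hjN⟩, hpj⟩ := ha
    simp only [ne_eq, ite_eq_right_iff, Classical.not_imp] at hf
    obtain ⟨hpX, hne⟩ := hf
    have hU : upFactor θ X ω j p ≠ 0 := fun h => hne (by simp [h])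
    obtain ⟨β, ω', hS⟩ := exists_isShift_of_upFactor hX₂ hkj hjN hpj hpX hU
    refine ⟨⟨ω', β, p⟩, ?_, rfl, hS, hpX⟩
    have h1 := hS.lt
    have h2 := hS.le_right
    simp only [mem_sigma, mem_univ, true_and, mem_Icc, mem_range]
    omega
  · rintro ⟨ω', β, p⟩ hb hg
    simp only [mem_sigma, mem_univ, true_and, mem_Icc, mem_range] at hb
    obtain ⟨⟨hkβ, hβN⟩, hpβ⟩ := hb
    simp only [ne_eq, ite_eq_right_iff, Classical.not_imp] at hg
    obtain ⟨hpX, hne⟩ := hg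
    have hD : downFactor θ X ω' β p ≠ 0 := fun h => hne (by simp [h])
    obtain ⟨j, ω, hS⟩ := exists_isShift_of_downFactor hX₁ (by omega) hβN hpβ hpX hD
    have h1 := hS.lt
    have h2 := hS.le_left
    have h3 := hS.index_lt
    refine ⟨⟨ω, j, p⟩, ?_, rfl, hS, ?_⟩
    · simp only [mem_sigma, mem_univ, true_and, mem_Icc, mem_range]
      omega
    · rw [hS.pos_of_mem (by omega) (by omega), raiseAt_self,
        hS.pos_const (by omega) (by omega)] at hpX
      exact hpX
  · rintro ⟨ω, j, p⟩ ⟨ω₁, β₁, p₁⟩ ⟨ω₂, β₂, p₂⟩ ⟨h1, h2, -⟩ ⟨h3, h4, -⟩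
    dsimp only at h1 h2 h3 h4
    subst h1 h3
    obtain ⟨rfl, rfl⟩ := h2.right_unique h4
    rfl
  · rintro ⟨ω₁, j₁, p₁⟩ ⟨ω₂, j₂, p₂⟩ ⟨ω, β, p⟩ ⟨h1, h2, -⟩ ⟨h3, h4, -⟩
    dsimp only at h1 h2 h3 h4
    subst h1 h3
    obtain ⟨rfl, rfl⟩ := h2.left_unique h4
    rfl
  · rintro ⟨ω, j, p⟩ - ⟨ω', β, p'⟩ - ⟨h1, hS, hpX⟩
    dsimp only at h1 hS hpX ⊢
    subst h1
    have h1 := hS.lt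
    have h2 := hS.le_left
    have h3 := hS.index_lt
    have h4 := hS.le_right
    have hpX' : pos θ ω' (β - 1) p = X := by
      rw [hS.pos_of_mem (by omega) (by omega), raiseAt_self,
        hS.pos_const (by omega) (by omega), hpX]
    rw [if_pos hpX, if_pos hpX', hφ ω j β p ω' hS hpX]
    congr 1
    have hW : (weight θ w ω' : ℂ) * downFactor θ X ω' β p = weight θ w ω * upFactor θ X ω j p *
        ((if β = N + 1 then w X / w (X - 1) else 1 : ℝ) : ℂ) := by
      exact_mod_cast hS.weight_mul_eq hθ hw hpX
    rw [hW]
    split_ifs with hβ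
    -- For `β = N + 1` both `X - 1` and `X` are occupied sites, of the old and the new state, which
    -- places `X` where the ratio condition holds.
    · rw [mul_assoc, mul_assoc, mul_assoc, hc]
      subst hβ
      rw [Nat.add_sub_cancel] at hpX'
      have m1 := (pos_mem hθ ω (by omega : j ≤ N) hS.index_lt).1
      have m2 := (pos_mem hθ ω' le_rfl (by omega : p < N)).2
      constructor <;> linarith
    · simp

end States

end BetaCorners

end

section

open Finset Filter Topology
namespace BetaCorners

/-! ### Residues of the observables -/

theorem tendsto_sub_self (c : ℂ) : Tendsto (fun u : ℂ => u - c) (𝓝[≠] c) (𝓝 0) := by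
  have : ContinuousAt (fun u : ℂ => u - c) c := by fun_prop
  have h := this.tendsto
  rw [sub_self] at h
  exact h.mono_left nhdsWithin_le_nhds

section Rational

variable {s : Finset ℕ} {a b : ℕ → ℝ} {X : ℝ}

theorem tendsto_prod_div (hb : ∀ q ∈ s, b q ≠ X) :
    Tendsto (fun u : ℂ => ∏ q ∈ s, (u - a q) / (u - b q)) (𝓝[≠] (X : ℂ))
      (𝓝 ((∏ q ∈ s, (X - a q) / (X - b q) : ℝ) : ℂ)) := by
  push_cast
  refine tendsto_finsetProd _ fun q hq => Tendsto.mono_left ?_ nhdsWithin_le_nhds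
  refine Tendsto.div ((continuous_id.sub continuous_const).tendsto _)
    ((continuous_id.sub continuous_const).tendsto _) ?_
  simp only [ne_eq, sub_eq_zero]
  exact fun h => hb q hq (by exact_mod_cast h.symm)

theorem tendsto_mul_prod_div (hb : ∀ p ∈ s, ∀ q ∈ s, b p = b q → p = q) :
    Tendsto (fun u : ℂ => (u - X) * ∏ q ∈ s, (u - a q) / (u - b q)) (𝓝[≠] (X : ℂ))
      (𝓝 ((∑ p ∈ s, if b p = X then
        (X - a p) * ∏ q ∈ s.erase p, (X - a q) / (X - b q) else 0 : ℝ) : ℂ)) := by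
  have hX := tendsto_sub_self (X : ℂ)
  by_cases h : ∃ p ∈ s, b p = X
  · obtain ⟨p, hp, hpX⟩ := h
    rw [sum_eq_single_of_mem p hp fun q hq hqp => if_neg fun h => hqp (hb q hq p hp (h.trans hpX.symm)),
      if_pos hpX]
    have h1 : Tendsto (fun u : ℂ => (u - a p) * ∏ q ∈ s.erase p, (u - a q) / (u - b q))
        (𝓝[≠] (X : ℂ)) (𝓝 (((X - a p) * ∏ q ∈ s.erase p, (X - a q) / (X - b q) : ℝ) : ℂ)) := by
      rw [Complex.ofReal_mul]
      refine Tendsto.mul ?_ (tendsto_prod_div fun q hq h => ?_)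
      · rw [Complex.ofReal_sub]
        exact ((continuous_id.sub continuous_const).tendsto _).mono_left nhdsWithin_le_nhds
      · exact (ne_of_mem_erase hq) (hb q (mem_of_mem_erase hq) p hp (h.trans hpX.symm))
    refine h1.congr' ?_
    filter_upwards [self_mem_nhdsWithin] with u hu
    have hu' : u - X ≠ 0 := sub_ne_zero.2 hu
    rw [← mul_prod_erase s _ hp, hpX, ← mul_assoc, mul_div_cancel₀ _ hu']
  · push Not at h
    rw [sum_eq_zero fun q hq => if_neg (h q hq)]
    simpa using hX.mul (tendsto_prod_div (a := a) h)

/-- The pole of the factor `p` cancels against the zero of the factor `p'`; what remains is the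
crossed quotient of `u - a p` by `u - b p'`. -/
theorem exists_tendsto_prod_div {p p' : ℕ} (hp : p ∈ s) (hpX : b p = X) (hp' : p' ∈ s)
    (hpp' : p' ≠ p) (hp'X : a p' = X) (hb : ∀ q ∈ s, q ≠ p → b q ≠ X) :
    ∃ c : ℂ, Tendsto (fun u : ℂ => ∏ q ∈ s, (u - a q) / (u - b q)) (𝓝[≠] (X : ℂ)) (𝓝 c) := by
  have h1 : p ∈ s.erase p' := mem_erase.2 ⟨hpp'.symm, hp⟩
  have h2 : Tendsto (fun u : ℂ => (u - a p) / (u - b p') *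
      ∏ q ∈ (s.erase p').erase p, (u - a q) / (u - b q)) (𝓝[≠] (X : ℂ))
      (𝓝 (((X - a p) / (X - b p') * ∏ q ∈ (s.erase p').erase p, (X - a q) / (X - b q) : ℝ) : ℂ)) := by
    rw [Complex.ofReal_mul]
    refine Tendsto.mul ?_ (tendsto_prod_div fun q hq => ?_)
    · push_cast
      refine Tendsto.mono_left ?_ nhdsWithin_le_nhds
      refine Tendsto.div ((continuous_id.sub continuous_const).tendsto _)
        ((continuous_id.sub continuous_const).tendsto _) ?_
      simp only [ne_eq, sub_eq_zero]
      exact fun h => hb p' hp' hpp' (by exact_mod_cast h.symm)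
    · simp only [mem_erase] at hq
      exact hb q hq.2.2 hq.1
  refine ⟨_, h2.congr' ?_⟩
  filter_upwards [self_mem_nhdsWithin] with u hu
  have hu' : u - X ≠ 0 := sub_ne_zero.2 hu
  rw [← mul_prod_erase s _ hp', ← mul_prod_erase _ _ h1, hpX, hp'X]
  field_simp

theorem tendsto_sub_mul_inv (c : ℝ) :
    Tendsto (fun u : ℂ => (u - X) * (1 / (u - c))) (𝓝[≠] (X : ℂ))
      (𝓝 (if c = X then 1 else 0)) := by
  split_ifs with h
  · subst h
    refine tendsto_const_nhds.congr' ?_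
    filter_upwards [self_mem_nhdsWithin] with u hu
    rw [mul_one_div_cancel (sub_ne_zero.2 hu)]
  · have hc : (X : ℂ) - c ≠ 0 := sub_ne_zero.2 fun h' => h (by exact_mod_cast h'.symm)
    have : ContinuousAt (fun u : ℂ => (u - X) * (1 / (u - c))) (X : ℂ) := by
      fun_prop (disch := exact hc)
    have h2 := this.tendsto
    simp only [sub_self, zero_mul] at h2
    exact h2.mono_left nhdsWithin_le_nhds

end Rational

/-! ### Limits of the middle observables at their possible poles -/

section Middle

variable {θ X : ℝ} {x y : ℕ → ℝ} {m n : ℕ}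

/-- A pole of the upper row leaves the numerator `1 - θ`, one of the lower row leaves `-(1 - θ)`. If
both rows have a pole at `X`, the hypothesis supplies a compensating zero in each product and the
limit is `0`. -/
theorem tendsto_mul_middle
    (hx : ∀ p ∈ range m, ∀ q ∈ range m, x p = x q → p = q)
    (hy : ∀ p ∈ range n, ∀ q ∈ range n, y p = y q → p = q)
    (hxy : ∀ p < m, ∀ q < n, x p + 1 = X → y q = X →
      (∃ p' < m, p' ≠ p ∧ x p' + θ = X) ∧ ∃ q' < n, q' ≠ q ∧ y q' + 1 - θ = X) :
    Tendsto (fun u : ℂ => (u - X) * ((∏ q ∈ range m, (u - x q - θ) / (u - x q - 1)) *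
        ∏ q ∈ range n, (u - y q + θ - 1) / (u - y q))) (𝓝[≠] (X : ℂ))
      (𝓝 (((1 - θ) * ((∑ p ∈ range m, if x p + 1 = X then
          (∏ q ∈ (range m).erase p, (X - x q - θ) / (X - x q - 1)) *
            ∏ q ∈ range n, (X - y q - 1 + θ) / (X - y q) else 0) -
        ∑ p ∈ range n, if y p = X then (∏ q ∈ range m, (X - x q - θ) / (X - x q - 1)) *
            ∏ q ∈ (range n).erase p, (X - y q - 1 + θ) / (X - y q) else 0) : ℝ) : ℂ)) := by
  have ex : ∀ u : ℂ, ∏ q ∈ range m, (u - x q - θ) / (u - x q - 1) =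
      ∏ q ∈ range m, (u - ((x q + θ : ℝ) : ℂ)) / (u - ((x q + 1 : ℝ) : ℂ)) := fun u =>
    prod_congr rfl fun q _ => by push_cast; congr 1 <;> ring
  have ey : ∀ u : ℂ, ∏ q ∈ range n, (u - y q + θ - 1) / (u - y q) =
      ∏ q ∈ range n, (u - ((y q + 1 - θ : ℝ) : ℂ)) / (u - (y q : ℂ)) := fun u =>
    prod_congr rfl fun q _ => by push_cast; congr 1; ring
  have rx : ∀ s : Finset ℕ, ∏ q ∈ s, (X - x q - θ) / (X - x q - 1) =
      ∏ q ∈ s, (X - (x q + θ)) / (X - (x q + 1)) := fun s =>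
    prod_congr rfl fun q _ => by congr 1 <;> ring
  have ry : ∀ s : Finset ℕ, ∏ q ∈ s, (X - y q - 1 + θ) / (X - y q) =
      ∏ q ∈ s, (X - (y q + 1 - θ)) / (X - y q) := fun s =>
    prod_congr rfl fun q _ => by congr 1; ring
  simp only [ex, ey, rx, ry]
  have hx' : ∀ p ∈ range m, ∀ q ∈ range m, x p + 1 = x q + 1 → p = q :=
    fun p hp q hq h => hx p hp q hq (by linarith)
  by_cases h1 : ∃ p < m, x p + 1 = X
  · by_cases h2 : ∃ q < n, y q = X
    · obtain ⟨p, hp, hpX⟩ := h1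
      obtain ⟨q, hq, hqX⟩ := h2
      obtain ⟨⟨p', hp', hpp', hp'X⟩, q', hq', hqq', hq'X⟩ := hxy p hp q hq hpX hqX
      obtain ⟨c, hc⟩ := exists_tendsto_prod_div (s := range m) (X := X) (a := fun q => x q + θ)
        (b := fun q => x q + 1) (mem_range.2 hp) hpX (mem_range.2 hp') hpp' hp'X
        (fun r hr hrp h => hrp (hx' r hr p (mem_range.2 hp) (h.trans hpX.symm)))
      obtain ⟨d, hd⟩ := exists_tendsto_prod_div (s := range n) (X := X)
        (a := fun q => y q + 1 - θ) (b := y) (mem_range.2 hq) hqX (mem_range.2 hq') hqq' hq'X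
        (fun r hr hrp h => hrp (hy r hr q (mem_range.2 hq) (h.trans hqX.symm)))
      have hX := tendsto_sub_self (X : ℂ)
      -- Both sums on the right vanish by the convention `x / 0 = 0`: each term still contains the
      -- full product of the other row.
      have z1 : ∏ q ∈ range n, (X - (y q + 1 - θ)) / (X - y q) = 0 :=
        prod_eq_zero (mem_range.2 hq) (by rw [hqX, sub_self, div_zero])
      have z2 : ∏ q ∈ range m, (X - (x q + θ)) / (X - (x q + 1)) = 0 :=
        prod_eq_zero (mem_range.2 hp) (by rw [hpX, sub_self, div_zero])
      rw [z1, z2]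
      simpa using hX.mul (hc.mul hd)
    · have hyX : ∀ q ∈ range n, y q ≠ X := fun q hq h => h2 ⟨q, mem_range.1 hq, h⟩
      rw [sum_eq_zero fun q hq => if_neg (hyX q hq), sub_zero]
      have h3 := (tendsto_mul_prod_div (a := fun q => x q + θ) (X := X) hx').mul
        (tendsto_prod_div (a := fun q => y q + 1 - θ) hyX)
      simp only [mul_assoc] at h3
      convert h3 using 2
      rw [← Complex.ofReal_mul, sum_mul, mul_sum]
      congr 1
      refine sum_congr rfl fun p _ => ?_
      split_ifs with h
      · rw [← h]; ring
      · ring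
  · have hxX : ∀ q ∈ range m, x q + 1 ≠ X := fun q hq h => h1 ⟨q, mem_range.1 hq, h⟩
    rw [sum_eq_zero fun q hq => if_neg (hxX q hq), zero_sub]
    have h3 := (tendsto_prod_div (a := fun q => x q + θ) hxX).mul
      (tendsto_mul_prod_div (a := fun q => y q + 1 - θ) (X := X) hy)
    simp only [mul_left_comm _ ((_ : ℂ) - X) _] at h3
    convert h3 using 2
    rw [← Complex.ofReal_mul, mul_sum, mul_neg, mul_sum, ← sum_neg_distrib]
    congr 1
    refine sum_congr rfl fun p _ => ?_
    split_ifs with h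
    · rw [← h]; ring
    · ring

/-- The products are written to match the case of general `θ`. Each quotient is `1`, or `0` where
its denominator vanishes, since `x / 0 = 0`. Thus simultaneous poles of the two rows give `0` on the
right, in accordance with `1 - 1` on the left. -/
theorem tendsto_mul_middle_one
    (hx : ∀ p ∈ range m, ∀ q ∈ range m, x p = x q → p = q)
    (hy : ∀ p ∈ range n, ∀ q ∈ range n, y p = y q → p = q) :
    Tendsto (fun u : ℂ => (u - X) * ((∑ q ∈ range m, 1 / (u - x q - 1)) -
        ∑ q ∈ range n, 1 / (u - y q))) (𝓝[≠] (X : ℂ))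
      (𝓝 (((∑ p ∈ range m, if x p + 1 = X then
          (∏ q ∈ (range m).erase p, (X - x q - 1) / (X - x q - 1)) *
            ∏ q ∈ range n, (X - y q - 1 + 1) / (X - y q) else 0) -
        ∑ p ∈ range n, if y p = X then (∏ q ∈ range m, (X - x q - 1) / (X - x q - 1)) *
            ∏ q ∈ (range n).erase p, (X - y q - 1 + 1) / (X - y q) else 0 : ℝ) : ℂ)) := by
  have h1 : Tendsto (fun u : ℂ => (u - X) * ((∑ q ∈ range m, 1 / (u - x q - 1)) -
      ∑ q ∈ range n, 1 / (u - y q))) (𝓝[≠] (X : ℂ))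
      (𝓝 ((∑ p ∈ range m, if x p + 1 = X then (1 : ℂ) else 0) -
        ∑ p ∈ range n, if y p = X then 1 else 0)) := by
    simp only [mul_sub, mul_sum, sub_sub, ← Complex.ofReal_one, ← Complex.ofReal_add]
    exact (tendsto_finsetSum _ fun q _ => by simpa using tendsto_sub_mul_inv (X := X) (x q + 1)).sub
      (tendsto_finsetSum _ fun q _ => by simpa using tendsto_sub_mul_inv (X := X) (y q))
  convert h1 using 2
  by_cases hxX : ∃ p ∈ range m, x p + 1 = X
  · obtain ⟨p, hp, hpX⟩ := hxX
    have e1 : ∀ f : ℕ → ℝ, (∑ q ∈ range m, if x q + 1 = X then f q else 0) = f p := fun f => by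
      rw [sum_eq_single_of_mem p hp fun q hq hqp =>
        if_neg fun h => hqp (hx q hq p hp (by linarith)), if_pos hpX]
    have z2 : ∏ q ∈ range m, (X - x q - 1) / (X - x q - 1) = 0 :=
      prod_eq_zero hp (by rw [← hpX]; simp)
    have o2 : ∏ q ∈ (range m).erase p, (X - x q - 1) / (X - x q - 1) = 1 :=
      prod_eq_one fun q hq => div_self fun h =>
        (ne_of_mem_erase hq) (hx q (mem_of_mem_erase hq) p hp (by linarith))
    have e1' : (∑ q ∈ range m, if x q + 1 = X then (1 : ℂ) else 0) = 1 := by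
      exact_mod_cast congrArg Complex.ofReal (e1 fun _ => 1)
    rw [e1, e1', z2, o2]
    by_cases hyX : ∃ p ∈ range n, y p = X
    · obtain ⟨q, hq, hqX⟩ := hyX
      rw [sum_eq_single_of_mem q hq fun r hr hrq =>
        if_neg fun h => hrq (hy r hr q hq (by linarith)), if_pos hqX,
        sum_eq_single_of_mem q hq fun r hr hrq =>
        if_neg fun h => hrq (hy r hr q hq (by linarith)), if_pos hqX,
        prod_eq_zero hq (by rw [← hqX]; simp)]
      simp
    · push Not at hyX
      rw [sum_eq_zero fun q hq => if_neg (hyX q hq), sum_eq_zero fun q hq => if_neg (hyX q hq),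
        prod_eq_one fun q hq => ?_]
      · simp
      · rw [sub_add_cancel, div_self (sub_ne_zero.2 (hyX q hq).symm)]
  · push Not at hxX
    rw [sum_eq_zero fun q hq => if_neg (hxX q hq), sum_eq_zero fun q hq => if_neg (hxX q hq),
      prod_eq_one (s := range m) fun q hq => div_self fun h => hxX q hq (by linarith)]
    rw [zero_sub, zero_sub, Complex.ofReal_neg, Complex.ofReal_sum]
    congr 1
    refine sum_congr rfl fun q hq => ?_
    split_ifs with h
    · rw [prod_eq_one fun r hr => ?_]
      · simp
      · rw [sub_add_cancel, div_self]
        exact fun h' => (ne_of_mem_erase hr) (hy r (mem_of_mem_erase hr) q hq (by linarith))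
    · simp

end Middle

/-! ### Observables attached to the edges and their residues -/

section States

variable {N k M : ℕ} {θ : ℝ}

/-- The observable of the edge between the levels `j - 1` and `j`. -/
noncomputable def edgeObs (θ : ℝ) (j : ℕ) (u : ℂ) (ω : State N k M) : ℂ :=
  if j = k then bottomObs θ u ω
  else if j = N + 1 then topObs θ u ω
  else if θ = 1 then middleObsOne θ (j - 1) u ω
  else θ / (1 - θ) * middleObs θ (j - 1) u ω

/-- The residue at `X` of the observable of the edge `j`, divided by `θ`. -/
noncomputable def edgeRes (θ X : ℝ) (ω : State N k M) (j : ℕ) : ℝ :=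
  (if j ≤ N then ∑ p ∈ range j, if pos θ ω j p + 1 = X then upFactor θ X ω j p else 0 else 0) -
    if k < j then ∑ p ∈ range (j - 1),
      if pos θ ω (j - 1) p = X then downFactor θ X ω j p else 0 else 0

theorem topObs_eq (hkN : k ≤ N) (u : ℂ) (ω : State N k M) :
    topObs θ u ω = ∏ p ∈ range N, (u - pos θ ω N p - θ) / (u - pos θ ω N p) := by
  rw [topObs, prod_range]
  exact prod_congr rfl fun p _ => by rw [row_eq_pos θ ω (mem_Icc.2 ⟨hkN, le_rfl⟩)]

theorem bottomObs_eq (hkN : k ≤ N) (u : ℂ) (ω : State N k M) :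
    bottomObs θ u ω = ∏ p ∈ range k, (u - pos θ ω k p + θ - 1) / (u - pos θ ω k p - 1) := by
  rw [bottomObs, prod_range]
  exact prod_congr rfl fun p _ => by rw [row_eq_pos θ ω (mem_Icc.2 ⟨le_rfl, hkN⟩)]

theorem middleObs_eq {n : ℕ} (h1 : k ≤ n) (h2 : n < N) (u : ℂ) (ω : State N k M) :
    middleObs θ n u ω =
      (∏ p ∈ range (n + 1), (u - pos θ ω (n + 1) p - θ) / (u - pos θ ω (n + 1) p - 1)) *
        ∏ p ∈ range n, (u - pos θ ω n p + θ - 1) / (u - pos θ ω n p) := by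
  rw [middleObs, prod_range, prod_range]
  congr 1
  · exact prod_congr rfl fun p _ => by rw [row_eq_pos θ ω (mem_Icc.2 (by omega))]
  · exact prod_congr rfl fun p _ => by rw [row_eq_pos θ ω (mem_Icc.2 (by omega))]

theorem middleObsOne_eq {n : ℕ} (h1 : k ≤ n) (h2 : n < N) (u : ℂ) (ω : State N k M) :
    middleObsOne θ n u ω = (∑ p ∈ range (n + 1), 1 / (u - pos θ ω (n + 1) p - 1)) -
      ∑ p ∈ range n, 1 / (u - pos θ ω n p) := by
  rw [middleObsOne, sum_range, sum_range]
  congr 1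
  · exact sum_congr rfl fun p _ => by rw [row_eq_pos θ ω (mem_Icc.2 (by omega))]
  · exact sum_congr rfl fun p _ => by rw [row_eq_pos θ ω (mem_Icc.2 (by omega))]

theorem pos_injOn (hθ : 0 < θ) (ω : State N k M) (j : ℕ) :
    ∀ p ∈ range j, ∀ q ∈ range j, pos θ ω j p = pos θ ω j q → p = q := by
  intro p hp q hq h
  rw [mem_range] at hp hq
  rcases lt_trichotomy p q with hpq | hpq | hpq
  · have := spaced_pos hθ ω j p q hpq hq
    linarith
  · exact hpq
  · have := spaced_pos hθ ω j q p hpq hp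
    linarith

/-- When both the level `j + 1` and the level `j` produce a pole at `X`, both are cancelled by
zeros coming from a block of equal coordinates. -/
theorem exists_zero_of_double_pole (hθ : 0 < θ) (hθ1 : θ ≠ 1) {X : ℝ} (ω : State N k M) {j : ℕ}
    (hkj : k ≤ j) (hjN : j < N) {p q : ℕ} (hp : p < j + 1) (hq : q < j)
    (hpX : pos θ ω (j + 1) p + 1 = X) (hqX : pos θ ω j q = X) :
    (∃ p' < j + 1, p' ≠ p ∧ pos θ ω (j + 1) p' + θ = X) ∧
      ∃ q' < j, q' ≠ q ∧ pos θ ω j q' + 1 - θ = X := by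
  have hqp : q < p := by
    by_contra! h
    have h1 := (interlaced_pos hθ ω hkj hjN).upper_lower p q h hq
    have h2 : (height ω j q : ℝ) ≤ height ω (j + 1) p := by
      exact_mod_cast (height_anti ω h hq).trans (height_le_succ ω hkj hjN (by omega))
    have h3 : (p : ℝ) ≤ q := by exact_mod_cast h
    simp only [pos] at hpX hqX
    nlinarith
  obtain ⟨p, rfl⟩ : ∃ r, p = r + 1 := ⟨p - 1, by omega⟩
  have h1 : height ω (j + 1) (p + 1) ≤ height ω j p :=
    height_succ_succ_le ω hkj hjN (by omega)
  have h2 : height ω j p ≤ height ω j q := height_anti ω (by omega) (by omega)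
  have h3 : height ω (j + 1) (p + 1) ≤ height ω (j + 1) (q + 1) := height_anti ω (by omega) hp
  have h4 : height ω (j + 1) (q + 1) ≤ height ω j q := height_succ_succ_le ω hkj hjN hq
  have hqp' : (q : ℝ) + 1 ≤ (p + 1 : ℕ) := by exact_mod_cast hqp
  -- Comparing the two expressions for `X` gives `height ω j q < height ω (j + 1) (p + 1) + 1`. By
  -- integrality and interlacing all coordinates in between are equal.
  have h5 : height ω j q = height ω (j + 1) (p + 1) := by
    refine le_antisymm ?_ (h1.trans h2)
    have : (height ω j q : ℝ) < height ω (j + 1) (p + 1) + 1 := by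
      simp only [pos] at hpX hqX
      nlinarith
    exact Nat.lt_succ_iff.1 (by exact_mod_cast this)
  have hpq : p ≠ q := by
    rintro rfl
    refine hθ1 ?_
    simp only [pos, h5] at hpX hqX
    push_cast at hpX
    linarith
  refine ⟨⟨q + 1, by omega, by omega, ?_⟩, p, by omega, hpq, ?_⟩
  · rw [← hqX, pos, pos, show height ω (j + 1) (q + 1) = height ω j q by omega]
    push_cast
    ring
  · rw [← hpX, pos, pos, show height ω (j + 1) (p + 1) = height ω j p by omega]
    push_cast
    ring

/-- Every edge yields the same constant `θ`: directly at the bottom and the top, through the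
prefactor `θ / (1 - θ)` in the middle, and because `θ = 1` in the remaining case. -/
theorem tendsto_mul_edgeObs (hθ : 0 < θ) (hkN : k ≤ N) (X : ℝ) (ω : State N k M) {j : ℕ}
    (hj : j ∈ Icc k (N + 1)) :
    Tendsto (fun u : ℂ => (u - X) * edgeObs θ j u ω) (𝓝[≠] (X : ℂ))
      (𝓝 ((θ * edgeRes θ X ω j : ℝ) : ℂ)) := by
  rw [mem_Icc] at hj
  by_cases hjk : j = k
  · subst hjk
    simp only [edgeObs, if_true, edgeRes, upFactor, lt_irrefl, if_false, sub_zero, if_pos hkN,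
      bottomObs_eq hkN]
    have h := tendsto_mul_prod_div (s := range j) (a := fun q => pos θ ω j q + 1 - θ)
      (b := fun q => pos θ ω j q + 1) (X := X)
      fun p hp q hq h => pos_injOn hθ ω j p hp q hq (by linarith)
    convert h using 2
    · congr 1
      exact prod_congr rfl fun q _ => by push_cast; congr 1 <;> ring
    · congr 1
      rw [mul_sum]
      refine sum_congr rfl fun p _ => ?_
      split_ifs with h
      · rw [show X - (pos θ ω j p + 1 - θ) = θ by linarith]
        congr 1
        exact prod_congr rfl fun q _ => by congr 1 <;> ring
      · exact mul_zero _
  by_cases hjN : j = N + 1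
  · subst hjN
    simp only [edgeObs, if_true, if_neg hjk, edgeRes, downFactor, if_pos (show k < N + 1 by omega),
      if_neg (show ¬(N + 1 ≤ N) by omega), topObs_eq hkN, Nat.add_sub_cancel, zero_sub]
    have h := tendsto_mul_prod_div (s := range N) (a := fun q => pos θ ω N q + θ)
      (b := fun q => pos θ ω N q) (X := X) (pos_injOn hθ ω N)
    convert h using 2
    · congr 1
      exact prod_congr rfl fun q _ => by push_cast; congr 1; ring
    · congr 1
      rw [mul_neg, mul_sum, ← sum_neg_distrib]
      refine sum_congr rfl fun p _ => ?_
      split_ifs with h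
      · rw [show X - (pos θ ω N p + θ) = -θ by linarith, neg_mul]
        congr 2
        exact prod_congr rfl fun q _ => by congr 1; ring
      · simp
  obtain ⟨n, rfl⟩ : ∃ n, j = n + 1 := ⟨j - 1, by omega⟩
  simp only [edgeObs, if_neg hjk, if_neg hjN, edgeRes, upFactor, downFactor,
    if_pos (show n + 1 ≤ N by omega), if_pos (show k < n + 1 by omega), Nat.add_sub_cancel]
  by_cases hθ1 : θ = 1
  · subst hθ1
    simp only [if_true, one_mul, middleObsOne_eq (show k ≤ n by omega) (show n < N by omega)]
    exact tendsto_mul_middle_one (pos_injOn hθ ω _) (pos_injOn hθ ω _)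
  · simp only [if_neg hθ1, middleObs_eq (show k ≤ n by omega) (show n < N by omega)]
    have h := (tendsto_mul_middle (X := X) (pos_injOn hθ ω (n + 1)) (pos_injOn hθ ω n)
      fun p hp q hq hpX hqX => exists_zero_of_double_pole hθ hθ1 ω (by omega) (by omega)
        hp hq hpX hqX).const_mul ((θ : ℂ) / (1 - θ))
    have hθ2 : (1 : ℂ) - θ ≠ 0 := sub_ne_zero.2 fun h => hθ1 (by exact_mod_cast h.symm)
    convert h using 2
    · ring
    · rw [Complex.ofReal_mul θ, Complex.ofReal_mul (1 - θ), ← mul_assoc, Complex.ofReal_sub 1 θ,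
        Complex.ofReal_one, div_mul_cancel₀ _ hθ2]

theorem differentiableAt_edgeObs (hkN : k ≤ N) (ω : State N k M) {j : ℕ}
    (hj : j ∈ Icc k (N + 1)) {u : ℂ}
    (h1 : ∀ i ≤ N, ∀ q < i, u ≠ pos θ ω i q)
    (h2 : ∀ i ≤ N, ∀ q < i, u ≠ (pos θ ω i q + 1 : ℝ)) :
    DifferentiableAt ℂ (fun u => edgeObs θ j u ω) u := by
  have h1' : ∀ i ≤ N, ∀ q < i, u - pos θ ω i q ≠ 0 := fun i hi q hq => sub_ne_zero.2 (h1 i hi q hq)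
  have h2' : ∀ i ≤ N, ∀ q < i, u - pos θ ω i q - 1 ≠ 0 := fun i hi q hq => by
    have := h2 i hi q hq
    push_cast at this
    rw [sub_sub]
    exact sub_ne_zero.2 this
  rw [mem_Icc] at hj
  by_cases hjk : j = k
  · subst hjk
    simp only [edgeObs, if_true, bottomObs_eq hkN]
    refine DifferentiableAt.fun_finsetProd fun q hq => ?_
    have := h2' j hkN q (mem_range.1 hq)
    fun_prop (disch := exact this)
  by_cases hjN : j = N + 1
  · subst hjN
    simp only [edgeObs, if_neg hjk, if_true, topObs_eq hkN]
    refine DifferentiableAt.fun_finsetProd fun q hq => ?_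
    have := h1' N le_rfl q (mem_range.1 hq)
    fun_prop (disch := exact this)
  obtain ⟨n, rfl⟩ : ∃ n, j = n + 1 := ⟨j - 1, by omega⟩
  simp only [edgeObs, if_neg hjk, if_neg hjN, Nat.add_sub_cancel]
  have hx : ∀ q ∈ range (n + 1), u - pos θ ω (n + 1) q - 1 ≠ 0 := fun q hq =>
    h2' _ (by omega) q (mem_range.1 hq)
  have hy : ∀ q ∈ range n, u - pos θ ω n q ≠ 0 := fun q hq =>
    h1' _ (by omega) q (mem_range.1 hq)
  by_cases hθ1 : θ = 1
  · simp only [if_pos hθ1, middleObsOne_eq (show k ≤ n by omega) (show n < N by omega)]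
    refine DifferentiableAt.sub (DifferentiableAt.fun_sum fun q hq => ?_)
      (DifferentiableAt.fun_sum fun q hq => ?_)
    · have := hx q hq
      fun_prop (disch := exact this)
    · have := hy q hq
      fun_prop (disch := exact this)
  · simp only [if_neg hθ1, middleObs_eq (show k ≤ n by omega) (show n < N by omega)]
    refine DifferentiableAt.const_mul (DifferentiableAt.mul
      (DifferentiableAt.fun_finsetProd fun q hq => ?_)
      (DifferentiableAt.fun_finsetProd fun q hq => ?_)) _
    · have := hx q hq
      fun_prop (disch := exact this)
    · have := hy q hq
      fun_prop (disch := exact this)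

/-- Outside of the interval that carries the particles the observables have no poles, except
possibly at its right end plus one. -/
theorem edgeRes_eq_zero (hθ : 0 < θ) {X : ℝ} (hX : X ∉ Set.Icc (-(N * θ)) (M - θ))
    (hX' : X ≠ M + 1 - θ) (ω : State N k M) {j : ℕ} (hj : j ∈ Icc k (N + 1)) :
    edgeRes θ X ω j = 0 := by
  rw [mem_Icc] at hj
  rw [edgeRes]
  have hU : (if j ≤ N then ∑ p ∈ range j, if pos θ ω j p + 1 = X then upFactor θ X ω j p else 0
      else 0) = 0 := by
    split_ifs with hjN
    · refine sum_eq_zero fun p hp => ?_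
      rw [mem_range] at hp
      split_ifs with hpX
      · by_contra hU
        obtain ⟨β, ω', hS⟩ := exists_isShift_of_upFactor hX' hj.1 hjN hp hpX hU
        have h := pos_mem hθ ω' (q := p) hjN hp
        rw [hS.pos_of_mem le_rfl hS.lt, raiseAt_self, hpX] at h
        exact hX h
      · rfl
    · rfl
  have hD : (if k < j then ∑ p ∈ range (j - 1),
      if pos θ ω (j - 1) p = X then downFactor θ X ω j p else 0 else 0) = 0 := by
    split_ifs with hjk
    · refine sum_eq_zero fun p hp => if_neg fun h => hX ?_
      rw [← h]
      exact pos_mem hθ ω (by omega) (mem_range.1 hp)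
    · rfl
  rw [hU, hD, sub_zero]

end States

end BetaCorners

end

section

open Finset
namespace BetaCorners

/-! ### The cumulants as linear forms -/

/-- Regroup by `C = F \ B`. For fixed `C`, each index outside `C` lies either in `B`, giving `g`, or
outside `F`, giving `κ`; the sum over both choices is the product of `g + κ`. -/
theorem sum_prod_compl_mul {σ : Type*} [Fintype σ] [DecidableEq σ] (b : Finset σ → ℂ)
    (g κ : σ → ℂ) :
    ∑ F : Finset σ, (∏ s ∈ Fᶜ, κ s) * ∑ B ∈ F.powerset, b (F \ B) * ∏ s ∈ B, g s =
      ∑ C : Finset σ, b C * ∏ s ∈ Cᶜ, (g s + κ s) := by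
  simp only [prod_add, mul_sum, sum_sigma']
  refine sum_bij' (fun a _ => ⟨a.1 \ a.2, a.2⟩) (fun a _ => ⟨a.1 ∪ a.2, a.2⟩) ?_ ?_ ?_ ?_ ?_
  · rintro ⟨F, B⟩ h
    simp only [mem_sigma, mem_univ, mem_powerset, true_and] at h ⊢
    intro s hs
    simp [hs]
  · rintro ⟨C, B⟩ h
    simp only [mem_sigma, mem_univ, mem_powerset, true_and]
    exact subset_union_right
  · rintro ⟨F, B⟩ h
    simp only [mem_sigma, mem_univ, mem_powerset, true_and] at h
    simp [sdiff_union_of_subset h]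
  · rintro ⟨C, B⟩ h
    simp only [mem_sigma, mem_univ, mem_powerset, true_and] at h
    have : Disjoint C B := disjoint_left.2 fun s hs hB => by simpa [hs] using h hB
    simp [union_sdiff_cancel_right this]
  · rintro ⟨F, B⟩ h
    simp only [mem_sigma, mem_univ, mem_powerset, true_and] at h
    have : (F \ B)ᶜ \ B = Fᶜ := by
      ext s
      have := @h s
      simp only [mem_sdiff, mem_compl]
      tauto
    simp only [this]
    ring

section States

variable {N k M : ℕ} {m : ℕ → ℕ}

/-- The indices of the spectral parameters `v^j_i`. -/
abbrev ParamIndex (k N : ℕ) (m : ℕ → ℕ) : Type := (j : Level k N) × Fin (m j.1)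

/-- The random variable `G_L^j(v^j_i)` with `s = (j, i)`. -/
noncomputable def param (θ L : ℝ) (v : (j : ℕ) → Fin (m j) → ℂ) (s : ParamIndex k N m)
    (ω : State N k M) : ℂ :=
  stieltjes θ L s.1.1 (v s.1.1 s.2) ω

/-- The coefficients of the linear form `ξ ↦ M(ξ; F)`. -/
noncomputable def cumulantCoeff (θ L : ℝ) (w : ℝ → ℝ) (v : (j : ℕ) → Fin (m j) → ℂ)
    (F : Finset (ParamIndex k N m)) (ω : State N k M) : ℂ :=
  prob θ w ω * ∑ B ∈ F.powerset,
    subsetInv (fun T => expect (prob θ w) fun ω' : State N k M => ∏ s ∈ T, param θ L v s ω')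
      (F \ B) * ∏ s ∈ B, param θ L v s ω

theorem cumulantWith_eq_sum {θ L : ℝ} {w : ℝ → ℝ}
    (hP : ∑ ω : State N k M, prob θ w ω = 1) (v : (j : ℕ) → Fin (m j) → ℂ)
    (F : (j : Level k N) → Finset (Fin (m j.1))) (ξ : State N k M → ℂ) :
    cumulantWith θ L w v F ξ =
      ∑ ω, cumulantCoeff θ L w v (univ.sigma F) ω * ξ ω := by
  rw [cumulantWith, jointCumulant_eq_sum hP (fun s : ParamIndex k N m => param θ L v s) none
    (fun s => if h : s.2 ∈ F s.1 then some ⟨s, h⟩ else none) (F := univ.sigma F)]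
  · simp only [cumulantCoeff, expect, mul_sum, sum_mul]
    rw [sum_comm]
    refine sum_congr rfl fun ω _ => sum_congr rfl fun B _ => ?_
    ring
  · intro s hs
    simp only [mem_sigma, mem_univ, true_and] at hs
    simp [hs]
  · intro s hs t ht hst
    simp only [coe_sigma, Set.mem_sigma_iff, mem_coe, mem_univ, true_and] at hs ht
    simpa [hs, ht] using hst
  · rintro (_ | ⟨s, hs⟩) hi
    · exact absurd rfl hi
    · exact ⟨s, by simpa using hs, by simp [hs]⟩
  · intro s hs
    simp only [mem_sigma, mem_univ, true_and] at hs
    simp only [hs, dif_pos]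
    rfl

/-- The contribution of `v^i_f` to the kernel of the edge `j`. -/
noncomputable def edgeKernel (L : ℝ) (v : (j : ℕ) → Fin (m j) → ℂ) (j : ℕ) (z : ℂ)
    (s : ParamIndex k N m) : ℂ :=
  if j ≤ s.1.1 then 1 / ((L : ℂ) * (v s.1.1 s.2 - z) * (v s.1.1 s.2 - z + (L : ℂ)⁻¹)) else 0

/-- `edgeKernel` vanishes below level `j`, so one missing index there kills the product. This
absorbs the indicators into a single product over the complement. -/
theorem fullBelow_mul_kernelFrom (L : ℝ) (v : (j : ℕ) → Fin (m j) → ℂ)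
    (F : (j : Level k N) → Finset (Fin (m j.1))) (j : ℕ) (z : ℂ) :
    fullBelow F j * kernelFrom L v F j z = ∏ s ∈ (univ.sigma F)ᶜ, edgeKernel L v j z s := by
  have h : (univ.sigma F)ᶜ = (univ : Finset (Level k N)).sigma fun i => (F i)ᶜ := by
    ext s
    simp
  rw [h, prod_sigma, fullBelow, kernelFrom, prod_filter, prod_filter, ← prod_mul_distrib]
  refine prod_congr rfl fun i _ => ?_
  by_cases hij : j ≤ i.1
  · simp only [edgeKernel, if_pos hij, if_neg (not_lt.2 hij), one_mul]
  · simp only [edgeKernel, if_neg hij, if_pos (not_le.1 hij), mul_one, prod_const]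
    split_ifs with hF
    · simp [hF]
    · rw [zero_pow]
      rw [Ne, card_eq_zero, ← Ne, ← nonempty_iff_ne_empty]
      by_contra h
      rw [not_nonempty_iff_eq_empty, compl_eq_empty_iff] at h
      exact hF h

theorem fullBelow_bot (F : (j : Level k N) → Finset (Fin (m j.1))) : fullBelow F k = 1 := by
  rw [fullBelow, prod_filter]
  exact prod_eq_one fun i _ => if_neg (not_lt.2 (mem_Icc.1 i.2).1)

theorem kernelFrom_top (L : ℝ) (v : (j : ℕ) → Fin (m j) → ℂ)
    (F : (j : Level k N) → Finset (Fin (m j.1))) (z : ℂ) : kernelFrom L v F (N + 1) z = 1 := by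
  rw [kernelFrom, prod_filter]
  exact prod_eq_one fun i _ => if_neg (not_le.2 (Nat.lt_succ_of_le (mem_Icc.1 i.2).2))

theorem sum_pi_finset_eq (f : Finset (ParamIndex k N m) → ℂ) :
    ∑ F : (j : Level k N) → Finset (Fin (m j.1)), f (univ.sigma F) = ∑ F, f F := by
  refine Fintype.sum_bijective (fun F : (j : Level k N) → Finset (Fin (m j.1)) => univ.sigma F)
    ⟨fun F F' h => ?_, fun S => ⟨fun j => univ.filter fun i => ⟨j, i⟩ ∈ S, ?_⟩⟩ _ _ fun _ => rfl
  · ext j i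
    have := congrArg (fun S : Finset (ParamIndex k N m) => (⟨j, i⟩ : ParamIndex k N m) ∈ S) h
    simpa using this
  · ext s
    simp

/-- On a moved level, raising a particle from `X - 1` to `X` changes `G` by exactly one kernel
factor. The kernel of the edge `j` has this factor for levels `j ≤ i < β` and that of the edge `β`
does not, which compensates the change. -/
theorem IsShift.param_add_edgeKernel {θ L : ℝ} (hθ : 0 < θ) (hL : 0 < L)
    {v : (j : ℕ) → Fin (m j) → ℂ}
    (hv : ∀ j ∈ Icc k N, ∀ i : Fin (m j), ∀ x ∈ Set.Icc (-(N * θ)) (M - θ),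
      (L : ℂ) * v j i ≠ (x : ℂ))
    {ω ω' : State N k M} {j β p : ℕ} (h : IsShift ω j β p ω') {X : ℝ}
    (hX : pos θ ω j p + 1 = X) {z : ℂ} (hz : (L : ℂ) * z = X) (s : ParamIndex k N m) :
    param θ L v s ω + edgeKernel L v j z s = param θ L v s ω' + edgeKernel L v β z s := by
  obtain ⟨⟨i, hi⟩, f⟩ := s
  have hiN := mem_Icc.1 hi
  have hst : ∀ ω : State N k M, param θ L v ⟨⟨i, hi⟩, f⟩ ω =
      ∑ q ∈ range i, 1 / (v i f - ((pos θ ω i q / L : ℝ) : ℂ)) := fun ω => by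
    rw [param, stieltjes, sum_range]
    exact sum_congr rfl fun q _ => by rw [row_eq_pos θ ω hi]
  have hjβ := h.lt
  have hpj := h.index_lt
  rw [hst, hst]
  by_cases hji : j ≤ i
  · by_cases hiβ : i < β
    · have hp : p ∈ range i := mem_range.2 (by omega)
      rw [edgeKernel, edgeKernel, if_pos hji, if_neg (not_le.2 hiβ), add_zero,
        h.pos_of_mem hji hiβ, ← add_sum_erase _ _ hp, ← add_sum_erase _ _ hp, raiseAt_self,
        h.pos_const hji hiβ, hX, show pos θ ω j p = X - 1 by linarith]
      have hLc : (L : ℂ) ≠ 0 := by exact_mod_cast hL.ne'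
      have m1 := pos_mem hθ ω hiN.2 (mem_range.1 hp)
      have m2 := pos_mem hθ ω' hiN.2 (mem_range.1 hp)
      rw [h.pos_const hji hiβ, show pos θ ω j p = X - 1 by linarith] at m1
      rw [h.pos_of_mem hji hiβ, raiseAt_self, h.pos_const hji hiβ, hX] at m2
      have d1 : (L : ℂ) * v i f - (X - 1) ≠ 0 := by
        have := hv i hi f _ m1
        push_cast at this
        exact sub_ne_zero.2 this
      have d2 : (L : ℂ) * v i f - X ≠ 0 := sub_ne_zero.2 (hv i hi f _ m2)
      have hz' : z = X / L := by rw [← hz]; field_simp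
      have e1 : 1 / (v i f - (((X - 1) / L : ℝ) : ℂ)) = L / (L * v i f - (X - 1)) := by
        rw [show v i f - (((X - 1) / L : ℝ) : ℂ) = (L * v i f - (X - 1)) / L by
          push_cast; field_simp]
        rw [one_div_div]
      have e2 : 1 / (v i f - ((X / L : ℝ) : ℂ)) = L / (L * v i f - X) := by
        rw [show v i f - ((X / L : ℝ) : ℂ) = (L * v i f - X) / L by
          push_cast; field_simp]
        rw [one_div_div]
      have e3 : (1 : ℂ) / ((L : ℂ) * (v i f - z) * (v i f - z + (L : ℂ)⁻¹)) =
          L / ((L * v i f - X) * (L * v i f - (X - 1))) := by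
        rw [show (L : ℂ) * (v i f - z) * (v i f - z + (L : ℂ)⁻¹) =
          ((L * v i f - X) * (L * v i f - (X - 1))) / L by rw [hz']; field_simp; ring]
        rw [one_div_div]
      have e4 : ∑ q ∈ (range i).erase p, 1 / (v i f - ((raiseAt (pos θ ω i) p q / L : ℝ) : ℂ)) =
          ∑ q ∈ (range i).erase p, 1 / (v i f - ((pos θ ω i q / L : ℝ) : ℂ)) :=
        sum_congr rfl fun q hq => by rw [raiseAt_of_ne _ (ne_of_mem_erase hq)]
      rw [e4, e1, e2, e3]
      field_simp
      ring
    · rw [edgeKernel, edgeKernel, if_pos hji, if_pos (not_lt.1 hiβ), h.pos_of_notMem (by omega)]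
  · rw [edgeKernel, edgeKernel, if_neg hji, if_neg (show ¬ β ≤ i by omega), h.pos_of_notMem (by omega)]

/-- The residues at `X` add up to zero. -/
theorem sum_residue_eq_zero {θ L : ℝ} (hθ : 0 < θ) (hL : 0 < L) {w : ℝ → ℝ}
    (hw : ∀ x ∈ Set.Icc (-(N * θ)) (M - θ), 0 < w x) {v : (j : ℕ) → Fin (m j) → ℂ}
    (hv : ∀ j ∈ Icc k N, ∀ i : Fin (m j), ∀ x ∈ Set.Icc (-(N * θ)) (M - θ),
      (L : ℂ) * v j i ≠ (x : ℂ)) {X : ℝ} (hX₁ : X ≠ -(N * θ))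
    (hX₂ : X ≠ M + 1 - θ) {cp cm : ℂ}
    (hc : X ∈ Set.Icc (-(N * θ) + 1) (M - θ) → ((w X / w (X - 1) : ℝ) : ℂ) * cm = cp)
    {z : ℂ} (hz : (L : ℂ) * z = X) :
    ∑ F : Finset (ParamIndex k N m), ∑ j ∈ Icc k (N + 1), (if j = N + 1 then cm else cp) *
      (∏ s ∈ Fᶜ, edgeKernel L v j z s) *
        ∑ ω : State N k M, cumulantCoeff θ L w v F ω * edgeRes θ X ω j = 0 := by
  -- For each fixed `C`, the conserved product of `G + κ` over its complement plays the role of `φ`.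
  -- Terms equal to zero extend both sums to the common range of edges.
  have hbal : ∀ C : Finset (ParamIndex k N m), ∑ ω : State N k M, ∑ j ∈ Icc k (N + 1),
      (weight θ w ω : ℂ) * (if j = N + 1 then cm else cp) * edgeRes θ X ω j *
        ∏ s ∈ Cᶜ, (param θ L v s ω + edgeKernel L v j z s) = 0 := by
    intro C
    have h := sum_upFactor_eq_sum_downFactor hθ hw hX₁ hX₂ hc
      (fun (ω : State N k M) j => ∏ s ∈ Cᶜ, (param θ L v s ω + edgeKernel L v j z s))
      fun ω j β p ω' hS hX => prod_congr rfl fun s _ => hS.param_add_edgeKernel hθ hL hv hX hz s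
    rw [← sub_eq_zero, ← sum_sub_distrib] at h
    rw [← h]
    refine sum_congr rfl fun ω _ => ?_
    have hup : ∑ j ∈ Icc k N, ∑ p ∈ range j, (if pos θ ω j p + 1 = X then
        (weight θ w ω : ℂ) * upFactor θ X ω j p * cp *
          ∏ s ∈ Cᶜ, (param θ L v s ω + edgeKernel L v j z s) else 0) =
        ∑ j ∈ Icc k (N + 1), (weight θ w ω : ℂ) * (if j = N + 1 then cm else cp) *
          ((if j ≤ N then ∑ p ∈ range j, if pos θ ω j p + 1 = X then upFactor θ X ω j p else 0
            else 0 : ℝ) : ℂ) * ∏ s ∈ Cᶜ, (param θ L v s ω + edgeKernel L v j z s) := by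
      refine sum_subset_zero_on_sdiff (Icc_subset_Icc_right (by omega)) ?_ ?_
      · intro j hj
        simp only [mem_sdiff, mem_Icc] at hj
        rw [if_neg (show ¬ j ≤ N by omega)]
        simp
      · intro j hj
        rw [mem_Icc] at hj
        rw [if_pos hj.2, if_neg (by omega)]
        push_cast
        rw [mul_sum, sum_mul]
        refine sum_congr rfl fun p _ => ?_
        split_ifs
        · ring
        · simp
    have hdown : ∑ j ∈ Icc (k + 1) (N + 1), ∑ p ∈ range (j - 1),
        (if pos θ ω (j - 1) p = X then (weight θ w ω : ℂ) * downFactor θ X ω j p *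
          (if j = N + 1 then cm else cp) *
            ∏ s ∈ Cᶜ, (param θ L v s ω + edgeKernel L v j z s) else 0) =
        ∑ j ∈ Icc k (N + 1), (weight θ w ω : ℂ) * (if j = N + 1 then cm else cp) *
          ((if k < j then ∑ p ∈ range (j - 1),
            if pos θ ω (j - 1) p = X then downFactor θ X ω j p else 0 else 0 : ℝ) : ℂ) *
              ∏ s ∈ Cᶜ, (param θ L v s ω + edgeKernel L v j z s) := by
      refine sum_subset_zero_on_sdiff (Icc_subset_Icc_left (by omega)) ?_ ?_
      · intro j hj
        simp only [mem_sdiff, mem_Icc] at hj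
        rw [if_neg (show ¬ k < j by omega)]
        simp
      · intro j hj
        rw [mem_Icc] at hj
        rw [if_pos (show k < j by omega)]
        push_cast
        rw [mul_sum, sum_mul]
        refine sum_congr rfl fun p _ => ?_
        by_cases hp : pos θ ω (j - 1) p = X
        · simp only [if_pos hp]
          ring
        · simp [if_neg hp]
    rw [hup, hdown, ← sum_sub_distrib]
    refine sum_congr rfl fun j _ => ?_
    rw [edgeRes, Complex.ofReal_sub]
    ring
  -- The sum over `F` of cumulant coefficients times kernels is regrouped so that only products of
  -- `G + κ` are tested against the weight.
  have hsw : ∀ j ∈ Icc k (N + 1), ∑ F : Finset (ParamIndex k N m), (if j = N + 1 then cm else cp) *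
      (∏ s ∈ Fᶜ, edgeKernel L v j z s) *
        ∑ ω : State N k M, cumulantCoeff θ L w v F ω * edgeRes θ X ω j =
      ∑ C : Finset (ParamIndex k N m), ∑ ω : State N k M,
        subsetInv (fun T => expect (prob θ w) fun ω' : State N k M => ∏ s ∈ T, param θ L v s ω') C *
        (((∑ ω' : State N k M, weight θ w ω' : ℝ) : ℂ)⁻¹ *
        ((weight θ w ω : ℂ) * (if j = N + 1 then cm else cp) * edgeRes θ X ω j *
        ∏ s ∈ Cᶜ, (param θ L v s ω + edgeKernel L v j z s))) := by
    intro j _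
    rw [sum_comm (s := (univ : Finset (Finset (ParamIndex k N m))))
      (t := (univ : Finset (State N k M)))]
    simp only [mul_sum]
    rw [sum_comm]
    refine sum_congr rfl fun ω _ => ?_
    have h := congrArg (fun a : ℂ => (prob θ w ω : ℂ) * (if j = N + 1 then cm else cp) *
      edgeRes θ X ω j * a) (sum_prod_compl_mul
      (subsetInv (fun T => expect (prob θ w) fun ω' : State N k M => ∏ s ∈ T, param θ L v s ω'))
      (fun s => param θ L v s ω) (fun s => edgeKernel L v j z s))
    simp only [mul_sum (s := (univ : Finset (Finset (ParamIndex k N m))))] at h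
    convert h using 1
    · refine sum_congr rfl fun F _ => ?_
      rw [cumulantCoeff]
      ring
    · refine sum_congr rfl fun C _ => ?_
      rw [prob, Complex.ofReal_div]
      ring
  rw [sum_comm, sum_congr rfl hsw, sum_comm]
  refine sum_eq_zero fun C _ => ?_
  rw [sum_comm]
  simp only [← mul_sum]
  rw [hbal, mul_zero, mul_zero]

end States

end BetaCorners

end

section

open Filter Topology
namespace BetaCorners

/-! ### Deformation of the contour -/

/-- Inside the contour only the total residue has to vanish. On the contour each summand must have
residue zero, so that its integral exists. -/
theorem sum_contourIntegral_eq_zero {γ : ℝ → ℂ} (hγ : IsPositiveSimpleContour γ) {ι : Type*}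
    (s : Finset ι) {U P : Set ℂ} (hU : IsOpen U) (hP : P.Finite) (hγU : trace γ ∪ inside γ ⊆ U)
    (f : ι → ℂ → ℂ) (r : ι → ℂ → ℂ) (hf : ∀ i ∈ s, DifferentiableOn ℂ (f i) (U \ P))
    (hlim : ∀ i ∈ s, ∀ c ∈ P, c ∈ U → Tendsto (fun z => (z - c) * f i z) (𝓝[≠] c) (𝓝 (r i c)))
    (hr : ∀ i ∈ s, ∀ c ∈ P, c ∈ trace γ → r i c = 0)
    (hsum : ∀ c ∈ P, c ∈ U → ∑ i ∈ s, r i c = 0) :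
    ∑ i ∈ s, contourIntegral γ (f i) = 0 := by
  have hint : ∀ i ∈ s, IntervalIntegrable (fun t => f i (γ t) * deriv γ t)
      MeasureTheory.volume 0 1 := fun i hi =>
    hγ.piecewiseC1.intervalIntegrable_of_removable hγ.simple hU hP
      (Set.subset_union_left.trans hγU) (hf i hi) fun c hc hct => by
        have := hlim i hi c hc (hγU (Or.inl hct))
        rwa [hr i hi c hc hct] at this
  have h : contourIntegral γ (fun z => ∑ i ∈ s, f i z) = 0 := by
    refine hγ.piecewiseC1.contourIntegral_eq_zero_of_removable hγ.closed hγ.simple hU hP hγU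
      (DifferentiableOn.fun_sum hf) fun c hc hcγ => ?_
    have := tendsto_finsetSum s fun i hi => hlim i hi c hc (hγU hcγ)
    rw [hsum c hc (hγU hcγ)] at this
    simpa only [Finset.mul_sum] using this
  rw [← h]
  simp only [contourIntegral, Finset.sum_mul]
  exact (intervalIntegral.integral_finsetSum hint).symm

/-! ### The integrands, their pole set and their residues -/

section States

variable {N k M : ℕ} {m : ℕ → ℕ}

/-- The factor of the integrand of the edge `j` that does not depend on the state. -/
noncomputable def edgePrefactor (M : ℕ) (θ L : ℝ) (Φp Φm : ℂ → ℂ) (v : (j : ℕ) → Fin (m j) → ℂ)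
    (v₀ : ℂ) (F : Finset (ParamIndex k N m)) (j : ℕ) (z : ℂ) : ℂ :=
  (if j = N + 1 then Φm (L * z) else Φp (L * z)) /
    (2 * Real.pi * Complex.I * auxS N M θ L v₀ (L * z)) * ∏ s ∈ Fᶜ, edgeKernel L v j z s

/-- The integrand of the edge `j`. -/
noncomputable def edgeIntegrand (M : ℕ) (θ L : ℝ) (w : ℝ → ℝ) (Φp Φm : ℂ → ℂ)
    (v : (j : ℕ) → Fin (m j) → ℂ) (v₀ : ℂ) (F : Finset (ParamIndex k N m)) (j : ℕ) (z : ℂ) : ℂ :=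
  edgePrefactor M θ L Φp Φm v v₀ F j z *
    ∑ ω : State N k M, cumulantCoeff θ L w v F ω * edgeObs θ j (L * z) ω

/-- This makes the zeros of `1 / S_v` at `-Nθ` and `M + 1 - θ` visible. It holds at these points
too, where division by zero makes the left side `0`. -/
theorem edgePrefactor_eq (M : ℕ) (θ L : ℝ) (Φp Φm : ℂ → ℂ) (v : (j : ℕ) → Fin (m j) → ℂ)
    (v₀ : ℂ) (F : Finset (ParamIndex k N m)) (j : ℕ) (z : ℂ) :
    edgePrefactor M θ L Φp Φm v v₀ F j z =
      ((L * z + N * θ) * (L * z - M - 1 + θ) / (2 * Real.pi * Complex.I * (L * z - L * v₀))) *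
        ((if j = N + 1 then Φm (L * z) else Φp (L * z)) * ∏ s ∈ Fᶜ, edgeKernel L v j z s) := by
  rw [edgePrefactor, auxS, mul_div_assoc', div_div_eq_mul_div]
  ring

/-- The domain on which the prefactors are holomorphic. -/
def contourDomain (k N : ℕ) (L : ℝ) (D : Set ℂ) (v : (j : ℕ) → Fin (m j) → ℂ) (v₀ : ℂ) : Set ℂ :=
  {z | (L : ℂ) * z ∈ D ∧ z ≠ v₀ ∧ ∀ s : ParamIndex k N m,
    z ≠ v s.1.1 s.2 ∧ z ≠ v s.1.1 s.2 + (L : ℂ)⁻¹}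

theorem isOpen_contourDomain (L : ℝ) {D : Set ℂ} (hD : IsOpen D) (v : (j : ℕ) → Fin (m j) → ℂ)
    (v₀ : ℂ) : IsOpen (contourDomain k N L D v v₀) := by
  simp only [contourDomain, Set.ofPred_and, Set.ofPred_forall]
  exact (hD.preimage (by fun_prop)).inter (isOpen_ne.inter
    (isOpen_iInter_of_finite fun s => isOpen_ne.inter isOpen_ne))

theorem differentiableAt_edgePrefactor {θ L : ℝ} (hL : 0 < L) {D : Set ℂ} (hD : IsOpen D)
    {Φp Φm : ℂ → ℂ} (hΦp : DifferentiableOn ℂ Φp D) (hΦm : DifferentiableOn ℂ Φm D)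
    (v : (j : ℕ) → Fin (m j) → ℂ) (v₀ : ℂ) (F : Finset (ParamIndex k N m)) (j : ℕ) {z : ℂ}
    (hz : z ∈ contourDomain k N L D v v₀) :
    DifferentiableAt ℂ (edgePrefactor M θ L Φp Φm v v₀ F j) z := by
  obtain ⟨hzD, hz0, hzs⟩ := hz
  have hL' : (L : ℂ) ≠ 0 := by exact_mod_cast hL.ne'
  have hp := (hΦp _ hzD).differentiableAt (hD.mem_nhds hzD)
  have hm := (hΦm _ hzD).differentiableAt (hD.mem_nhds hzD)
  have hlin : DifferentiableAt ℂ (fun z : ℂ => (L : ℂ) * z) z := by fun_prop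
  have hp' : DifferentiableAt ℂ (fun z : ℂ => Φp (L * z)) z := hp.comp z hlin
  have hm' : DifferentiableAt ℂ (fun z : ℂ => Φm (L * z)) z := hm.comp z hlin
  rw [show edgePrefactor M θ L Φp Φm v v₀ F j = _ from
    funext fun z => edgePrefactor_eq M θ L Φp Φm v v₀ F j z]
  refine DifferentiableAt.mul ?_ (DifferentiableAt.mul ?_ (DifferentiableAt.fun_finsetProd ?_))
  · have : 2 * (Real.pi : ℂ) * Complex.I * (L * z - L * v₀) ≠ 0 := by
      rw [← mul_sub]
      exact mul_ne_zero Complex.two_pi_I_ne_zero (mul_ne_zero hL' (sub_ne_zero.2 hz0))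
    fun_prop (disch := exact this)
  · split_ifs
    · exact hm'
    · exact hp'
  · intro s _
    simp only [edgeKernel]
    split_ifs
    · obtain ⟨h1, h2⟩ := hzs s
      have : (L : ℂ) * (v s.1.1 s.2 - z) * (v s.1.1 s.2 - z + (L : ℂ)⁻¹) ≠ 0 := by
        refine mul_ne_zero (mul_ne_zero hL' (sub_ne_zero.2 h1.symm)) fun h => h2 ?_
        linear_combination -h
      fun_prop (disch := exact this)
    · exact differentiableAt_const _

/-- The points `z` such that `L z` may be a pole of an observable. -/
def poleSet (N M : ℕ) (θ L : ℝ) : Set ℂ :=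
  (fun a : ℕ × ℕ => (((a.1 - a.2 * θ) / L : ℝ) : ℂ)) '' (Set.Iic (M + 1) ×ˢ Set.Iic N)

theorem finite_poleSet (N M : ℕ) (θ L : ℝ) : (poleSet N M θ L).Finite :=
  ((Set.finite_Iic _).prod (Set.finite_Iic _)).image _

theorem mem_poleSet {θ L : ℝ} (hL : 0 < L) {n p : ℕ} (hn : n ≤ M + 1) (hp : p ≤ N) {z : ℂ}
    (hz : (L : ℂ) * z = (n - p * θ : ℝ)) : z ∈ poleSet N M θ L := by
  have hL' : (L : ℂ) ≠ 0 := by exact_mod_cast hL.ne'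
  refine ⟨(n, p), ⟨hn, hp⟩, ?_⟩
  dsimp only
  rw [Complex.ofReal_div, ← hz]
  field_simp

theorem differentiableOn_edgeIntegrand {θ L : ℝ} (hL : 0 < L) (hkN : k ≤ N) {D : Set ℂ}
    (hD : IsOpen D) (w : ℝ → ℝ)
    {Φp Φm : ℂ → ℂ} (hΦp : DifferentiableOn ℂ Φp D) (hΦm : DifferentiableOn ℂ Φm D)
    (v : (j : ℕ) → Fin (m j) → ℂ) (v₀ : ℂ) (F : Finset (ParamIndex k N m)) {j : ℕ}
    (hj : j ∈ Finset.Icc k (N + 1)) :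
    DifferentiableOn ℂ (edgeIntegrand M θ L w Φp Φm v v₀ F j)
      (contourDomain k N L D v v₀ \ poleSet N M θ L) := by
  rintro z ⟨hz, hzP⟩
  refine DifferentiableAt.differentiableWithinAt ?_
  refine (differentiableAt_edgePrefactor hL hD hΦp hΦm v v₀ F j hz).mul
    (DifferentiableAt.fun_sum fun ω _ => DifferentiableAt.const_mul ?_ _)
  have hlin : DifferentiableAt ℂ (fun z : ℂ => (L : ℂ) * z) z := by fun_prop
  refine DifferentiableAt.comp (g := fun u => edgeObs θ j u ω) z
    (differentiableAt_edgeObs hkN ω hj ?_ ?_) hlin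
  · intro i hi q hq h
    refine hzP (mem_poleSet hL (n := height ω i q) (p := q + 1)
      ((height_le ω i q).trans (by omega)) (by omega) ?_)
    rw [h, pos]
    push_cast
    ring
  · intro i hi q hq h
    refine hzP (mem_poleSet hL (n := height ω i q + 1) (p := q + 1)
      (by have := height_le ω i q; omega) (by omega) ?_)
    rw [h, pos]
    push_cast
    ring

theorem tendsto_mul_edgeIntegrand {θ L : ℝ} (hθ : 0 < θ) (hL : 0 < L) (hkN : k ≤ N) {D : Set ℂ}
    (hD : IsOpen D) (w : ℝ → ℝ)
    {Φp Φm : ℂ → ℂ} (hΦp : DifferentiableOn ℂ Φp D) (hΦm : DifferentiableOn ℂ Φm D)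
    (v : (j : ℕ) → Fin (m j) → ℂ) (v₀ : ℂ) (F : Finset (ParamIndex k N m)) {j : ℕ}
    (hj : j ∈ Finset.Icc k (N + 1)) {X : ℝ} {c : ℂ} (hcX : (L : ℂ) * c = X)
    (hc : c ∈ contourDomain k N L D v v₀) :
    Tendsto (fun z => (z - c) * edgeIntegrand M θ L w Φp Φm v v₀ F j z) (𝓝[≠] c)
      (𝓝 (edgePrefactor M θ L Φp Φm v v₀ F j c * ∑ ω : State N k M,
        cumulantCoeff θ L w v F ω * ((L : ℂ)⁻¹ * (θ * edgeRes θ X ω j : ℝ)))) := by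
  have hL' : (L : ℂ) ≠ 0 := by exact_mod_cast hL.ne'
  have hlin : Tendsto (fun z : ℂ => (L : ℂ) * z) (𝓝[≠] c) (𝓝[≠] (X : ℂ)) := by
    refine tendsto_nhdsWithin_of_tendsto_nhds_of_eventually_within _ ?_ ?_
    · rw [← hcX]
      have : ContinuousAt (fun z : ℂ => (L : ℂ) * z) c := by fun_prop
      exact this.tendsto.mono_left nhdsWithin_le_nhds
    · filter_upwards [self_mem_nhdsWithin] with z hz h
      exact hz (mul_left_cancel₀ hL' ((Set.mem_singleton_iff.1 h).trans hcX.symm))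
  have h1 := (differentiableAt_edgePrefactor (M := M) (θ := θ) hL hD hΦp hΦm v v₀ F j
    hc).continuousAt.tendsto.mono_left (nhdsWithin_le_nhds (s := {c}ᶜ))
  have h2 := h1.mul (tendsto_finsetSum (Finset.univ : Finset (State N k M)) fun ω _ =>
    (((tendsto_mul_edgeObs hθ hkN X ω hj).comp hlin).const_mul (L : ℂ)⁻¹).const_mul
      (cumulantCoeff θ L w v F ω))
  refine h2.congr fun z => ?_
  simp only [edgeIntegrand, Function.comp_apply, Finset.mul_sum]
  refine Finset.sum_congr rfl fun ω _ => ?_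
  rw [← hcX]
  field_simp

/-- The residue of the integrand of the edge `j` at a point of `poleSet`. -/
noncomputable def edgeResidue (M : ℕ) (θ L : ℝ) (w : ℝ → ℝ) (Φp Φm : ℂ → ℂ)
    (v : (j : ℕ) → Fin (m j) → ℂ) (v₀ : ℂ) (F : Finset (ParamIndex k N m)) (j : ℕ) (c : ℂ) : ℂ :=
  edgePrefactor M θ L Φp Φm v v₀ F j c * ∑ ω : State N k M,
    cumulantCoeff θ L w v F ω * ((L : ℂ)⁻¹ * (θ * edgeRes θ ((L : ℂ) * c).re ω j : ℝ))

/-- Away from the particle interval only `X = M + 1 - θ` could be a pole, and there the prefactor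
vanishes. This settles the poles on the contour individually. -/
theorem edgeResidue_eq_zero {θ L : ℝ} (hθ : 0 < θ) (w : ℝ → ℝ)
    (Φp Φm : ℂ → ℂ) (v : (j : ℕ) → Fin (m j) → ℂ) (v₀ : ℂ) (F : Finset (ParamIndex k N m)) {j : ℕ}
    (hj : j ∈ Finset.Icc k (N + 1)) {X : ℝ} {c : ℂ} (hcX : (L : ℂ) * c = X)
    (hX : X ∉ Set.Icc (-(N * θ)) (M - θ)) : edgeResidue M θ L w Φp Φm v v₀ F j c = 0 := by
  rw [edgeResidue, hcX, Complex.ofReal_re]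
  by_cases hX' : X = M + 1 - θ
  · rw [edgePrefactor_eq, hcX, hX']
    push_cast
    rw [show (M : ℂ) + 1 - θ - M - 1 + θ = 0 by ring]
    simp
  · refine mul_eq_zero_of_right _ (Finset.sum_eq_zero fun ω _ => ?_)
    rw [edgeRes_eq_zero hθ hX hX' ω hj]
    simp

/-- At the walls `-Nθ` and `M + 1 - θ` the prefactor vanishes; elsewhere a common prefactor comes
out of the cancellation of residues between states. -/
theorem sum_edgeResidue_eq_zero {θ L : ℝ} (hθ : 0 < θ) (hL : 0 < L)
    {w : ℝ → ℝ} (hw : ∀ x ∈ Set.Icc (-(N * θ)) (M - θ), 0 < w x) {Φp Φm : ℂ → ℂ}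
    (hΦ : ∀ x ∈ Set.Icc (-(N * θ) + 1) (M - θ),
      ((w x / w (x - 1) : ℝ) : ℂ) = Φp x / Φm x)
    (v : (j : ℕ) → Fin (m j) → ℂ)
    (hv : ∀ j ∈ Finset.Icc k N, ∀ i : Fin (m j), ∀ x ∈ Set.Icc (-(N * θ)) (M - θ),
      (L : ℂ) * v j i ≠ (x : ℂ)) (v₀ : ℂ) {X : ℝ} {c : ℂ} (hX : (L : ℂ) * c = X) :
    ∑ F : Finset (ParamIndex k N m), ∑ j ∈ Finset.Icc k (N + 1),
      edgeResidue M θ L w Φp Φm v v₀ F j c = 0 := by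
  simp only [edgeResidue, hX, Complex.ofReal_re]
  by_cases hX₁ : X = -(N * θ)
  · refine Finset.sum_eq_zero fun F _ => Finset.sum_eq_zero fun j _ => ?_
    rw [edgePrefactor_eq, hX, hX₁]
    push_cast
    simp
  by_cases hX₂ : X = M + 1 - θ
  · refine Finset.sum_eq_zero fun F _ => Finset.sum_eq_zero fun j _ => ?_
    rw [edgePrefactor_eq, hX, hX₂]
    push_cast
    rw [show (M : ℂ) + 1 - θ - M - 1 + θ = 0 by ring]
    simp
  have hratio : X ∈ Set.Icc (-(N * θ) + 1) (M - θ) →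
      ((w X / w (X - 1) : ℝ) : ℂ) * Φm X = Φp X := by
    intro hXI
    have hpos : 0 < w X / w (X - 1) :=
      div_pos (hw _ ⟨by linarith [hXI.1], hXI.2⟩)
        (hw _ ⟨by linarith [hXI.1], by linarith [hXI.2]⟩)
    -- If the denominator vanished, the ratio would be `0` by convention, but the weight is
    -- positive.
    have hm : Φm X ≠ 0 := by
      intro h0
      have h := hΦ X hXI
      rw [h0, div_zero] at h
      exact hpos.ne' (by exact_mod_cast h)
    rw [hΦ X hXI, div_mul_cancel₀ _ hm]
  have h := sum_residue_eq_zero hθ hL hw hv hX₁ hX₂ hratio hX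
  have h' := congrArg (fun a : ℂ => (((L * c + N * θ) * (L * c - M - 1 + θ) /
    (2 * Real.pi * Complex.I * (L * c - L * v₀))) * ((L : ℂ)⁻¹ * θ)) * a) h
  simp only [mul_zero] at h'
  rw [← h', Finset.mul_sum]
  refine Finset.sum_congr rfl fun F _ => ?_
  rw [Finset.mul_sum]
  refine Finset.sum_congr rfl fun j _ => ?_
  rw [edgePrefactor_eq, hX]
  simp only [Finset.mul_sum]
  refine Finset.sum_congr rfl fun ω _ => ?_
  push_cast
  ring

theorem sum_contourIntegral_edgeIntegrand {θ L : ℝ} (hkN : k ≤ N) (hθ : 0 < θ)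
    {w : ℝ → ℝ} (hw : ∀ x ∈ Set.Icc (-(N * θ)) (M - θ), 0 < w x) {D : Set ℂ} (hD : IsOpen D)
    {Φp Φm : ℂ → ℂ} (hΦp : DifferentiableOn ℂ Φp D) (hΦm : DifferentiableOn ℂ Φm D)
    (hΦ : ∀ x ∈ Set.Icc (-(N * θ) + 1) (M - θ),
      ((w x / w (x - 1) : ℝ) : ℂ) = Φp x / Φm x)
    (hL : 0 < L) (v : (j : ℕ) → Fin (m j) → ℂ)
    (hv : ∀ j ∈ Finset.Icc k N, ∀ i : Fin (m j), ∀ x ∈ Set.Icc (-(N * θ)) (M - θ),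
      (L : ℂ) * v j i ≠ (x : ℂ))
    {γ : ℝ → ℂ} (hγ : IsPositiveSimpleContour γ)
    (hγD : ∀ z ∈ trace γ ∪ inside γ, (L : ℂ) * z ∈ D)
    (hγI : ∀ x ∈ Set.Icc (-(θ * N / L)) ((M - θ) / L), (x : ℂ) ∈ inside γ)
    (hγv : ∀ j ∈ Finset.Icc k N, ∀ i : Fin (m j), v j i ∈ outside γ ∧
      v j i + (L : ℂ)⁻¹ ∈ outside γ)
    {v₀ : ℂ} (hv₀ : v₀ ∈ outside γ) :
    ∑ F : Finset (ParamIndex k N m), ∑ j ∈ Finset.Icc k (N + 1),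
      contourIntegral γ (edgeIntegrand M θ L w Φp Φm v v₀ F j) = 0 := by
  have hL' : (L : ℂ) ≠ 0 := by exact_mod_cast hL.ne'
  have hout : ∀ a ∈ outside γ, ∀ z ∈ trace γ ∪ inside γ, z ≠ a := by
    rintro a ⟨h1, h2⟩ z hz rfl
    exact hz.elim h1 fun h => h2 h.2
  have hγU : trace γ ∪ inside γ ⊆ contourDomain k N L D v v₀ := fun z hz =>
    ⟨hγD z hz, hout _ hv₀ z hz, fun s => ⟨hout _ (hγv _ s.1.2 s.2).1 z hz,
      hout _ (hγv _ s.1.2 s.2).2 z hz⟩⟩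
  have hpole : ∀ c ∈ poleSet N M θ L, ∃ X : ℝ, (L : ℂ) * c = X := by
    rintro _ ⟨a, -, rfl⟩
    exact ⟨a.1 - a.2 * θ, by dsimp only; rw [Complex.ofReal_div]; field_simp⟩
  rw [← Finset.sum_product']
  refine sum_contourIntegral_eq_zero hγ
    ((Finset.univ : Finset (Finset (ParamIndex k N m))) ×ˢ Finset.Icc k (N + 1))
    (isOpen_contourDomain L hD v v₀) (finite_poleSet N M θ L) hγU
    (fun a => edgeIntegrand M θ L w Φp Φm v v₀ a.1 a.2)
    (fun a => edgeResidue M θ L w Φp Φm v v₀ a.1 a.2)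
    (fun a ha => differentiableOn_edgeIntegrand hL hkN hD w hΦp hΦm v v₀ a.1
      (Finset.mem_product.1 ha).2) ?_ ?_ ?_
  · intro a ha c hcP hc
    obtain ⟨X, hX⟩ := hpole c hcP
    simp only [edgeResidue, hX, Complex.ofReal_re]
    exact tendsto_mul_edgeIntegrand hθ hL hkN hD w hΦp hΦm v v₀ a.1
      (Finset.mem_product.1 ha).2 hX hc
  · intro a ha c hcP hct
    obtain ⟨X, hX⟩ := hpole c hcP
    -- A point of the contour cannot belong to the scaled particle interval, which is enclosed.
    refine edgeResidue_eq_zero hθ w Φp Φm v v₀ a.1 (Finset.mem_product.1 ha).2 hX fun hXI => ?_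
    have hcL : c = ((X / L : ℝ) : ℂ) := by
      rw [Complex.ofReal_div, ← hX]
      field_simp
    have := hγI (X / L) ⟨by
      rw [← neg_div]
      refine div_le_div_of_nonneg_right ?_ hL.le
      linarith [hXI.1], div_le_div_of_nonneg_right hXI.2 hL.le⟩
    rw [← hcL] at this
    exact this.1 hct
  · intro c hcP hc
    obtain ⟨X, hX⟩ := hpole c hcP
    rw [Finset.sum_product]
    exact sum_edgeResidue_eq_zero hθ hL hw hΦ v hv v₀ hX

theorem contourIntegral_edgeIntegrand {θ : ℝ} {w : ℝ → ℝ}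
    (hP : ∑ ω : State N k M, prob θ w ω = 1) (L : ℝ) (Φp Φm : ℂ → ℂ)
    (v : (j : ℕ) → Fin (m j) → ℂ) (v₀ : ℂ) (γ : ℝ → ℂ)
    (F : (j : Level k N) → Finset (Fin (m j.1))) (j : ℕ) :
    contourIntegral γ (edgeIntegrand M θ L w Φp Φm v v₀ (Finset.univ.sigma F) j) =
      fullBelow F j * contourIntegral γ (fun z =>
        (if j = N + 1 then Φm (L * z) else Φp (L * z)) /
          (2 * Real.pi * Complex.I * auxS N M θ L v₀ (L * z)) * kernelFrom L v F j z *
            cumulantWith (M := M) θ L w v F (edgeObs θ j (L * z))) := by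
  rw [← contourIntegral_const_mul]
  refine contourIntegral_congr fun z _ => ?_
  rw [edgeIntegrand, edgePrefactor, ← fullBelow_mul_kernelFrom, cumulantWith_eq_sum hP]
  ring

/-- The identity between the cumulants, in terms of the observables of the edges. -/
theorem sum_edge_eq {θ : ℝ} {w : ℝ → ℝ} (hkN : k ≤ N)
    (hP : ∑ ω : State N k M, prob θ w ω = 1) (L : ℝ) (Φp Φm : ℂ → ℂ)
    (v : (j : ℕ) → Fin (m j) → ℂ) (v₀ : ℂ) (γ : ℝ → ℂ)
    (F : (j : Level k N) → Finset (Fin (m j.1))) :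
    ∑ j ∈ Finset.Icc k (N + 1),
        contourIntegral γ (edgeIntegrand M θ L w Φp Φm v v₀ (Finset.univ.sigma F) j) =
      fullBelow F (N + 1) * contourIntegral γ (fun z =>
        Φm (L * z) / (2 * Real.pi * Complex.I * auxS N M θ L v₀ (L * z)) *
          cumulantWith (M := M) θ L w v F (topObs θ (L * z))) +
      contourIntegral γ (fun z =>
        Φp (L * z) / (2 * Real.pi * Complex.I * auxS N M θ L v₀ (L * z)) *
          kernelFrom L v F k z * cumulantWith (M := M) θ L w v F (bottomObs θ (L * z))) +
      ∑ n ∈ Finset.Ico k N, fullBelow F (n + 1) * contourIntegral γ (fun z =>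
        Φp (L * z) / (2 * Real.pi * Complex.I * auxS N M θ L v₀ (L * z)) *
          kernelFrom L v F (n + 1) z *
            cumulantWith (M := M) θ L w v F (edgeObs θ (n + 1) (L * z))) := by
  have hIcc : Finset.Icc k (N + 1) = Finset.Ico k (N + 2) := by
    ext
    simp only [Finset.mem_Icc, Finset.mem_Ico]
    omega
  simp only [contourIntegral_edgeIntegrand hP]
  rw [hIcc, Finset.sum_eq_sum_Ico_succ_bot (by omega), Finset.sum_Ico_succ_top (by omega),
    ← Finset.sum_Ico_add']
  have hbot : ∀ u : ℂ, edgeObs (N := N) (k := k) (M := M) θ k u = bottomObs θ u := fun u =>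
    funext fun ω => if_pos rfl
  have htop : ∀ u : ℂ, edgeObs (N := N) (k := k) (M := M) θ (N + 1) u = topObs θ u := fun u =>
    funext fun ω => by rw [edgeObs, if_neg (by omega), if_pos rfl]
  simp only [fullBelow_bot, one_mul, hbot, htop, kernelFrom_top, mul_one, if_true,
    if_neg (show k ≠ N + 1 by omega)]
  have hperm : ∀ a b c c' : ℂ, c = c' → a + (c + b) = b + a + c' := by
    rintro a b c _ rfl
    ring
  refine hperm _ _ _ _ (Finset.sum_congr rfl fun n hn => ?_)
  simp only [if_neg (show n + 1 ≠ N + 1 by have := Finset.mem_Ico.1 hn; omega)]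

end States

end BetaCorners

end

/-! ### The identity for the two cases of `θ` -/

theorem lemma3p3
    -- the measure
    (N k M : ℕ) (hk : 1 ≤ k) (hkN : k ≤ N) (θ : ℝ) (hθ : 0 < θ)
    (w : ℝ → ℝ) (hw : ∀ x ∈ Set.Icc (-(N * θ)) (M - θ), 0 < w x)
    -- the assumption on the ratios of the weight
    (D : Set ℂ) (hD : IsOpen D)
    (hDI : ∀ x ∈ Set.Icc (-(N * θ)) (M + 1 - θ), (x : ℂ) ∈ D)
    (Φp Φm : ℂ → ℂ) (hΦp : DifferentiableOn ℂ Φp D) (hΦm : DifferentiableOn ℂ Φm D)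
    (hΦ : ∀ x ∈ Set.Icc (-(N * θ) + 1) (M - θ),
      ((w x / w (x - 1) : ℝ) : ℂ) = Φp x / Φm x)
    -- the parameters
    (L : ℝ) (hL : 0 < L) (m : ℕ → ℕ) (v : (j : ℕ) → Fin (m j) → ℂ)
    (hv : ∀ j ∈ Finset.Icc k N, ∀ i : Fin (m j), (L : ℂ) * v j i ∈ D ∧
      ∀ x ∈ Set.Icc (-(N * θ)) (M - θ), (L : ℂ) * v j i ≠ (x : ℂ))
    -- the contour
    (γ : ℝ → ℂ) (hγ : BetaCorners.IsPositiveSimpleContour γ)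
    (hγD : ∀ z ∈ BetaCorners.trace γ ∪ BetaCorners.inside γ, (L : ℂ) * z ∈ D)
    (hγI : ∀ x ∈ Set.Icc (-(θ * N / L)) ((M - θ) / L), (x : ℂ) ∈ BetaCorners.inside γ)
    (hγv : ∀ j ∈ Finset.Icc k N, ∀ i : Fin (m j), v j i ∈ BetaCorners.outside γ ∧
      v j i + (L : ℂ)⁻¹ ∈ BetaCorners.outside γ)
    (v₀ : ℂ) (hv₀ : v₀ ∈ BetaCorners.outside γ) :
    (θ ≠ 1 →
      0 = ∑ F : (j : BetaCorners.Level k N) → Finset (Fin (m j.1)),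
        (BetaCorners.fullBelow F (N + 1) *
            BetaCorners.contourIntegral γ (fun z =>
              Φm (L * z) / (2 * Real.pi * Complex.I * BetaCorners.auxS N M θ L v₀ (L * z)) *
              BetaCorners.cumulantWith (M := M) θ L w v F (BetaCorners.topObs θ (L * z))) +
          BetaCorners.contourIntegral γ (fun z =>
              Φp (L * z) / (2 * Real.pi * Complex.I * BetaCorners.auxS N M θ L v₀ (L * z)) *
              BetaCorners.kernelFrom L v F k z *
              BetaCorners.cumulantWith (M := M) θ L w v F (BetaCorners.bottomObs θ (L * z))) +
          (θ : ℂ) / (1 - θ) * ∑ n ∈ Finset.Ico k N, BetaCorners.fullBelow F (n + 1) *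
            BetaCorners.contourIntegral γ (fun z =>
              Φp (L * z) / (2 * Real.pi * Complex.I * BetaCorners.auxS N M θ L v₀ (L * z)) *
              BetaCorners.kernelFrom L v F (n + 1) z *
              BetaCorners.cumulantWith (M := M) θ L w v F
                (BetaCorners.middleObs θ n (L * z))))) ∧
    (θ = 1 →
      0 = ∑ F : (j : BetaCorners.Level k N) → Finset (Fin (m j.1)),
        (BetaCorners.fullBelow F (N + 1) *
            BetaCorners.contourIntegral γ (fun z =>
              Φm (L * z) / (2 * Real.pi * Complex.I * BetaCorners.auxS N M θ L v₀ (L * z)) *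
              BetaCorners.cumulantWith (M := M) θ L w v F (BetaCorners.topObs θ (L * z))) +
          BetaCorners.contourIntegral γ (fun z =>
              Φp (L * z) / (2 * Real.pi * Complex.I * BetaCorners.auxS N M θ L v₀ (L * z)) *
              BetaCorners.kernelFrom L v F k z *
              BetaCorners.cumulantWith (M := M) θ L w v F (BetaCorners.bottomObs θ (L * z))) +
          ∑ n ∈ Finset.Ico k N, BetaCorners.fullBelow F (n + 1) *
            BetaCorners.contourIntegral γ (fun z =>
              Φp (L * z) / (2 * Real.pi * Complex.I * BetaCorners.auxS N M θ L v₀ (L * z)) *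
              BetaCorners.kernelFrom L v F (n + 1) z *
              BetaCorners.cumulantWith (M := M) θ L w v F
                (BetaCorners.middleObsOne θ n (L * z))))) := by
  have hP := BetaCorners.sum_prob (M := M) hθ hkN hw
  have key := BetaCorners.sum_contourIntegral_edgeIntegrand hkN hθ hw hD hΦp hΦm hΦ hL v
    (fun j hj i => (hv j hj i).2) hγ hγD hγI hγv hv₀
  rw [← BetaCorners.sum_pi_finset_eq] at key
  refine ⟨fun hθ1 => ?_, fun hθ1 => ?_⟩
  · rw [← key]
    refine Finset.sum_congr rfl fun F _ => ?_
    rw [BetaCorners.sum_edge_eq hkN hP, Finset.mul_sum]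
    refine congrArg₂ (· + ·) rfl (Finset.sum_congr rfl fun n hn => ?_)
    rw [Finset.mem_Ico] at hn
    -- The edge observable contains the constant `θ / (1 - θ)`; linearity of the cumulant in `ξ` and
    -- of the integral lets it be taken out.
    have hobs : ∀ u : ℂ, BetaCorners.edgeObs (N := N) (k := k) (M := M) θ (n + 1) u =
        fun ω => (θ : ℂ) / (1 - θ) * BetaCorners.middleObs θ n u ω := fun u => funext fun ω => by
      rw [BetaCorners.edgeObs, if_neg (by omega), if_neg (by omega), if_neg hθ1,
        Nat.add_sub_cancel]
    rw [mul_left_comm]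
    congr 1
    rw [← BetaCorners.contourIntegral_const_mul]
    refine BetaCorners.contourIntegral_congr fun z _ => ?_
    rw [hobs, BetaCorners.cumulantWith_eq_sum hP, BetaCorners.cumulantWith_eq_sum hP]
    simp only [Finset.mul_sum]
    refine Finset.sum_congr rfl fun ω _ => ?_
    ring
  · rw [← key]
    refine Finset.sum_congr rfl fun F _ => ?_
    rw [BetaCorners.sum_edge_eq hkN hP]
    refine congrArg₂ (· + ·) rfl (Finset.sum_congr rfl fun n hn => ?_)
    rw [Finset.mem_Ico] at hn
    have hobs : ∀ u : ℂ, BetaCorners.edgeObs (N := N) (k := k) (M := M) θ (n + 1) u =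
        BetaCorners.middleObsOne θ n u := fun u => funext fun ω => by
      rw [BetaCorners.edgeObs, if_neg (by omega), if_neg (by omega), if_pos hθ1,
        Nat.add_sub_cancel]
    simp only [hobs]
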